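/- **Games.** An $m$-player $n$-action normal-form game ($m\ge 2$, $n\ge 1$) is given by utilities $u_i(a)\in[0,1]$ for each player $i\in[m]$ and each action profile $a=(a_1,\dots,a_m)\in[n]^m$; its description is an array of $m\,n^m$ real numbers. For $\varepsilon>0$, a probability distribution $\mathcal D$ on $[n]^m$ is an $\varepsilon$-approximate correlated equilibrium if for every player $i$ and every swap function $\phi:[n]\to[n]$, $$\mathbb E_{a\sim\mathcal D}[u_i(a_i;a_{-i})]\ \ge\ \mathbb E_{a\sim\mathcal D}[u_i(\phi(a_i);a_{-i})]-\varepsilon .$$ **Model.** Algorithms are programs for a randomized real RAM: registers and memory for natural numbers (addition, subtraction, comparison, indirect addressing) and for real numbers (addition, subtraction, multiplication, division, comparison; no conversion of a real to an integer), random read access to the array of utilities, and fair coin tosses; each operation costs one step. The input is $m$, $n$ and the array of utilities. The output is a number $T\ge 1$ together with mixed strategies $p_{t,i}\in\Delta_n$ ($t\in[T]$, $i\in[m]$) written in memory; it represents the distribution $\frac1T\sum_{t\in[T]}p_{t,1}\otimes\cdots\otimes p_{t,m}$. **Statement.** There are a universal constant $C>0$ and a function $\omega:\mathbb N\to\mathbb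 R$ with $\omega(N)\to\infty$ as $N\to\infty$ such that for every $\varepsilon>0$ there is a randomized algorithm with a running time bound $\mathrm{time}(m,n)$ (valid for all $m\ge2$, $n\ge1$, all games and all outcomes of the coin tosses) with the following properties. 1. For all $m\ge 2$, $n\ge1$ and every $m$-player $n$-action game, the algorithm outputs an $\varepsilon$-approximate correlated equilibrium with probability at least $1-1/(mn)^{\omega(mn)}$. 2. The running time is $mn(\log(mn))^{O(1/\varepsilon)}$: there is $c_\varepsilon$ with $\mathrm{time}(m,n)\le c_\varepsilon\, mn\,(\log(mn))^{C/\varepsilon}$ for all $m\ge2$, $n\ge1$; and whenever $\varepsilon\ge 1/\log n$ (that is, $n\ge 2$ and $1/\varepsilon\le\log n$), $\mathrm{time}(m,n)\le C\,mn\,(\log(mn))^{C/\varepsilon}$, with the same universal constant $C$. 3. This is sublinear in the size of the description of the game: for every $\delta>0$ there is $N$ such that $\mathrm{time}(m,n)\le\delta\, m\,n^m$ for all $m,n\ge 2$ with $mn\ge N$. -/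

import Mathlib

open Filter MeasureTheory

/-! ### Games and correlated equilibria -/

/-- An `m`-player normal-form game, every player having the `n` actions `Fin n`, with utilities
in `[0, 1]`. -/
structure Game (m n : ℕ) where
  /-- `u i a` is the utility of player `i` at the action profile `a`. -/
  u : Fin m → (Fin m → Fin n) → ℝ
  u_mem : ∀ i a, u i a ∈ Set.Icc (0 : ℝ) 1

/-- `D` is (the mass function of) a probability distribution on action profiles which is an
`ε`-correlated equilibrium: no player gains more than `ε` in expectation by applying a swap
function `φ` to the recommended action. -/
def Game.IsCorrelatedEq {m n : ℕ} (G : Game m n) (ε : ℝ) (D : (Fin m → Fin n) → ℝ) : Prop :=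
  D ∈ stdSimplex ℝ (Fin m → Fin n) ∧
    ∀ (i : Fin m) (φ : Fin n → Fin n),
      ∑ a, D a * G.u i (Function.update a i (φ (a i))) - ε ≤ ∑ a, D a * G.u i a

/-- The description of a game, as an array of `m * n ^ m` real numbers: the utility `u i a` stands
in cell `i * n ^ m + ∑ j, a j * n ^ j`. Beyond the end of the array one reads `0`. -/
noncomputable def Game.table {m n : ℕ} (G : Game m n) (k : ℕ) : ℝ :=
  if h : k < m * n ^ m then
    G.u (finProdFinEquiv.symm ⟨k, h⟩).1 (finFunctionFinEquiv.symm (finProdFinEquiv.symm ⟨k, h⟩).2)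
  else 0

theorem Game.table_apply {m n : ℕ} (G : Game m n) (i : Fin m) (a : Fin m → Fin n) :
    G.table ((i : ℕ) * n ^ m + ∑ j : Fin m, (a j : ℕ) * n ^ (j : ℕ)) = G.u i a := by
  have h : (i : ℕ) * n ^ m + ∑ j : Fin m, (a j : ℕ) * n ^ (j : ℕ)
      = (finProdFinEquiv (i, finFunctionFinEquiv a) : Fin (m * n ^ m)) := by
    simp [finProdFinEquiv, finFunctionFinEquiv_apply_val, add_comm, mul_comm]
  rw [h, Game.table, dif_pos (Fin.isLt _)]
  simp only [Fin.eta, Equiv.symm_apply_apply]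

/-! ### The machine: a randomized random access machine with real registers

Natural-number registers and memory serve for counting and addressing; on them the machine can only
add, subtract and compare. Real registers and memory admit exact arithmetic and comparison; a real
number can not be converted back to a natural number. The input table is read-only, with random
access. A fair coin can be tossed. Programs are structured (branching and loops). -/

/-- A state of the machine. -/
structure RAMState where
  /-- natural-number registers -/
  reg : ℕ → ℕ
  /-- real registers -/
  xreg : ℕ → ℝ
  /-- natural-number memory, addressed through the natural-number registers -/
  mem : ℕ → ℕ
  /-- real memory, addressed through the natural-number registers -/
  xmem : ℕ → ℝ
  /-- number of coins tossed so far -/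
  pos : ℕ

/-- Elementary instructions; the arguments are names of registers, except for `c` in `const`,
which is a literal. The destination comes first. -/
inductive RAMInstr where
  | const (d c : ℕ)
  | add (d a b : ℕ)
  | sub (d a b : ℕ)
  | load (d a : ℕ)
  | store (a s : ℕ)
  | cast (d a : ℕ)
  | xadd (d a b : ℕ)
  | xsub (d a b : ℕ)
  | xmul (d a b : ℕ)
  | xdiv (d a b : ℕ)
  | xload (d a : ℕ)
  | xstore (a s : ℕ)
  | input (d a : ℕ)
  | coin (d : ℕ)

/-- Effect of an instruction, given the input table and the sequence of coin tosses.
(Natural-number subtraction is truncated, real division by `0` yields `0`.) -/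
noncomputable def RAMInstr.run (table : ℕ → ℝ) (coins : ℕ → Bool) (s : RAMState) :
    RAMInstr → RAMState
  | .const d c => { s with reg := Function.update s.reg d c }
  | .add d a b => { s with reg := Function.update s.reg d (s.reg a + s.reg b) }
  | .sub d a b => { s with reg := Function.update s.reg d (s.reg a - s.reg b) }
  | .load d a => { s with reg := Function.update s.reg d (s.mem (s.reg a)) }
  | .store a r => { s with mem := Function.update s.mem (s.reg a) (s.reg r) }
  | .cast d a => { s with xreg := Function.update s.xreg d (s.reg a : ℝ) }
  | .xadd d a b => { s with xreg := Function.update s.xreg d (s.xreg a + s.xreg b) }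
  | .xsub d a b => { s with xreg := Function.update s.xreg d (s.xreg a - s.xreg b) }
  | .xmul d a b => { s with xreg := Function.update s.xreg d (s.xreg a * s.xreg b) }
  | .xdiv d a b => { s with xreg := Function.update s.xreg d (s.xreg a / s.xreg b) }
  | .xload d a => { s with xreg := Function.update s.xreg d (s.xmem (s.reg a)) }
  | .xstore a r => { s with xmem := Function.update s.xmem (s.reg a) (s.xreg r) }
  | .input d a => { s with xreg := Function.update s.xreg d (table (s.reg a)) }
  | .coin d =>
      { s with
        reg := Function.update s.reg d (if coins s.pos then 1 else 0)
        pos := s.pos + 1 }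

/-- Tests: comparison of two natural-number registers, or of two real registers. -/
inductive RAMTest where
  | le (a b : ℕ)
  | xle (a b : ℕ)

/-- The test succeeds in the state `s`. -/
def RAMTest.Holds (s : RAMState) : RAMTest → Prop
  | .le a b => s.reg a ≤ s.reg b
  | .xle a b => s.xreg a ≤ s.xreg b

/-- Programs (finite objects). -/
inductive RAMProg where
  | skip
  | instr (c : RAMInstr)
  | seq (p q : RAMProg)
  | ite (b : RAMTest) (p q : RAMProg)
  | loop (b : RAMTest) (p : RAMProg)

/-- `RAMProg.Exec table coins p s s' t`: started in the state `s`, the program `p` halts in the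
state `s'` after `t` steps. Every instruction and every evaluation of a test is one step. -/
inductive RAMProg.Exec (table : ℕ → ℝ) (coins : ℕ → Bool) :
    RAMProg → RAMState → RAMState → ℕ → Prop where
  | skip (s : RAMState) : Exec table coins .skip s s 0
  | instr (c : RAMInstr) (s : RAMState) :
      Exec table coins (.instr c) s (c.run table coins s) 1
  | seq {p q : RAMProg} {s s' s'' : RAMState} {t t' : ℕ} :
      Exec table coins p s s' t → Exec table coins q s' s'' t' →
      Exec table coins (.seq p q) s s'' (t + t')
  | ite_pos {b : RAMTest} {p q : RAMProg} {s s' : RAMState} {t : ℕ} :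
      b.Holds s → Exec table coins p s s' t → Exec table coins (.ite b p q) s s' (t + 1)
  | ite_neg {b : RAMTest} {p q : RAMProg} {s s' : RAMState} {t : ℕ} :
      ¬ b.Holds s → Exec table coins q s s' t → Exec table coins (.ite b p q) s s' (t + 1)
  | loop_done {b : RAMTest} {p : RAMProg} {s : RAMState} :
      ¬ b.Holds s → Exec table coins (.loop b p) s s 1
  | loop_step {b : RAMTest} {p : RAMProg} {s s' s'' : RAMState} {t t' : ℕ} :
      b.Holds s → Exec table coins p s s' t → Exec table coins (.loop b p) s' s'' t' →
      Exec table coins (.loop b p) s s'' (t + t' + 1)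

/-- Given the coins, final state and running time are determined. -/
theorem RAMProg.Exec.unique {table : ℕ → ℝ} {coins : ℕ → Bool} {p : RAMProg}
    {s s₁ s₂ : RAMState} {t₁ t₂ : ℕ} (h₁ : RAMProg.Exec table coins p s s₁ t₁)
    (h₂ : RAMProg.Exec table coins p s s₂ t₂) : s₁ = s₂ ∧ t₁ = t₂ := by
  induction h₁ generalizing s₂ t₂ with
  | skip s => cases h₂; exact ⟨rfl, rfl⟩
  | instr c s => cases h₂; exact ⟨rfl, rfl⟩
  | seq _ _ ih ih' =>
    cases h₂ with
    | seq a b =>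
      obtain ⟨rfl, rfl⟩ := ih a
      obtain ⟨rfl, rfl⟩ := ih' b
      exact ⟨rfl, rfl⟩
  | ite_pos hb _ ih =>
    cases h₂ with
    | ite_pos _ a => obtain ⟨rfl, rfl⟩ := ih a; exact ⟨rfl, rfl⟩
    | ite_neg hb' _ => exact absurd hb hb'
  | ite_neg hb _ ih =>
    cases h₂ with
    | ite_pos hb' _ => exact absurd hb' hb
    | ite_neg _ a => obtain ⟨rfl, rfl⟩ := ih a; exact ⟨rfl, rfl⟩
  | loop_done hb =>
    cases h₂ with
    | loop_done _ => exact ⟨rfl, rfl⟩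
    | loop_step hb' _ _ => exact absurd hb' hb
  | loop_step hb _ _ ih ih' =>
    cases h₂ with
    | loop_done hb' => exact absurd hb hb'
    | loop_step _ a b =>
      obtain ⟨rfl, rfl⟩ := ih a
      obtain ⟨rfl, rfl⟩ := ih' b
      exact ⟨rfl, rfl⟩

/-- The initial state on a game with `m` players and `n` actions: register `0` holds `m`,
register `1` holds `n`, everything else is `0`. -/
def RAMState.init (m n : ℕ) : RAMState where
  reg := fun k => if k = 0 then m else if k = 1 then n else 0
  xreg := fun _ => 0
  mem := fun _ => 0
  xmem := fun _ => 0
  pos := 0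

/-- A run of `p` on the game `G` with the given coins halts in the state `s` after `t` steps. -/
def RAMProg.RunsOn {m n : ℕ} (p : RAMProg) (G : Game m n) (coins : ℕ → Bool)
    (s : RAMState) (t : ℕ) : Prop :=
  RAMProg.Exec G.table coins p (RAMState.init m n) s t

/-! ### Output: a uniform mixture of product distributions -/

/-- The mixed strategy of player `i` in the `t`-th product distribution that is written in the
real memory. -/
def RAMState.strategy (s : RAMState) {m n : ℕ} (t : ℕ) (i : Fin m) (j : Fin n) : ℝ :=
  s.xmem (t * (m * n) + (i : ℕ) * n + (j : ℕ))

/-- The distribution on action profiles that a final state describes: with `T` the content of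
register `0`, the average over `t < T` of the products of the `m` mixed strategies of index `t`. -/
noncomputable def RAMState.mixture (s : RAMState) (m n : ℕ) (a : Fin m → Fin n) : ℝ :=
  (1 / (s.reg 0 : ℝ)) * ∑ t ∈ Finset.range (s.reg 0), ∏ i : Fin m, s.strategy t i (a i)

/-- The final state `s` is a well-formed output and describes an `ε`-correlated equilibrium. -/
def RAMState.IsSolution (s : RAMState) {m n : ℕ} (G : Game m n) (ε : ℝ) : Prop :=
  0 < s.reg 0 ∧
    (∀ t < s.reg 0, ∀ i : Fin m, (fun j : Fin n => s.strategy t i j) ∈ stdSimplex ℝ (Fin n)) ∧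
    G.IsCorrelatedEq ε (s.mixture m n)

/-- The law of an infinite sequence of independent fair coin tosses. -/
noncomputable def fairCoins : Measure (ℕ → Bool) :=
  Measure.infinitePi fun _ => (PMF.uniformOfFintype Bool).toMeasure

/-- The probability that `p`, run on `G`, halts and outputs an `ε`-correlated equilibrium. -/
noncomputable def RAMProg.successProb {m n : ℕ} (p : RAMProg) (G : Game m n) (ε : ℝ) : ℝ :=
  fairCoins.real {coins | ∃ s t, p.RunsOn G coins s t ∧ s.IsSolution G ε}

/-! ### Multiplicative weights on a tree -/

/-! If every player has small average swap regret over `T` rounds, then the uniform mixture of the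
`T` product distributions is an approximate correlated equilibrium (`isSolution_of_swap_regret`). So
each player needs a strategy with average swap regret O(1/D), where D is of order 1/ε.

Such a strategy comes from a tree of depth D and arity M over M^D rounds. Level h cuts the rounds
into blocks of length M^h. It keeps one mixed strategy during a block and updates it by
multiplicative weights from block to block, restarting with every new block of level h + 1. The
player mixes the D levels uniformly. While a level-h strategy is frozen, any swap of it earns at
most what the best fixed action of that block earns. On the other hand, multiplicative weights earn,
up to regret, what the best fixed action of the enclosing block earns. Summed over the levels the
gaps telescope to at most 1 plus D regrets of size 3/D (`subtree_swap_regret`), and division by D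
leaves 4/D (`treeStrategy_swap_regret`). With L = clog m + clog n, arity M = D²L suffices, so there
are only (D²L)^D rounds.

Exact expected utilities would need all the profiles. Instead every round samples K profiles and
reads, for each of them, the mn utilities of unilateral deviations. The regret bound holds for
arbitrary reward sequences, hence for these estimates. The strategies of a round depend on earlier
samples only, so a Chernoff bound for the fresh samples and a union bound make all estimates
accurate to 1/D (`card_not_accurate_le`, `failure_le`). This costs another 2/D, in total 6/D.

As the machine cannot round reals, mixed strategies are stored as tables of cells that are filled by
comparing partial sums. The number of cells is a power of two, so coins select one exactly
uniformly. The program is verified against a recursion that computes the estimates from the coins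
(`reward`, `treeProg_runs`, `equilibriumProg_runs`), and its time is at most mn(DL)^(5D)
(`equilibriumTime_le`). For ε ≥ 1 any pure profile will do. -/

theorem sum_range_mul_block {α : Type*} [AddCommMonoid α] (f : ℕ → α) (a b : ℕ) :
    ∑ t ∈ Finset.range (a * b), f t
      = ∑ c ∈ Finset.range a, ∑ j ∈ Finset.range b, f (c * b + j) := by
  induction a with
  | zero => simp
  | succ a ih => rw [Nat.succ_mul, Finset.sum_range_add, ih, Finset.sum_range_succ]

/-- Average of `r` over the `c`-th block of length `M ^ h`. -/
noncomputable def blockAvg (M : ℕ) (r : ℕ → ℝ) : ℕ → ℕ → ℝ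
  | 0, c => r c
  | h + 1, c => ∑ i ∈ Finset.range M, blockAvg M r h (c * M + i) * (1 / M)

/-- The multiplicative weight of an action with rewards `r`, at level `h`, before the `c`-th block
of that level. -/
noncomputable def treeWeight (M : ℕ) (η : ℝ) (r : ℕ → ℝ) (h c : ℕ) : ℝ :=
  ∏ i ∈ Finset.range (c % M), (1 + η * blockAvg M r h (c / M * M + i))

/-- The number of cells, of a table with `G` cells, that the first `j` of `n` weights receive. -/
noncomputable def cellCount (w : ℕ → ℝ) (n G j : ℕ) : ℕ :=
  ⌊(G : ℝ) * (∑ i ∈ Finset.range j, w i) / ∑ i ∈ Finset.range n, w i⌋₊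

/-- A table of `G` actions in which the multiplicities are roughly proportional to `w`. -/
noncomputable def roundTable (w : ℕ → ℝ) (n G k : ℕ) : ℕ :=
  ((Finset.range n).filter fun j => cellCount w n G (j + 1) ≤ k).card

/-- The table at level `h` in the `c`-th block of that level. -/
noncomputable def levelTable (M : ℕ) (η : ℝ) (n G : ℕ) (r : ℕ → ℕ → ℝ) (h c k : ℕ) : ℕ :=
  roundTable (fun j => treeWeight M η (fun t => r t j) h c) n G k

/-- The strategy at time `t` is uniform over the tables of all the levels. -/
noncomputable def treeStrategy (M : ℕ) (η : ℝ) (n G : ℕ) (r : ℕ → ℕ → ℝ) (t idx : ℕ) : ℕ :=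
  levelTable M η n G r (idx / G) (t / M ^ (idx / G)) (idx % G)

/-! ### Rounding a mixed strategy to a table of cells -/

section Rounding

variable {w : ℕ → ℝ} {n G : ℕ}

theorem sum_weights_pos (hw : ∀ j < n, 0 < w j) (hn : 0 < n) :
    0 < ∑ i ∈ Finset.range n, w i :=
  Finset.sum_pos (fun i hi => hw i (Finset.mem_range.1 hi)) ⟨0, Finset.mem_range.2 hn⟩

theorem sum_weights_mono (hw : ∀ j < n, 0 < w j) {a b : ℕ} (hab : a ≤ b) (hb : b ≤ n) :
    ∑ i ∈ Finset.range a, w i ≤ ∑ i ∈ Finset.range b, w i := by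
  apply Finset.sum_le_sum_of_subset_of_nonneg (Finset.range_subset_range.2 hab)
  intro i hi _
  exact (hw i ((Finset.mem_range.1 hi).trans_le hb)).le

theorem cellCount_mono (hw : ∀ j < n, 0 < w j) {a b : ℕ} (hab : a ≤ b) (hb : b ≤ n) :
    cellCount w n G a ≤ cellCount w n G b := by
  apply Nat.floor_mono
  have h0 : 0 ≤ ∑ i ∈ Finset.range n, w i := by
    simpa using sum_weights_mono hw (Nat.zero_le n) le_rfl
  have := sum_weights_mono hw hab hb
  gcongr

theorem cellCount_zero : cellCount w n G 0 = 0 := by simp [cellCount]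

theorem cellCount_self (hw : ∀ j < n, 0 < w j) (hn : 0 < n) : cellCount w n G n = G := by
  rw [cellCount, mul_div_assoc, div_self (sum_weights_pos hw hn).ne']
  simp

/-- Comparison with the floor is a comparison of two reals without division, which is the test that
the machine can carry out although it cannot round. -/
theorem lt_cellCount_iff (hw : ∀ j < n, 0 < w j) (hn : 0 < n) {j k : ℕ} :
    k < cellCount w n G j ↔
      ((k : ℝ) + 1) * ∑ i ∈ Finset.range n, w i ≤ (G : ℝ) * ∑ i ∈ Finset.range j, w i := by
  have h0 := sum_weights_pos hw hn
  rw [← Nat.add_one_le_iff, cellCount, Nat.le_floor_iff' (by omega), le_div_iff₀ h0]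
  push_cast
  rfl

/-- The cell counts are monotone, so the table is a sequence of intervals, one per action. -/
theorem roundTable_eq (hw : ∀ j < n, 0 < w j) {j k : ℕ} (hj : j < n)
    (h1 : cellCount w n G j ≤ k) (h2 : k < cellCount w n G (j + 1)) :
    roundTable w n G k = j := by
  have : ((Finset.range n).filter fun j => cellCount w n G (j + 1) ≤ k) = Finset.range j := by
    ext i
    simp only [Finset.mem_filter, Finset.mem_range]
    constructor
    · rintro ⟨hi, hik⟩
      by_contra hji
      have := cellCount_mono (G := G) hw (a := j + 1) (b := i + 1) (by omega) (by omega)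
      omega
    · intro hi
      have := cellCount_mono (G := G) hw (a := i + 1) (b := j) (by omega) (by omega)
      exact ⟨by omega, by omega⟩
  rw [roundTable, this, Finset.card_range]

theorem roundTable_lt (hw : ∀ j < n, 0 < w j) (hn : 0 < n) {k : ℕ} (hk : k < G) :
    roundTable w n G k < n := by
  rw [roundTable]
  calc _ < (Finset.range n).card := by
        apply Finset.card_lt_card
        refine Finset.filter_ssubset.2 ⟨n - 1, Finset.mem_range.2 (by omega), ?_⟩
        rw [Nat.sub_add_cancel hn, cellCount_self hw hn]
        omega
    _ = n := Finset.card_range n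

theorem sum_roundTable_prefix (hw : ∀ j < n, 0 < w j) (f : ℕ → ℝ) {j : ℕ} (hj : j ≤ n) :
    ∑ k ∈ Finset.range (cellCount w n G j), f (roundTable w n G k)
      = ∑ i ∈ Finset.range j,
          ((cellCount w n G (i + 1) : ℝ) - cellCount w n G i) * f i := by
  induction j with
  | zero => simp [cellCount_zero]
  | succ j ih =>
    have hm := cellCount_mono (G := G) hw (Nat.le_succ j) hj
    rw [Finset.sum_range_succ, ← ih (by omega), ← Finset.sum_range_add_sum_Ico _ hm]
    congr 1
    rw [Finset.sum_congr rfl (g := fun _ => f j), Finset.sum_const, Nat.card_Ico, nsmul_eq_mul,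
      Nat.cast_sub hm]
    intro k hk
    rw [Finset.mem_Ico] at hk
    rw [roundTable_eq hw (by omega) hk.1 hk.2]

/-- Rounding costs each action at most one cell, hence at most `n` in the total of rewards from [0,
1]. -/
theorem sum_roundTable_ge (hw : ∀ j < n, 0 < w j) (hn : 0 < n) (f : ℕ → ℝ)
    (hf : ∀ j < n, 0 ≤ f j ∧ f j ≤ 1) :
    (G : ℝ) * ((∑ j ∈ Finset.range n, w j * f j) / ∑ j ∈ Finset.range n, w j) - n
      ≤ ∑ k ∈ Finset.range G, f (roundTable w n G k) := by
  have h := sum_roundTable_prefix (G := G) hw f le_rfl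
  rw [cellCount_self hw hn] at h
  rw [h, Finset.sum_div, Finset.mul_sum]
  have hnn : (n : ℝ) = ∑ j ∈ Finset.range n, (1 : ℝ) := by simp
  rw [hnn, ← Finset.sum_sub_distrib]
  apply Finset.sum_le_sum
  intro j hj
  have hj := Finset.mem_range.1 hj
  have h0 := sum_weights_pos hw hn
  set tot := ∑ i ∈ Finset.range n, w i
  -- The floor is estimated from below at the right end and from above at the left end, so the two
  -- errors together stay below one cell.
  have hlo : (G : ℝ) * (∑ i ∈ Finset.range (j + 1), w i) / tot - 1 < cellCount w n G (j + 1) :=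
    Nat.sub_one_lt_floor _
  have hhi : (cellCount w n G j : ℝ) ≤ (G : ℝ) * (∑ i ∈ Finset.range j, w i) / tot := by
    apply Nat.floor_le
    have := sum_weights_mono hw (Nat.zero_le j) hj.le
    rw [Finset.sum_range_zero] at this
    positivity
  rw [Finset.sum_range_succ, mul_add, add_div] at hlo
  have hd : (G : ℝ) * w j / tot - 1 ≤ (cellCount w n G (j + 1) : ℝ) - cellCount w n G j := by
    linarith
  have e : (G : ℝ) * (w j * f j / tot) = (G : ℝ) * w j / tot * f j := by ring
  rw [e]
  nlinarith [hf j hj]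

end Rounding

/-! ### Regret of multiplicative weights -/

/-- Termwise log(1 + x) ≥ x / (1 + x) ≥ x - x², with x = ηR ≤ η. -/
theorem log_prod_one_add_ge (η : ℝ) (hη : 0 < η) (M : ℕ) (R : ℕ → ℝ)
    (hR : ∀ i < M, 0 ≤ R i ∧ R i ≤ 1) :
    η * ∑ i ∈ Finset.range M, R i - η ^ 2 * M
      ≤ Real.log (∏ i ∈ Finset.range M, (1 + η * R i)) := by
  rw [Real.log_prod]
  · rw [Finset.mul_sum]
    have : η ^ 2 * (M : ℝ) = ∑ i ∈ Finset.range M, η ^ 2 := by simp [mul_comm]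
    rw [this, ← Finset.sum_sub_distrib]
    apply Finset.sum_le_sum
    intro i hi
    obtain ⟨h0, h1⟩ := hR i (Finset.mem_range.1 hi)
    have hx : 0 ≤ η * R i := by positivity
    have hxη : η * R i ≤ η := by nlinarith
    have h2 := Real.one_sub_inv_le_log_of_pos (x := 1 + η * R i) (by linarith)
    have h3 : η * R i - (η * R i) ^ 2 ≤ 1 - (1 + η * R i)⁻¹ := by
      have hp : 0 < 1 + η * R i := by linarith
      have : 1 - (1 + η * R i)⁻¹ = η * R i / (1 + η * R i) := by field_simp; ring
      rw [this, le_div_iff₀ hp]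
      nlinarith [pow_nonneg hx 3]
    nlinarith
  · intro i hi
    obtain ⟨h0, h1⟩ := hR i (Finset.mem_range.1 hi)
    positivity

/-- Regret of the multiplicative weights method. -/
theorem multiplicative_weights (η : ℝ) (hη : 0 < η) (n M : ℕ) (R : ℕ → ℕ → ℝ)
    (hR : ∀ i < M, ∀ j < n, 0 ≤ R i j ∧ R i j ≤ 1) (j : ℕ) (hj : j < n) :
    ∑ i ∈ Finset.range M, R i j - η * M - Real.log n / η
      ≤ ∑ i ∈ Finset.range M,
          (∑ j ∈ Finset.range n, (∏ k ∈ Finset.range i, (1 + η * R k j)) * R i j)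
            / ∑ j ∈ Finset.range n, ∏ k ∈ Finset.range i, (1 + η * R k j) := by
  set W : ℕ → ℝ := fun i => ∑ j ∈ Finset.range n, ∏ k ∈ Finset.range i, (1 + η * R k j) with hW
  have hpos : ∀ i ≤ M, ∀ j < n, 0 < ∏ k ∈ Finset.range i, (1 + η * R k j) := by
    intro i hi j hj
    apply Finset.prod_pos
    intro k hk
    have := hR k ((Finset.mem_range.1 hk).trans_le hi) j hj
    nlinarith
  have hWpos : ∀ i ≤ M, 0 < W i := fun i hi => sum_weights_pos (hpos i hi) (by omega)
  -- The potential: by log(1 + x) ≤ x, the logarithm of the total weight grows per step by at most η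
  -- times the reward that is earned.
  have hup : ∀ i ≤ M, Real.log (W i) ≤ Real.log n + η * ∑ i ∈ Finset.range i,
          (∑ j ∈ Finset.range n, (∏ k ∈ Finset.range i, (1 + η * R k j)) * R i j) / W i := by
    intro i hi
    induction i with
    | zero => simp [hW]
    | succ i ih =>
      have h0 := hWpos i (by omega)
      set S := ∑ j ∈ Finset.range n, (∏ k ∈ Finset.range i, (1 + η * R k j)) * R i j with hS
      have hSn : 0 ≤ S := Finset.sum_nonneg fun j hj =>
        mul_nonneg (hpos i (by omega) j (Finset.mem_range.1 hj)).le
          (hR i (by omega) j (Finset.mem_range.1 hj)).1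
      have e : W (i + 1) = W i * (1 + η * (S / W i)) := by
        have : W (i + 1) = W i + η * S := by
          simp only [hW, hS, Finset.prod_range_succ, Finset.mul_sum, ← Finset.sum_add_distrib]
          exact Finset.sum_congr rfl fun _ _ => by ring
        rw [this]; field_simp
      have hq : 0 ≤ η * (S / W i) := by positivity
      rw [e, Real.log_mul h0.ne' (by positivity), Finset.sum_range_succ, mul_add, ← hS]
      have := Real.log_le_sub_one_of_pos (x := 1 + η * (S / W i)) (by positivity)
      linarith [ih (by omega)]
  -- The total weight is at least the weight of the single competitor `j`.
  have hlow : Real.log (∏ k ∈ Finset.range M, (1 + η * R k j)) ≤ Real.log (W M) := by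
    apply Real.log_le_log (hpos M le_rfl j hj)
    exact Finset.single_le_sum (f := fun j => ∏ k ∈ Finset.range M, (1 + η * R k j))
      (fun j hj => (hpos M le_rfl j (Finset.mem_range.1 hj)).le) (Finset.mem_range.2 hj)
  have h1 := log_prod_one_add_ge η hη M (fun i => R i j) fun i hi => hR i hi j hj
  have h2 := hup M le_rfl
  set X := ∑ i ∈ Finset.range M,
          (∑ j ∈ Finset.range n, (∏ k ∈ Finset.range i, (1 + η * R k j)) * R i j) / W i
  have h3 : η * (∑ i ∈ Finset.range M, R i j - η * M - Real.log n / η) ≤ η * X := by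
    have : η * (∑ i ∈ Finset.range M, R i j - η * M - Real.log n / η)
        = η * ∑ i ∈ Finset.range M, R i j - η ^ 2 * M - Real.log n := by
      field_simp
    linarith
  exact le_of_mul_le_mul_left h3 hη

/-! ### Swap regret of the tree strategy -/

section Tree

variable {M : ℕ}

theorem blockAvg_mem {r : ℕ → ℝ} (hM : 0 < M) (hr : ∀ t, 0 ≤ r t ∧ r t ≤ 1) (h c : ℕ) :
    0 ≤ blockAvg M r h c ∧ blockAvg M r h c ≤ 1 := by
  induction h generalizing c with
  | zero => exact hr c
  | succ h ih =>
    have hM' : (0 : ℝ) < M := by exact_mod_cast hM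
    rw [blockAvg, ← Finset.sum_mul]
    refine ⟨mul_nonneg (Finset.sum_nonneg fun i _ => (ih _).1) (by positivity), ?_⟩
    rw [mul_one_div, div_le_one hM']
    calc _ ≤ ∑ i ∈ Finset.range M, (1 : ℝ) := Finset.sum_le_sum fun i _ => (ih _).2
      _ = M := by simp

theorem sum_block_eq (hM : 0 < M) (r : ℕ → ℝ) (h c : ℕ) :
    ∑ t ∈ Finset.range (M ^ h), r (c * M ^ h + t) = (M : ℝ) ^ h * blockAvg M r h c := by
  induction h generalizing c with
  | zero => simp [blockAvg]
  | succ h ih =>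
    have hM' : (M : ℝ) ≠ 0 := by exact_mod_cast hM.ne'
    rw [pow_succ', sum_range_mul_block, blockAvg, Finset.mul_sum]
    refine Finset.sum_congr rfl fun i _ => ?_
    have := ih (c * M + i)
    have harg : ∀ t, c * (M * M ^ h) + (i * M ^ h + t) = (c * M + i) * M ^ h + t := fun t => by ring
    simp only [harg]
    rw [this]
    field_simp
    try ring

theorem treeWeight_pos {η : ℝ} (hη : 0 < η) (hM : 0 < M) {r : ℕ → ℝ}
    (hr : ∀ t, 0 ≤ r t ∧ r t ≤ 1) (h c : ℕ) : 0 < treeWeight M η r h c := by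
  apply Finset.prod_pos
  intro i _
  have := blockAvg_mem hM hr h (c / M * M + i)
  nlinarith

theorem levelTable_lt {η : ℝ} (hη : 0 < η) (hM : 0 < M) {n G : ℕ} (hn : 0 < n) {r : ℕ → ℕ → ℝ}
    (hr : ∀ t, ∀ j < n, 0 ≤ r t j ∧ r t j ≤ 1) (h c : ℕ) {k : ℕ} (hk : k < G) :
    levelTable M η n G r h c k < n :=
  roundTable_lt (fun j hj => treeWeight_pos hη hM (fun t => hr t j hj) h c) hn hk

/-- The children of one block form one run of multiplicative weights, with child averages as
rewards. The competitor is a fixed action on the parent block, and rounding costs `n` cells per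
child. -/
theorem sum_levelTable_ge {η : ℝ} (hη : 0 < η) (hM : 0 < M) {n G : ℕ} (hn : 0 < n)
    {r : ℕ → ℕ → ℝ} (hr : ∀ t, ∀ j < n, 0 ≤ r t j ∧ r t j ≤ 1) (h c j : ℕ) (hj : j < n) :
    (G : ℝ) * (M * blockAvg M (fun t => r t j) (h + 1) c - η * M - Real.log n / η) - n * M
      ≤ ∑ i ∈ Finset.range M, ∑ k ∈ Finset.range G,
          blockAvg M (fun t => r t (levelTable M η n G r h (c * M + i) k)) h (c * M + i) := by
  set R : ℕ → ℕ → ℝ := fun i j => blockAvg M (fun t => r t j) h (c * M + i) with hRdef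
  have hR : ∀ i, ∀ j < n, 0 ≤ R i j ∧ R i j ≤ 1 := fun i j hj =>
    blockAvg_mem hM (fun t => hr t j hj) h _
  have hmw := multiplicative_weights η hη n M R (fun i _ => hR i) j hj
  have hM' : (M : ℝ) ≠ 0 := by exact_mod_cast hM.ne'
  have e : (M : ℝ) * blockAvg M (fun t => r t j) (h + 1) c = ∑ i ∈ Finset.range M, R i j := by
    rw [blockAvg, ← Finset.sum_mul]
    field_simp
    rfl
  -- Block `c * M + i` is the `i`-th child of block `c`, and tree weights only look back to earlier
  -- siblings.
  have hw : ∀ i < M, ∀ j, treeWeight M η (fun t => r t j) h (c * M + i)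
      = ∏ k ∈ Finset.range i, (1 + η * R k j) := by
    intro i hi j
    have h1 : (c * M + i) % M = i := by rw [add_comm, Nat.add_mul_mod_self_right, Nat.mod_eq_of_lt hi]
    have h2 : (c * M + i) / M = c := by
      rw [add_comm, Nat.add_mul_div_right _ _ hM, Nat.div_eq_of_lt hi, zero_add]
    simp only [treeWeight, h1, h2, hRdef]
  rw [e]
  have h1 : ∀ i ∈ Finset.range M, (G : ℝ) *
        ((∑ j ∈ Finset.range n, (∏ k ∈ Finset.range i, (1 + η * R k j)) * R i j)
            / ∑ j ∈ Finset.range n, ∏ k ∈ Finset.range i, (1 + η * R k j)) - n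
      ≤ ∑ k ∈ Finset.range G,
          blockAvg M (fun t => r t (levelTable M η n G r h (c * M + i) k)) h (c * M + i) := by
    intro i hi
    have := sum_roundTable_ge (w := fun j => treeWeight M η (fun t => r t j) h (c * M + i))
      (G := G) (fun j hj => treeWeight_pos hη hM (fun t => hr t j hj) _ _) hn (R i) (hR i)
    simp only [hw i (Finset.mem_range.1 hi)] at this
    refine this.trans (le_of_eq ?_)
    simp only [levelTable, hw i (Finset.mem_range.1 hi), hRdef]
  refine le_trans ?_ (Finset.sum_le_sum h1)
  rw [Finset.sum_sub_distrib, ← Finset.mul_sum, Finset.sum_const, Finset.card_range, nsmul_eq_mul,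
    mul_comm (n : ℝ)]
  gcongr

/-- Swap regret of the strategies on a subtree. -/
theorem subtree_swap_regret {η : ℝ} (hη : 0 < η) (hM : 0 < M) {n G : ℕ} (hn : 0 < n)
    {r : ℕ → ℕ → ℝ} (hr : ∀ t, ∀ j < n, 0 ≤ r t j ∧ r t j ≤ 1) (φ : ℕ → ℕ)
    (hφ : ∀ j < n, φ j < n) {κ : ℝ}
    (hκ : (G : ℝ) * (η * M + Real.log n / η) + n * M ≤ κ * M * G)
    (h c j : ℕ) (hj : j < n) :
    ∑ t ∈ Finset.range (M ^ h), ∑ l ∈ Finset.range h, ∑ k ∈ Finset.range G,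
        (r (c * M ^ h + t) (φ (levelTable M η n G r l ((c * M ^ h + t) / M ^ l) k))
          - r (c * M ^ h + t) (levelTable M η n G r l ((c * M ^ h + t) / M ^ l) k))
      ≤ G * (M : ℝ) ^ h * (1 + h * κ - blockAvg M (fun t => r t j) h c) := by
  induction h generalizing c j with
  | zero =>
    have := (hr c j hj).2
    simp only [blockAvg, Finset.range_zero, Finset.sum_empty, Finset.sum_const_zero]
    apply mul_nonneg (by positivity)
    push_cast
    linarith
  | succ h ih =>
    have hM0 : (0 : ℝ) < M := by exact_mod_cast hM
    rw [pow_succ', sum_range_mul_block]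
    have harg : ∀ i t, c * (M * M ^ h) + (i * M ^ h + t) = (c * M + i) * M ^ h + t := by
      intro i t; ring
    simp only [harg, Finset.sum_range_succ _ h, Finset.sum_add_distrib]
    set S : ℕ → ℕ → ℕ := fun i k => levelTable M η n G r h (c * M + i) k with hS
    have hSlt : ∀ i, ∀ k ∈ Finset.range G, S i k < n := fun i k hk =>
      levelTable_lt hη hM hn hr _ _ (Finset.mem_range.1 hk)
    -- The table of level `h` is frozen on a block of that level, so its rewards there are block
    -- averages.
    have hlast : ∀ i ∈ Finset.range M,
        ∑ t ∈ Finset.range (M ^ h), ∑ k ∈ Finset.range G,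
          (r ((c * M + i) * M ^ h + t)
              (φ (levelTable M η n G r h (((c * M + i) * M ^ h + t) / M ^ h) k))
            - r ((c * M + i) * M ^ h + t)
              (levelTable M η n G r h (((c * M + i) * M ^ h + t) / M ^ h) k))
        = (M : ℝ) ^ h * ∑ k ∈ Finset.range G,
          (blockAvg M (fun t => r t (φ (S i k))) h (c * M + i)
            - blockAvg M (fun t => r t (S i k)) h (c * M + i)) := by
      intro i _
      rw [Finset.sum_comm, Finset.mul_sum]
      refine Finset.sum_congr rfl fun k _ => ?_
      rw [mul_sub, ← sum_block_eq hM, ← sum_block_eq hM, ← Finset.sum_sub_distrib]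
      refine Finset.sum_congr rfl fun t ht => ?_
      have : ((c * M + i) * M ^ h + t) / M ^ h = c * M + i := by
        rw [add_comm, Nat.add_mul_div_right _ _ (by positivity),
          Nat.div_eq_of_lt (Finset.mem_range.1 ht), zero_add]
      rw [this]
    rw [Finset.sum_congr rfl hlast]
    have hchild : ∀ i ∈ Finset.range M,
        ∑ t ∈ Finset.range (M ^ h), ∑ l ∈ Finset.range h, ∑ k ∈ Finset.range G,
          (r ((c * M + i) * M ^ h + t)
              (φ (levelTable M η n G r l (((c * M + i) * M ^ h + t) / M ^ l) k))
            - r ((c * M + i) * M ^ h + t)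
              (levelTable M η n G r l (((c * M + i) * M ^ h + t) / M ^ l) k))
        + (M : ℝ) ^ h * ∑ k ∈ Finset.range G,
          (blockAvg M (fun t => r t (φ (S i k))) h (c * M + i)
            - blockAvg M (fun t => r t (S i k)) h (c * M + i))
        ≤ (M : ℝ) ^ h * (G * (1 + h * κ) - ∑ k ∈ Finset.range G,
            blockAvg M (fun t => r t (S i k)) h (c * M + i)) := by
      intro i _
      -- The telescoping: the best fixed action of the child dominates every swap of the frozen
      -- table, and its average is exactly what the induction hypothesis subtracts.
      obtain ⟨b, hb, hbmax⟩ := Finset.exists_max_image (Finset.range n)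
        (fun j => blockAvg M (fun t => r t j) h (c * M + i)) ⟨0, Finset.mem_range.2 hn⟩
      have h1 := ih (c * M + i) b (Finset.mem_range.1 hb)
      have h2 : ∑ k ∈ Finset.range G, blockAvg M (fun t => r t (φ (S i k))) h (c * M + i)
          ≤ ∑ k ∈ Finset.range G, blockAvg M (fun t => r t b) h (c * M + i) :=
        Finset.sum_le_sum fun k hk => hbmax _ (Finset.mem_range.2 (hφ _ (hSlt i k hk)))
      rw [Finset.sum_const, Finset.card_range, nsmul_eq_mul] at h2
      rw [Finset.sum_sub_distrib]
      have h3 := mul_le_mul_of_nonneg_left h2 (pow_pos hM0 h).le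
      linarith
    rw [← Finset.sum_add_distrib]
    refine (Finset.sum_le_sum hchild).trans ?_
    rw [← Finset.mul_sum, Finset.sum_sub_distrib, Finset.sum_const, Finset.card_range,
      nsmul_eq_mul]
    -- What the tables of level `h` earn replaces the lost term by the average of `j` on the parent,
    -- up to κ.
    have h4 := sum_levelTable_ge (G := G) hη hM hn hr h c j hj
    have h5 : (G : ℝ) * (M : ℝ) ^ (h + 1)
          * (1 + ((h + 1 : ℕ) : ℝ) * κ - blockAvg M (fun t => r t j) (h + 1) c)
        = (M : ℝ) ^ h * (M * (G * (1 + h * κ)) + (κ * M * G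
            - G * (M * blockAvg M (fun t => r t j) (h + 1) c))) := by
      push_cast; ring
    rw [h5]
    apply mul_le_mul_of_nonneg_left _ (by positivity)
    nlinarith

/-- Swap regret of the strategies on the whole tree of depth `D`. -/
theorem treeStrategy_swap_regret {D L n G : ℕ} (hD : 0 < D) (hL : 0 < L) (hn : 0 < n)
    (hlog : Real.log n ≤ L) (hG : D * n ≤ G)
    {r : ℕ → ℕ → ℝ} (hr : ∀ t, ∀ j < n, 0 ≤ r t j ∧ r t j ≤ 1) (φ : ℕ → ℕ)
    (hφ : ∀ j < n, φ j < n) (hM : M = D ^ 2 * L) :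
    ∑ t ∈ Finset.range (M ^ D), ∑ k ∈ Finset.range (D * G),
        (r t (φ (treeStrategy M (1 / D) n G r t k)) - r t (treeStrategy M (1 / D) n G r t k))
      ≤ 4 * G * (M : ℝ) ^ D := by
  have hD0 : (0 : ℝ) < D := by exact_mod_cast hD
  have hM0 : 0 < M := by subst hM; positivity
  -- The three summands contribute 1/D each: step size η = 1/D; log n / η ≤ DL = M/D; rounding, as
  -- n/G ≤ 1/D.
  have hκ : (G : ℝ) * (1 / D * M + Real.log n / (1 / D)) + n * M ≤ (3 / D) * M * G := by
    have h1 : Real.log n / (1 / (D : ℝ)) ≤ M / D := by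
      rw [hM]; push_cast
      have : (D : ℝ) ^ 2 * L / D = D * L := by field_simp
      rw [this, div_div_eq_mul_div, div_one, mul_comm]
      gcongr
    have h2 : (n : ℝ) * M ≤ (1 / D) * M * G := by
      have : (D : ℝ) * n ≤ G := by exact_mod_cast hG
      rw [div_mul_eq_mul_div, div_mul_eq_mul_div, le_div_iff₀ hD0]
      nlinarith [show (0 : ℝ) ≤ M by positivity]
    have h3 := mul_le_mul_of_nonneg_left h1 (show (0 : ℝ) ≤ G by positivity)
    have e : (3 / D : ℝ) * M * G = G * (1 / D * M) + G * (M / D) + (1 / D) * M * G := by ring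
    rw [e]; linarith
  -- Any competitor serves at the root, since its average is only dropped as nonnegative.
  have hmain := subtree_swap_regret (η := 1 / D) (by positivity) hM0 hn hr φ hφ hκ D 0 0 hn
  have hb := (blockAvg_mem hM0 (fun t => hr t 0 hn) D 0).1
  simp only [zero_mul, zero_add] at hmain
  have hG0 : 0 < G := lt_of_lt_of_le (by positivity) hG
  refine le_trans (le_of_eq ?_) (hmain.trans ?_)
  · refine Finset.sum_congr rfl fun t _ => ?_
    rw [sum_range_mul_block]
    refine Finset.sum_congr rfl fun l _ => Finset.sum_congr rfl fun k hk => ?_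
    have h1 : (l * G + k) / G = l := by
      rw [add_comm, Nat.add_mul_div_right _ _ hG0,
        Nat.div_eq_of_lt (Finset.mem_range.1 hk), zero_add]
    have h2 : (l * G + k) % G = k := by
      rw [add_comm, Nat.add_mul_mod_self_right, Nat.mod_eq_of_lt (Finset.mem_range.1 hk)]
    simp only [treeStrategy, h1, h2]
  · have h1 : (D : ℝ) * (3 / D) = 3 := by field_simp
    rw [h1, show 4 * (G : ℝ) * (M : ℝ) ^ D = G * (M : ℝ) ^ D * 4 by ring]
    apply mul_le_mul_of_nonneg_left _ (by positivity)
    linarith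

theorem treeStrategy_lt {D n G : ℕ} (hD : 0 < D) (hM : 0 < M) (hn : 0 < n)
    {r : ℕ → ℕ → ℝ} (hr : ∀ t, ∀ j < n, 0 ≤ r t j ∧ r t j ≤ 1) (t : ℕ) {k : ℕ}
    (hk : k < D * G) : treeStrategy M (1 / D) n G r t k < n := by
  have hD0 : (0 : ℝ) < D := by exact_mod_cast hD
  have hG0 : 0 < G := Nat.pos_of_ne_zero fun h => by simp [h] at hk
  exact levelTable_lt (by positivity) hM hn hr _ _ (Nat.mod_lt _ hG0)

end Tree

/-! ### Fair coins and sampling -/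

instance fairCoins_isProbabilityMeasure : IsProbabilityMeasure fairCoins := by
  unfold fairCoins
  infer_instance

theorem fairCoins_real_cylinder (N : ℕ) (f : ℕ → Bool) :
    fairCoins.real {c | ∀ p < N, c p = f p} = (1 / 2) ^ N := by
  have h : {c : ℕ → Bool | ∀ p < N, c p = f p}
      = Set.pi (Finset.range N) fun p => {f p} := by
    ext c
    simp [Set.mem_pi]
  have hp : ∀ b : Bool, (PMF.uniformOfFintype Bool).toMeasure {b} = 2⁻¹ := by
    intro b
    rw [PMF.toMeasure_apply_singleton _ _ (measurableSet_singleton b)]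
    simp
  rw [h, Measure.real, fairCoins, Measure.infinitePi_pi _ fun i _ => measurableSet_singleton _]
  simp [hp]

/-- If the value of `Ψ` in a set of `2 ^ N` elements determines the first `N` coins, and
conversely, then it is uniformly distributed. -/
theorem fairCoins_real_preimage {Ω : Type*} [Fintype Ω] [DecidableEq Ω] (N : ℕ)
    (Ψ : (ℕ → Bool) → Ω) (hΨ : ∀ c c', Ψ c = Ψ c' ↔ ∀ p < N, c p = c' p)
    (hcard : Fintype.card Ω = 2 ^ N) (S : Finset Ω) :
    fairCoins.real {c | Ψ c ∈ S} = S.card / Fintype.card Ω := by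
  -- Padding by `false` gives each pattern of the first `N` coins a representative. Injectivity and
  -- equal cardinality then make every value of `Ψ` correspond to one cylinder of mass 2^(-N).
  let ext : (Fin N → Bool) → ℕ → Bool := fun x p => if h : p < N then x ⟨p, h⟩ else false
  have hbij : Function.Bijective fun x => Ψ (ext x) := by
    rw [Fintype.bijective_iff_injective_and_card]
    refine ⟨fun x y hxy => ?_, by simp [hcard]⟩
    ext p
    have := (hΨ _ _).1 hxy p p.2
    simpa [ext] using this
  have hfib : ∀ ω, fairCoins.real {c | Ψ c = ω} = (1 / 2) ^ N
      ∧ MeasurableSet {c | Ψ c = ω} := by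
    intro ω
    obtain ⟨x, rfl⟩ := hbij.2 ω
    have : {c | Ψ c = Ψ (ext x)} = {c | ∀ p < N, c p = ext x p} := by
      ext c
      exact hΨ _ _
    simp only [this]
    refine ⟨fairCoins_real_cylinder N _, ?_⟩
    have h : {c : ℕ → Bool | ∀ p < N, c p = ext x p}
        = Set.pi (Finset.range N) fun p => {ext x p} := by
      ext c
      simp [Set.mem_pi]
    rw [h]
    exact MeasurableSet.pi (Finset.countable_toSet _) fun _ _ => measurableSet_singleton _
  have hU : {c | Ψ c ∈ S} = ⋃ ω ∈ S, {c | Ψ c = ω} := by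
    ext c
    simp
  rw [hU, measureReal_biUnion_finset]
  · rw [Finset.sum_congr rfl fun ω _ => (hfib ω).1, Finset.sum_const, hcard]
    simp [div_eq_mul_inv]
  · intro ω _ ω' _ hne
    exact Set.disjoint_left.2 fun c h h' => hne (h.symm.trans h')
  · exact fun ω _ => (hfib ω).2

/-! ### Chernoff bounds by counting -/

/-- One half of the Chernoff bound for independent uniform samples. -/
theorem card_deviation_le {W : Type*} [Fintype W] [Nonempty W] (f : W → ℝ)
    (hf : ∀ w, |f w| ≤ 1) (hmean : ∑ w, f w = 0) (K : ℕ) {η : ℝ} (hη : 0 ≤ η) (hη1 : η ≤ 1) :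
    (((Finset.univ : Finset (Fin K → W)).filter fun y => η * K < ∑ k, f (y k)).card : ℝ)
      ≤ Real.exp (-(K * η ^ 2 / 4)) * (Fintype.card W : ℝ) ^ K := by
  -- exp x ≤ 1 + x + x² for |x| ≤ 1, at x = (η/2) f; the choice η/2 optimizes the final exponent.
  have h1 : ∀ w, Real.exp (η / 2 * f w) ≤ 1 + η / 2 * f w + η ^ 2 / 4 := by
    intro w
    have hx : |η / 2 * f w| ≤ η / 2 := by
      rw [abs_mul, abs_of_nonneg (by positivity)]
      nlinarith [hf w]
    have h := Real.abs_exp_sub_one_sub_id_le (x := η / 2 * f w) (by linarith)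
    have h2 := (abs_le.1 h).2
    have h3 : (η / 2 * f w) ^ 2 ≤ (η / 2) ^ 2 := by
      rw [← sq_abs]
      gcongr
    nlinarith
  have h2 : ∑ w, Real.exp (η / 2 * f w) ≤ Real.exp (η ^ 2 / 4) * Fintype.card W := by
    calc _ ≤ ∑ w, (1 + η / 2 * f w + η ^ 2 / 4) := Finset.sum_le_sum fun w _ => h1 w
      _ = (η ^ 2 / 4 + 1) * Fintype.card W := by
        rw [Finset.sum_add_distrib, Finset.sum_add_distrib, ← Finset.mul_sum, hmean]
        simp
        ring
      _ ≤ _ := by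
        gcongr
        exact Real.add_one_le_exp _
  have h3 : ∑ y : Fin K → W, Real.exp (η / 2 * ∑ k, f (y k))
      = (∑ w, Real.exp (η / 2 * f w)) ^ K := by
    rw [Fintype.sum_pow]
    refine Finset.sum_congr rfl fun y _ => ?_
    rw [Finset.mul_sum, Real.exp_sum]
  -- Markov's inequality for the exponential moment.
  have h4 : (((Finset.univ : Finset (Fin K → W)).filter
      fun y => η * K < ∑ k, f (y k)).card : ℝ) * Real.exp (η / 2 * (η * K))
      ≤ ∑ y : Fin K → W, Real.exp (η / 2 * ∑ k, f (y k)) := by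
    rw [← nsmul_eq_mul, ← Finset.sum_const]
    refine (Finset.sum_le_sum fun y hy => ?_).trans (Finset.sum_le_sum_of_subset_of_nonneg
      (Finset.filter_subset _ _) fun _ _ _ => (Real.exp_pos _).le)
    have := (Finset.mem_filter.1 hy).2
    gcongr
  have h5 : ∑ y : Fin K → W, Real.exp (η / 2 * ∑ k, f (y k))
      ≤ Real.exp (K * (η ^ 2 / 4)) * (Fintype.card W : ℝ) ^ K := by
    rw [h3, Real.exp_nat_mul, ← mul_pow]
    gcongr
  have h6 := h4.trans h5
  rw [← le_div_iff₀ (Real.exp_pos _), mul_div_right_comm, ← Real.exp_sub] at h6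
  refine h6.trans (le_of_eq ?_)
  congr 2
  ring

/-- Chernoff bound for the average of independent uniform samples. -/
theorem card_average_deviation_le {W : Type*} [Fintype W] [Nonempty W] (f : W → ℝ)
    (hf : ∀ w, 0 ≤ f w ∧ f w ≤ 1) (K : ℕ) (hK : 0 < K) {η : ℝ} (hη : 0 ≤ η) (hη1 : η ≤ 1) :
    (((Finset.univ : Finset (Fin K → W)).filter fun y =>
      η < |∑ k, f (y k) * (1 / K) - (∑ w, f w) * (1 / Fintype.card W)|).card : ℝ)
      ≤ 2 * Real.exp (-(K * η ^ 2 / 4)) * (Fintype.card W : ℝ) ^ K := by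
  classical
  set μ : ℝ := (∑ w, f w) * (1 / Fintype.card W) with hμ
  have hW : (0 : ℝ) < Fintype.card W := by exact_mod_cast Fintype.card_pos
  have hK' : (0 : ℝ) < K := by exact_mod_cast hK
  have hsum : ∑ _w : W, μ = ∑ w, f w := by
    rw [Finset.sum_const, Finset.card_univ, nsmul_eq_mul, hμ]
    field_simp
  have hμ0 : 0 ≤ μ := mul_nonneg (Finset.sum_nonneg fun w _ => (hf w).1) (by positivity)
  have hμ1 : μ ≤ 1 := by
    rw [hμ, mul_one_div, div_le_one hW]
    calc _ ≤ ∑ _w : W, (1 : ℝ) := Finset.sum_le_sum fun w _ => (hf w).2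
      _ = _ := by simp
  have hA := card_deviation_le (fun w => f w - μ)
    (fun w => abs_le.2 ⟨by linarith [(hf w).1], by linarith [(hf w).2]⟩)
    (by rw [Finset.sum_sub_distrib, hsum, sub_self]) K hη hη1
  have hB := card_deviation_le (fun w => μ - f w)
    (fun w => abs_le.2 ⟨by linarith [(hf w).2], by linarith [(hf w).1]⟩)
    (by rw [Finset.sum_sub_distrib, hsum, sub_self]) K hη hη1
  have hsub : ((Finset.univ : Finset (Fin K → W)).filter fun y =>
        η < |∑ k, f (y k) * (1 / K) - μ|)
      ⊆ ((Finset.univ : Finset (Fin K → W)).filter fun y => η * K < ∑ k, (f (y k) - μ))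
        ∪ ((Finset.univ : Finset (Fin K → W)).filter fun y => η * K < ∑ k, (μ - f (y k))) := by
    intro y hy
    have hy := (Finset.mem_filter.1 hy).2
    rw [← Finset.sum_mul] at hy
    simp only [Finset.mem_union, Finset.mem_filter, Finset.mem_univ, true_and,
      Finset.sum_sub_distrib, Finset.sum_const, Finset.card_univ, Fintype.card_fin, nsmul_eq_mul]
    have e : (∑ k, f (y k)) * (1 / K) - μ = (∑ k, f (y k) - K * μ) / K := by
      field_simp
    rw [e, abs_div, abs_of_pos hK', lt_div_iff₀ hK', lt_abs] at hy
    rcases hy with hy | hy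
    · exact Or.inl hy
    · right; linarith
  have := (Finset.card_le_card hsub).trans (Finset.card_union_le _ _)
  have : (((Finset.univ : Finset (Fin K → W)).filter fun y =>
      η < |∑ k, f (y k) * (1 / K) - μ|).card : ℝ) ≤
      ((Finset.univ : Finset (Fin K → W)).filter fun y => η * K < ∑ k, (f (y k) - μ)).card
        + ((Finset.univ : Finset (Fin K → W)).filter fun y => η * K < ∑ k, (μ - f (y k))).card := by
    exact_mod_cast this
  linarith

/-! ### Resampling one coordinate -/

/-- A coordinate may be sampled anew, if the summand does not depend on it otherwise. -/
theorem sum_resample {ι X : Type*} [Fintype ι] [DecidableEq ι] [Fintype X]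
    (t : ι) (f : (ι → X) → X → ℝ) (hf : ∀ x y z, f (Function.update x t y) z = f x z) :
    ∑ x, ∑ y, f x y = Fintype.card X * ∑ x : ι → X, f x (x t) := by
  -- Exchanging the coordinate `x t` with the new value `y` is an involution that preserves the
  -- uniform distribution.
  let σ : (ι → X) × X → (ι → X) × X := fun z => (Function.update z.1 t z.2, z.1 t)
  have hσ : Function.Involutive σ := by
    rintro ⟨x, y⟩
    simp [σ]
  have h1 : ∑ z : (ι → X) × X, f z.1 z.2 = ∑ z : (ι → X) × X, f z.1 (z.1 t) := by
    refine Fintype.sum_equiv hσ.toPerm _ _ ?_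
    rintro ⟨x, y⟩
    simp [σ, hf]
  rw [Fintype.sum_prod_type, Fintype.sum_prod_type] at h1
  rw [h1, Finset.mul_sum]
  exact Finset.sum_congr rfl fun x _ => by
    change ∑ _y : X, f x (x t) = _
    rw [Finset.sum_const, Finset.card_univ, nsmul_eq_mul]

/-- An event about the `t`-th coordinate which may depend on the other coordinates. -/
theorem card_adaptive_le {ι X : Type*} [Fintype ι] [DecidableEq ι] [Fintype X] [Nonempty X]
    (t : ι) (P : (ι → X) → X → Prop) [∀ x, DecidablePred (P x)]
    (hP : ∀ x y z, P (Function.update x t y) z ↔ P x z) {δ : ℝ}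
    (hδ : ∀ x, ((Finset.univ.filter (P x)).card : ℝ) ≤ δ * Fintype.card X) :
    ((Finset.univ.filter fun x : ι → X => P x (x t)).card : ℝ) ≤ δ * Fintype.card (ι → X) := by
  -- Applied to the indicator of `P`: the actual coordinate may be replaced by a fresh one, for
  -- which `hδ` holds with the others fixed.
  have h1 := sum_resample t (fun x y => if P x y then (1 : ℝ) else 0) fun x y z => by simp only [hP]
  simp only [Finset.sum_boole] at h1
  have hX : (0 : ℝ) < Fintype.card X := by exact_mod_cast Fintype.card_pos
  have h2 : (Fintype.card X : ℝ) * (Finset.univ.filter fun x : ι → X => P x (x t)).card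
      ≤ Fintype.card X * (δ * Fintype.card (ι → X)) := by
    rw [← h1]
    calc _ ≤ ∑ _x : ι → X, δ * Fintype.card X := Finset.sum_le_sum fun x _ => hδ x
      _ = _ := by simp only [Finset.sum_const, Finset.card_univ, nsmul_eq_mul]; ring
  exact le_of_mul_le_mul_left h2 hX

/-! ### Reasoning about programs -/

/-- `p`, started in `s`, halts within `t` steps in a state that satisfies `Q`. -/
def RAMProg.Runs (table : ℕ → ℝ) (coins : ℕ → Bool) (p : RAMProg) (s : RAMState) (t : ℕ)
    (Q : RAMState → Prop) : Prop :=
  ∃ s' t', RAMProg.Exec table coins p s s' t' ∧ t' ≤ t ∧ Q s'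

/-- Straight-line programs. -/
def RAMProg.block : List RAMInstr → RAMProg
  | [] => .skip
  | c :: l => .seq (.instr c) (RAMProg.block l)

/-- Effect of a straight-line program. -/
noncomputable def runList (table : ℕ → ℝ) (coins : ℕ → Bool) (s : RAMState)
    (l : List RAMInstr) : RAMState :=
  l.foldl (fun s c => c.run table coins s) s

section Rules

variable {table : ℕ → ℝ} {coins : ℕ → Bool} {p p' : RAMProg} {s : RAMState} {t t' : ℕ}
  {Q Q' R : RAMState → Prop}

theorem RAMProg.Runs.mono (h : p.Runs table coins s t Q) (ht : t ≤ t') (hQ : ∀ s, Q s → Q' s) :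
    p.Runs table coins s t' Q' := by
  obtain ⟨s', t₀, h1, h2, h3⟩ := h
  exact ⟨s', t₀, h1, h2.trans ht, hQ _ h3⟩

theorem RAMProg.exec_block (l : List RAMInstr) (s : RAMState) :
    RAMProg.Exec table coins (RAMProg.block l) s (runList table coins s l) l.length := by
  induction l generalizing s with
  | nil => exact .skip s
  | cons c l ih =>
    rw [List.length_cons, add_comm]
    exact .seq (.instr c s) (ih _)

theorem RAMProg.runs_block {l : List RAMInstr} (h : Q (runList table coins s l))
    (ht : l.length ≤ t) : (RAMProg.block l).Runs table coins s t Q :=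
  ⟨_, _, RAMProg.exec_block l s, ht, h⟩

theorem RAMProg.Runs.seq (h : p.Runs table coins s t R)
    (h' : ∀ s', R s' → p'.Runs table coins s' t' Q) :
    (RAMProg.seq p p').Runs table coins s (t + t') Q := by
  obtain ⟨s₁, t₁, h1, h2, h3⟩ := h
  obtain ⟨s₂, t₂, h4, h5, h6⟩ := h' _ h3
  exact ⟨s₂, t₁ + t₂, .seq h1 h4, by omega, h6⟩

theorem RAMProg.runs_block_seq {l : List RAMInstr}
    (h : p.Runs table coins (runList table coins s l) t Q) :
    (RAMProg.seq (RAMProg.block l) p).Runs table coins s (l.length + t) Q :=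
  .seq (R := fun s' => s' = runList table coins s l) ⟨_, _, exec_block l s, le_rfl, rfl⟩
    fun _ hs => hs ▸ h

/-- A loop that makes exactly `N - k` more rounds. -/
theorem RAMProg.runs_loop {b : RAMTest} (I : ℕ → RAMState → Prop) {N k tb : ℕ} (hk : k ≤ N)
    (hb : ∀ k ≤ N, ∀ s, I k s → (b.Holds s ↔ k < N))
    (hp : ∀ k < N, ∀ s, I k s → p.Runs table coins s tb (I (k + 1))) (hI : I k s) :
    (RAMProg.loop b p).Runs table coins s ((N - k) * (tb + 1) + 1) (I N) := by
  obtain ⟨d, rfl⟩ := Nat.exists_eq_add_of_le hk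
  rw [Nat.add_sub_cancel_left]
  induction d generalizing k s with
  | zero =>
    refine ⟨s, 1, .loop_done ?_, by omega, hI⟩
    rw [hb k le_rfl s hI]
    omega
  | succ d ih =>
    obtain ⟨s₁, t₁, h1, h2, h3⟩ := hp k (by omega) s hI
    have e : k + (d + 1) = (k + 1) + d := by omega
    rw [e] at hb hp ⊢
    obtain ⟨s₂, t₂, h4, h5, h6⟩ := ih (k := k + 1) h3 (by omega) hb hp
    refine ⟨s₂, t₁ + t₂ + 1, .loop_step ((hb k (by omega) s hI).2 (by omega)) h1 h4, ?_, h6⟩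
    rw [Nat.succ_mul]
    omega

/-- A loop that makes exactly `N` rounds, which may take different times. -/
theorem RAMProg.runs_loop_sum {b : RAMTest} (I : ℕ → RAMState → Prop) {N : ℕ} (tb : ℕ → ℕ)
    (hb : ∀ k ≤ N, ∀ s, I k s → (b.Holds s ↔ k < N))
    (hp : ∀ k < N, ∀ s, I k s → p.Runs table coins s (tb k) (I (k + 1))) (hI : I 0 s) :
    (RAMProg.loop b p).Runs table coins s (∑ k ∈ Finset.range N, (tb k + 1) + 1) (I N) := by
  induction N generalizing s I tb with
  | zero =>
    refine ⟨s, 1, .loop_done ?_, by omega, hI⟩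
    rw [hb 0 le_rfl s hI]
    omega
  | succ d ih =>
    obtain ⟨s₁, t₁, h1, h2, h3⟩ := hp 0 (by omega) s hI
    obtain ⟨s₂, t₂, h4, h5, h6⟩ := ih (fun k => I (k + 1)) (fun k => tb (k + 1))
      (fun k hk s hs => (hb (k + 1) (by omega) s hs).trans (by omega))
      (fun k hk s hs => hp (k + 1) (by omega) s hs) h3
    refine ⟨s₂, t₁ + t₂ + 1, .loop_step ((hb 0 (by omega) s hI).2 (by omega)) h1 h4, ?_, h6⟩
    rw [Finset.sum_range_succ']
    omega

/-- A loop that is controlled by a counter in register `c`, with bound in register `l`, in rounds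
of equal length. -/
theorem RAMProg.runs_for {c l : ℕ} (I : ℕ → RAMState → Prop) {N tb : ℕ}
    (hc : ∀ k ≤ N, ∀ s, I k s → s.reg c = k + 1) (hl : ∀ k ≤ N, ∀ s, I k s → s.reg l = N)
    (hp : ∀ k < N, ∀ s, I k s → p.Runs table coins s tb (I (k + 1))) (hI : I 0 s) :
    (RAMProg.loop (.le c l) p).Runs table coins s (N * (tb + 1) + 1) (I N) := by
  refine RAMProg.runs_loop I (Nat.zero_le N) (fun k hk s hs => ?_) hp hI
  rw [RAMTest.Holds, hc k hk s hs, hl k hk s hs]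
  omega

end Rules

/-- Product of the registers `a` and `b`, into register `d`; register `c` is a counter. -/
def mulProg (c d a b : ℕ) : RAMProg :=
  .seq (.block [.const d 0, .const c 1]) (.loop (.le c b) (.block [.add d d a, .add c c 2]))

/-- Multiplication by repeated addition. The cost depends on the second factor only, so the first
one may be as large as a power of `n`. -/
theorem mulProg_runs {table : ℕ → ℝ} {coins : ℕ → Bool} {c d a b : ℕ} {s : RAMState}
    (h : s.reg 2 = 1) (hca : c ≠ a) (hcb : c ≠ b) (hda : d ≠ a) (hdb : d ≠ b) (hcd : c ≠ d)
    (hc2 : c ≠ 2) (hd2 : d ≠ 2) :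
    (mulProg c d a b).Runs table coins s (3 * s.reg b + 3) fun s' =>
      s' = { s with
        reg := Function.update (Function.update s.reg d (s.reg a * s.reg b)) c (s.reg b + 1) } := by
  refine (RAMProg.runs_block_seq (RAMProg.runs_for (fun k s' => s' = { s with
      reg := Function.update (Function.update s.reg d (s.reg a * k)) c (k + 1) })
    (N := s.reg b) (tb := 2) ?_ ?_ ?_ ?_)).mono ?_ ?_
  · rintro k hk s' rfl
    simp
  · rintro k hk s' rfl
    simp [Function.update_of_ne hcb.symm, Function.update_of_ne hdb.symm]
  · rintro k hk s' rfl
    refine RAMProg.runs_block ?_ le_rfl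
    simp [runList, RAMInstr.run, hca.symm, hda.symm, hc2.symm, hd2.symm,
      hcd.symm, h, hcd]
    ext r
    simp only [Function.update_apply]
    split_ifs <;> simp_all [mul_add]
  · simp [runList, RAMInstr.run]
  · simp; omega
  · exact fun _ h => h

/-! ### The equilibrium program

Registers: `0` players, `1` actions, `2` the number one, `3` the product of registers `0` and `1`,
`4` cells of a table (one level), `5` cells of the tables of all the levels, `6` coins per sampled
action, `7` arity of the tree, `8` samples per round, `9` number of rounds, `20` start of the next
output, `21` start of the accumulators of the current level, `22` offset of the table of the
current level, `30`-`49` scratch, `50 + h` loop counter of level `h`. -/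

/-- Sizes that the program uses: players, actions, levels, cells per table, arity, samples per
round, coins per sampled action. -/
structure Params where
  (m n D G M K B : ℕ)

namespace Params

variable (q : Params)

/-- number of pairs of a player and an action -/
def N : ℕ := q.m * q.n

/-- start of the working area in the real memory -/
def base : ℕ := q.M ^ q.D * q.N

end Params

/-- The constant registers have the values that `q` prescribes. -/
structure Env (q : Params) (s : RAMState) : Prop where
  reg0 : s.reg 0 = q.m
  reg1 : s.reg 1 = q.n
  reg2 : s.reg 2 = 1
  reg3 : s.reg 3 = q.N
  reg4 : s.reg 4 = q.G
  reg5 : s.reg 5 = q.D * q.G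
  reg6 : s.reg 6 = q.B
  reg7 : s.reg 7 = q.M
  reg8 : s.reg 8 = q.K
  reg9 : s.reg 9 = q.M ^ q.D
  reg10 : s.reg 10 = 0
  reg11 : s.reg 11 = 2 * q.N
  xreg0 : s.xreg 0 = 0
  xreg1 : s.xreg 1 = 1
  xreg2 : s.xreg 2 = 1 / q.D
  xreg3 : s.xreg 3 = 1 / q.M
  xreg4 : s.xreg 4 = 1 / q.K
  xreg5 : s.xreg 5 = 1 / (q.D * q.G : ℕ)
  xreg6 : s.xreg 6 = q.G

/-- Only scratch registers differ. -/
def Keeps (s s' : RAMState) : Prop :=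
  (∀ r, r < 30 ∨ 50 ≤ r → s'.reg r = s.reg r) ∧ ∀ r, r < 10 → s'.xreg r = s.xreg r

theorem Keeps.trans {s s' s'' : RAMState} (h : Keeps s s') (h' : Keeps s' s'') : Keeps s s'' :=
  ⟨fun r hr => (h'.1 r hr).trans (h.1 r hr), fun r hr => (h'.2 r hr).trans (h.2 r hr)⟩

theorem Env.of_eq {q : Params} {s s' : RAMState} (h : Env q s)
    (h1 : ∀ r, r < 20 → s'.reg r = s.reg r) (h2 : ∀ r, r < 10 → s'.xreg r = s.xreg r) :
    Env q s' where
  reg0 := (h1 _ (by norm_num)).trans h.reg0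
  reg1 := (h1 _ (by norm_num)).trans h.reg1
  reg2 := (h1 _ (by norm_num)).trans h.reg2
  reg3 := (h1 _ (by norm_num)).trans h.reg3
  reg4 := (h1 _ (by norm_num)).trans h.reg4
  reg5 := (h1 _ (by norm_num)).trans h.reg5
  reg6 := (h1 _ (by norm_num)).trans h.reg6
  reg7 := (h1 _ (by norm_num)).trans h.reg7
  reg8 := (h1 _ (by norm_num)).trans h.reg8
  reg9 := (h1 _ (by norm_num)).trans h.reg9
  reg10 := (h1 _ (by norm_num)).trans h.reg10
  reg11 := (h1 _ (by norm_num)).trans h.reg11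
  xreg0 := (h2 _ (by norm_num)).trans h.xreg0
  xreg1 := (h2 _ (by norm_num)).trans h.xreg1
  xreg2 := (h2 _ (by norm_num)).trans h.xreg2
  xreg3 := (h2 _ (by norm_num)).trans h.xreg3
  xreg4 := (h2 _ (by norm_num)).trans h.xreg4
  xreg5 := (h2 _ (by norm_num)).trans h.xreg5
  xreg6 := (h2 _ (by norm_num)).trans h.xreg6

theorem Env.keeps {q : Params} {s s' : RAMState} (h : Env q s) (h' : Keeps s s') : Env q s' :=
  h.of_eq (fun r hr => h'.1 r (by omega)) h'.2

/-! ### Programs for weights and tables -/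

/-- Set the weights of the current level to `1`. -/
def initWeights : RAMProg :=
  .seq (.block [.add 30 21 3, .const 31 1])
    (.loop (.le 31 3) (.block [.xstore 30 1, .add 30 30 2, .add 31 31 2]))

theorem initWeights_runs {table : ℕ → ℝ} {coins : ℕ → Bool} {q : Params} {s : RAMState}
    (hE : Env q s) :
    initWeights.Runs table coins s (4 * q.N + 3) fun s' => Keeps s s' ∧ s'.mem = s.mem ∧
      s'.pos = s.pos ∧ ∀ a, s'.xmem a =
        if s.reg 21 + q.N ≤ a ∧ a < s.reg 21 + 2 * q.N then 1 else s.xmem a := by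
  set I : ℕ → RAMState → Prop := fun k s' => Keeps s s' ∧ s'.mem = s.mem ∧
      s'.pos = s.pos ∧ s'.reg 30 = s.reg 21 + q.N + k ∧ s'.reg 31 = k + 1 ∧
      ∀ a, s'.xmem a =
        if s.reg 21 + q.N ≤ a ∧ a < s.reg 21 + q.N + k then 1 else s.xmem a with hI
  refine (RAMProg.runs_block_seq (RAMProg.runs_for I (N := q.N) (tb := 3)
    (fun k _ s' h => h.2.2.2.2.1) (fun k _ s' h => (hE.keeps h.1).reg3) ?_ ?_)).mono ?_ ?_
  · rintro k hk s' ⟨h1, h2, h3, h4, h5, h6⟩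
    have hE' := hE.keeps h1
    refine RAMProg.runs_block ?_ le_rfl
    refine ⟨⟨fun r hr => ?_, h1.2⟩, h2, h3, ?_, ?_, fun a => ?_⟩
    · simp (disch := omega) [runList, RAMInstr.run, Function.update_of_ne, h1.1 r hr]
    · simp [runList, RAMInstr.run, h4, hE'.reg2]; ring
    · simp [runList, RAMInstr.run, h5, hE'.reg2]
    · simp [runList, RAMInstr.run, Function.update_apply, h4, h6, hE'.xreg1]
      split_ifs <;> first | rfl | omega
  · refine ⟨⟨fun r hr => ?_, fun r hr => rfl⟩, rfl, rfl, ?_, ?_, fun a => ?_⟩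
    · simp (disch := omega) [runList, RAMInstr.run, Function.update_of_ne]
    · simp [runList, RAMInstr.run, hE.reg3]
    · simp [runList, RAMInstr.run]
    · simp [runList, RAMInstr.run]
  · simp; omega
  · rintro s' ⟨h1, h2, h3, h4, h5, h6⟩
    refine ⟨h1, h2, h3, fun a => ?_⟩
    rw [h6, show s.reg 21 + q.N + q.N = s.reg 21 + 2 * q.N by omega]

/-- Sum of the weights of one player. -/
def sumWeights : RAMProg :=
  .seq (.block [.xadd 10 0 0, .add 35 32 10, .const 36 1])
    (.loop (.le 36 1) (.block [.xload 11 35, .xadd 10 10 11, .add 35 35 2, .add 36 36 2]))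

/-- Store the cells of one action. -/
def fillCells : RAMProg :=
  .seq (.block [.xload 11 32, .xmul 11 11 6, .xadd 13 13 11])
    (.seq (.loop (.xle 12 13) (.block [.store 37 38, .add 37 37 2, .xadd 12 12 10]))
      (.block [.add 32 32 2, .add 38 38 2, .add 36 36 2]))

/-- Store the table of one player. -/
def fillRow : RAMProg :=
  .seq sumWeights
    (.seq (.block [.xadd 12 10 0, .xadd 13 0 0, .add 37 33 10, .const 38 0, .const 36 1])
      (.seq (.loop (.le 36 1) fillCells) (.block [.add 33 33 5, .add 34 34 2])))

/-- Store the tables of the current level. -/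
def fillTable : RAMProg :=
  .seq (.block [.add 32 21 3, .add 33 0 22, .const 34 1]) (.loop (.le 34 0) fillRow)

section

variable {table : ℕ → ℝ} {coins : ℕ → Bool} {q : Params} {s : RAMState}

theorem sumWeights_runs (hE : Env q s) :
    sumWeights.Runs table coins s (5 * q.n + 4) fun s' => Keeps s s' ∧ s'.mem = s.mem ∧
      s'.xmem = s.xmem ∧ s'.pos = s.pos ∧ (∀ r, r < 35 → s'.reg r = s.reg r) ∧
      s'.xreg 10 = ∑ j ∈ Finset.range q.n, s.xmem (s.reg 32 + j) := by
  refine (RAMProg.runs_block_seq (RAMProg.runs_for (fun k s' => Keeps s s' ∧ s'.mem = s.mem ∧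
      s'.xmem = s.xmem ∧ s'.pos = s.pos ∧ (∀ r, r < 35 → s'.reg r = s.reg r) ∧
      s'.reg 35 = s.reg 32 + k ∧ s'.reg 36 = k + 1 ∧
      s'.xreg 10 = ∑ j ∈ Finset.range k, s.xmem (s.reg 32 + j)) (N := q.n) (tb := 4)
      (fun k _ s' h => h.2.2.2.2.2.2.1) (fun k _ s' h => (hE.keeps h.1).reg1) ?_ ?_)).mono ?_ ?_
  · rintro k hk s' ⟨h1, h2, h3, h4, h5, h6, h7, h8⟩
    have hE' := hE.keeps h1
    refine RAMProg.runs_block ?_ le_rfl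
    refine ⟨⟨fun r hr => ?_, fun r hr => ?_⟩, h2, h3, h4, fun r hr => ?_, ?_, ?_, ?_⟩
    · simp (disch := omega) [runList, RAMInstr.run, Function.update_of_ne, h1.1 r hr]
    · simp (disch := omega) [runList, RAMInstr.run, Function.update_of_ne, h1.2 r hr]
    · simp (disch := omega) [runList, RAMInstr.run, Function.update_of_ne, h5 r hr]
    · simp [runList, RAMInstr.run, h6, hE'.reg2]; ring
    · simp [runList, RAMInstr.run, h7, hE'.reg2]
    · simp [runList, RAMInstr.run, h8, h3, h6, Finset.sum_range_succ]
  · refine ⟨⟨fun r hr => ?_, fun r hr => ?_⟩, rfl, rfl, rfl, fun r hr => ?_, ?_, ?_, ?_⟩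
    · simp (disch := omega) [runList, RAMInstr.run, Function.update_of_ne]
    · simp (disch := omega) [runList, RAMInstr.run, Function.update_of_ne]
    · simp (disch := omega) [runList, RAMInstr.run, Function.update_of_ne]
    · simp [runList, RAMInstr.run, hE.reg10]
    · simp [runList, RAMInstr.run]
    · simp [runList, RAMInstr.run, hE.xreg0]
  · simp; omega
  · rintro s' ⟨h1, h2, h3, h4, h5, h6, h7, h8⟩
    exact ⟨h1, h2, h3, h4, h5, h8⟩

/-- The loop invariant of `fillRow`, after `j` actions and `k` cells: `s` is the state before. -/
structure RowInv (q : Params) (s : RAMState) (w : ℕ → ℝ) (j k g : ℕ) (s' : RAMState) : Prop where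
  keeps : Keeps s s'
  xmem : s'.xmem = s.xmem
  pos : s'.pos = s.pos
  reg32 : s'.reg 32 = s.reg 32 + j
  reg33 : s'.reg 33 = s.reg 33
  reg34 : s'.reg 34 = s.reg 34
  reg36 : s'.reg 36 = j + 1
  reg38 : s'.reg 38 = j
  reg37 : s'.reg 37 = s.reg 33 + k
  xreg10 : s'.xreg 10 = ∑ i ∈ Finset.range q.n, w i
  xreg12 : s'.xreg 12 = (k + 1) * ∑ i ∈ Finset.range q.n, w i
  xreg13 : s'.xreg 13 = q.G * ∑ i ∈ Finset.range g, w i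
  mem : ∀ a, s'.mem a =
    if s.reg 33 ≤ a ∧ a < s.reg 33 + k then roundTable w q.n q.G (a - s.reg 33) else s.mem a

/-- Registers `12` and `13` hold the two sides of the criterion `lt_cellCount_iff`, so the loop
stops exactly when the cells of action `j` are used up. -/
theorem fillCells_runs {s₀ : RAMState} {w : ℕ → ℝ} (hE : Env q s₀) {j : ℕ} (hj : j < q.n)
    (hw : ∀ j < q.n, 0 < w j) (hx : s₀.xmem (s₀.reg 32 + j) = w j)
    (hs : RowInv q s₀ w j (cellCount w q.n q.G j) j s) :
    fillCells.Runs table coins s (4 * (cellCount w q.n q.G (j + 1) - cellCount w q.n q.G j) + 7)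
      (RowInv q s₀ w (j + 1) (cellCount w q.n q.G (j + 1)) (j + 1)) := by
  have hmono := cellCount_mono (G := q.G) hw (Nat.le_succ j) hj
  refine (RAMProg.runs_block_seq (RAMProg.Runs.seq (RAMProg.runs_loop (tb := 3)
    (N := cellCount w q.n q.G (j + 1)) (k := cellCount w q.n q.G j)
    (fun k s' => cellCount w q.n q.G j ≤ k ∧ RowInv q s₀ w j k (j + 1) s')
    hmono ?_ ?_ ?_) (t' := 3) ?_)).mono ?_ (fun _ h => h)
  · rintro k hk s' ⟨-, h⟩
    rw [RAMTest.Holds, h.xreg12, h.xreg13, lt_cellCount_iff hw (by omega)]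
  · rintro k hk s' ⟨hk', h⟩
    have hE' := hE.keeps h.keeps
    refine RAMProg.runs_block ⟨by omega, ?_⟩ le_rfl
    constructor
    · refine ⟨fun r hr => ?_, fun r hr => ?_⟩
      · simp (disch := omega) [runList, RAMInstr.run, Function.update_of_ne, h.keeps.1 r hr]
      · simp (disch := omega) [runList, RAMInstr.run, Function.update_of_ne, h.keeps.2 r hr]
    · simp [runList, RAMInstr.run, h.xmem]
    · simp [runList, RAMInstr.run, h.pos]
    · simp [runList, RAMInstr.run, h.reg32]
    · simp [runList, RAMInstr.run, h.reg33]
    · simp [runList, RAMInstr.run, h.reg34]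
    · simp [runList, RAMInstr.run, h.reg36]
    · simp [runList, RAMInstr.run, h.reg38]
    · simp [runList, RAMInstr.run, h.reg37, hE'.reg2]; ring
    · simp [runList, RAMInstr.run, h.xreg10]
    · simp [runList, RAMInstr.run, h.xreg10, h.xreg12]; ring
    · simp [runList, RAMInstr.run, h.xreg13]
    · intro a
      simp only [runList, RAMInstr.run, List.foldl, Function.update_apply, h.reg37, h.reg38, h.mem]
      by_cases ha : a = s₀.reg 33 + k
      · subst ha
        rw [if_pos rfl, if_pos (by omega), Nat.add_sub_cancel_left, roundTable_eq hw hj hk' hk]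
      · rw [if_neg ha]
        split_ifs <;> first | rfl | omega
  · refine ⟨le_rfl, ?_⟩
    constructor
    · refine ⟨fun r hr => ?_, fun r hr => ?_⟩
      · simp (disch := omega) [runList, RAMInstr.run, hs.keeps.1 r hr]
      · simp (disch := omega) [runList, RAMInstr.run, Function.update_of_ne, hs.keeps.2 r hr]
    · simp [runList, RAMInstr.run, hs.xmem]
    · simp [runList, RAMInstr.run, hs.pos]
    · simp [runList, RAMInstr.run, hs.reg32]
    · simp [runList, RAMInstr.run, hs.reg33]
    · simp [runList, RAMInstr.run, hs.reg34]
    · simp [runList, RAMInstr.run, hs.reg36]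
    · simp [runList, RAMInstr.run, hs.reg38]
    · simp [runList, RAMInstr.run, hs.reg37]
    · simp [runList, RAMInstr.run, hs.xreg10]
    · simp [runList, RAMInstr.run, hs.xreg12]
    · simp [runList, RAMInstr.run, hs.xreg13, hs.xmem, hs.reg32, hx, Finset.sum_range_succ,
        (hE.keeps hs.keeps).xreg6]
      ring
    · exact hs.mem
  · rintro s' ⟨-, h⟩
    have hE' := hE.keeps h.keeps
    refine RAMProg.runs_block ?_ le_rfl
    constructor
    · refine ⟨fun r hr => ?_, fun r hr => ?_⟩
      · simp (disch := omega) [runList, RAMInstr.run, Function.update_of_ne, h.keeps.1 r hr]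
      · simp (disch := omega) [runList, RAMInstr.run, h.keeps.2 r hr]
    · simp [runList, RAMInstr.run, h.xmem]
    · simp [runList, RAMInstr.run, h.pos]
    · simp [runList, RAMInstr.run, h.reg32, hE'.reg2]; ring
    · simp [runList, RAMInstr.run, h.reg33]
    · simp [runList, RAMInstr.run, h.reg34]
    · simp [runList, RAMInstr.run, h.reg36, hE'.reg2]
    · simp [runList, RAMInstr.run, h.reg38, hE'.reg2]
    · simp [runList, RAMInstr.run, h.reg37]
    · simp [runList, RAMInstr.run, h.xreg10]
    · simp [runList, RAMInstr.run, h.xreg12]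
    · simp [runList, RAMInstr.run, h.xreg13]
    · exact h.mem
  · simp; omega

/-- The cost is linear in `n + G`, not `n * G`, because the numbers of cells of the actions add up
to `G`. -/
theorem fillRow_runs (hE : Env q s) (hn : 0 < q.n)
    (hw : ∀ j < q.n, 0 < s.xmem (s.reg 32 + j)) :
    fillRow.Runs table coins s (13 * q.n + 4 * q.G + 12) fun s' => Keeps s s' ∧
      s'.xmem = s.xmem ∧ s'.pos = s.pos ∧ s'.reg 32 = s.reg 32 + q.n ∧
      s'.reg 33 = s.reg 33 + q.D * q.G ∧ s'.reg 34 = s.reg 34 + 1 ∧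
      ∀ a, s'.mem a = if s.reg 33 ≤ a ∧ a < s.reg 33 + q.G then
        roundTable (fun j => s.xmem (s.reg 32 + j)) q.n q.G (a - s.reg 33) else s.mem a := by
  set w : ℕ → ℝ := fun j => s.xmem (s.reg 32 + j) with hwdef
  refine (RAMProg.Runs.seq (sumWeights_runs hE) (R := _) (t' := 8 * q.n + 4 * q.G + 8)
    ?_).mono (by omega) (fun _ h => h)
  rintro s₁ ⟨h1, h2, h3, h4, h5, h6⟩
  have hE1 := hE.keeps h1
  refine (RAMProg.runs_block_seq (RAMProg.Runs.seq (RAMProg.runs_loop_sum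
    (fun j => RowInv q s w j (cellCount w q.n q.G j) j) (N := q.n)
    (fun j => 4 * (cellCount w q.n q.G (j + 1) - cellCount w q.n q.G j) + 7)
    ?_ ?_ ?_) (t' := 2) ?_)).mono ?_ (fun _ h => h)
  · intro j hj s' h
    rw [RAMTest.Holds, h.reg36, (hE.keeps h.keeps).reg1]
    omega
  · intro j hj s' h
    exact fillCells_runs hE hj hw rfl h
  · rw [cellCount_zero]
    constructor
    · refine ⟨fun r hr => ?_, fun r hr => ?_⟩
      · simp (disch := omega) [runList, RAMInstr.run, Function.update_of_ne, h1.1 r hr]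
      · simp (disch := omega) [runList, RAMInstr.run, Function.update_of_ne, h1.2 r hr]
    · simp [runList, RAMInstr.run, h3]
    · simp [runList, RAMInstr.run, h4]
    · simp [runList, RAMInstr.run, h5]
    · simp [runList, RAMInstr.run, h5]
    · simp [runList, RAMInstr.run, h5]
    · simp [runList, RAMInstr.run]
    · simp [runList, RAMInstr.run]
    · simp [runList, RAMInstr.run, h5, hE.reg10]
    · simp [runList, RAMInstr.run, h6, hwdef]
    · simp [runList, RAMInstr.run, h6, hwdef, hE1.xreg0]
    · simp [runList, RAMInstr.run, hE1.xreg0]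
    · intro a
      simp [runList, RAMInstr.run, h2]
  · intro s' h
    rw [cellCount_self hw hn] at h
    have hE' := hE.keeps h.keeps
    refine RAMProg.runs_block ?_ le_rfl
    refine ⟨⟨fun r hr => ?_, h.keeps.2⟩, ?_, ?_, ?_, ?_, ?_, fun a => ?_⟩
    · simp (disch := omega) [runList, RAMInstr.run, Function.update_of_ne, h.keeps.1 r hr]
    · simp [runList, RAMInstr.run, h.xmem]
    · simp [runList, RAMInstr.run, h.pos]
    · simp [runList, RAMInstr.run, h.reg32]
    · simp [runList, RAMInstr.run, h.reg33, hE'.reg5]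
    · simp [runList, RAMInstr.run, h.reg34, hE'.reg2]
    · simp [runList, RAMInstr.run, h.mem]
  · have hsum : ∑ j ∈ Finset.range q.n, (cellCount w q.n q.G (j + 1) - cellCount w q.n q.G j)
        = q.G := by
      have key : ∀ b ≤ q.n, ∑ j ∈ Finset.range b,
          (cellCount w q.n q.G (j + 1) - cellCount w q.n q.G j) = cellCount w q.n q.G b := by
        intro b hb
        induction b with
        | zero => simp [cellCount_zero]
        | succ b ih =>
          rw [Finset.sum_range_succ, ih (by omega)]
          have : cellCount w q.n q.G b ≤ cellCount w q.n q.G (b + 1) :=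
            cellCount_mono hw (Nat.le_succ b) hb
          omega
      rw [key q.n le_rfl, cellCount_self hw hn]
    have : ∑ j ∈ Finset.range q.n,
        (4 * (cellCount w q.n q.G (j + 1) - cellCount w q.n q.G j) + 7 + 1)
        = 4 * q.G + 8 * q.n := by
      simp only [add_assoc, Finset.sum_add_distrib, ← Finset.mul_sum, hsum]
      simp [mul_comm]
      ring
    rw [this]
    simp
    omega

/-- The rows of different players are `D * G` cells apart, since each player's tables of all the
levels are contiguous. Only the slice of the current level is overwritten. -/
theorem fillTable_runs (hE : Env q s) (hn : 0 < q.n) (hD : 0 < q.D)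
    (hw : ∀ x < q.N, 0 < s.xmem (s.reg 21 + q.N + x)) :
    fillTable.Runs table coins s (q.m * (13 * q.n + 4 * q.G + 13) + 4) fun s' => Keeps s s' ∧
      s'.xmem = s.xmem ∧ s'.pos = s.pos ∧
      (∀ i < q.m, ∀ k < q.G, s'.mem (q.m + i * (q.D * q.G) + s.reg 22 + k) =
        roundTable (fun j => s.xmem (s.reg 21 + q.N + (i * q.n + j))) q.n q.G k) ∧
      ∀ a, (∀ i < q.m, ∀ k < q.G, a ≠ q.m + i * (q.D * q.G) + s.reg 22 + k) →
        s'.mem a = s.mem a := by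
  have hDG : q.G ≤ q.D * q.G := Nat.le_mul_of_pos_left _ hD
  refine (RAMProg.runs_block_seq (RAMProg.runs_for (fun b s' => Keeps s s' ∧
      s'.xmem = s.xmem ∧ s'.pos = s.pos ∧ s'.reg 34 = b + 1 ∧
      s'.reg 32 = s.reg 21 + q.N + b * q.n ∧ s'.reg 33 = q.m + s.reg 22 + b * (q.D * q.G) ∧
      (∀ i < b, ∀ k < q.G, s'.mem (q.m + i * (q.D * q.G) + s.reg 22 + k) =
        roundTable (fun j => s.xmem (s.reg 21 + q.N + (i * q.n + j))) q.n q.G k) ∧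
      ∀ a, (∀ i < b, ∀ k < q.G, a ≠ q.m + i * (q.D * q.G) + s.reg 22 + k) →
        s'.mem a = s.mem a) (N := q.m) (tb := 13 * q.n + 4 * q.G + 12)
      (fun k _ s' h => h.2.2.2.1) (fun k _ s' h => (hE.keeps h.1).reg0) ?_ ?_)).mono ?_ ?_
  · rintro b hb s' ⟨h1, h2, h3, h4, h5, h6, h7, h8⟩
    have hE' := hE.keeps h1
    have hx : ∀ j, s'.xmem (s'.reg 32 + j) = s.xmem (s.reg 21 + q.N + (b * q.n + j)) := by
      intro j; rw [h2, h5, add_assoc]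
    refine (fillRow_runs hE' hn fun j hj => ?_).mono le_rfl ?_
    · rw [hx]
      apply hw
      rw [Params.N]
      nlinarith
    · rintro s'' ⟨g1, g2, g3, g4, g5, g6, g7⟩
      refine ⟨h1.trans g1, g2.trans h2, g3.trans h3, by rw [g6, h4], by rw [g4, h5]; ring,
        by rw [g5, h6]; ring, fun i hi k hk => ?_, fun a ha => ?_⟩
      · rw [g7, h6]
        rcases Nat.lt_succ_iff_lt_or_eq.1 hi with hi | rfl
        · have : (i + 1) * (q.D * q.G) ≤ b * (q.D * q.G) := Nat.mul_le_mul_right _ hi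
          rw [Nat.succ_mul] at this
          rw [if_neg (by omega), h7 i hi k hk]
        · rw [if_pos (by omega)]
          simp only [hx]
          congr 1
          omega
      · rw [g7, h6, if_neg, h8 a fun i hi k hk => ha i (by omega) k hk]
        rintro ⟨ha1, ha2⟩
        exact ha b (by omega) (a - (q.m + s.reg 22 + b * (q.D * q.G))) (by omega) (by omega)
  · refine ⟨⟨fun r hr => ?_, fun r hr => rfl⟩, rfl, rfl, ?_, ?_, ?_, by omega, fun a _ => rfl⟩
    · simp (disch := omega) [runList, RAMInstr.run, Function.update_of_ne]
    · simp [runList, RAMInstr.run]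
    · simp [runList, RAMInstr.run, hE.reg3]
    · simp [runList, RAMInstr.run, hE.reg0]
  · show 3 + (q.m * (13 * q.n + 4 * q.G + 13) + 1) ≤ _
    omega
  · rintro s' ⟨h1, h2, h3, h4, h5, h6, h7, h8⟩
    exact ⟨h1, h2, h3, h7, h8⟩

end

/-! ### Programs for closing a block and for the output -/

/-- Close a block of the current level: reset the accumulators, multiply the weights, and add to the
accumulators of the level above. -/
def closeBlock : RAMProg :=
  .seq (.block [.add 30 21 10, .const 31 1])
    (.loop (.le 31 3) (.block [.xload 10 30, .xstore 30 0, .add 35 30 3, .xload 11 35,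
      .xmul 12 10 2, .xadd 12 12 1, .xmul 11 11 12, .xstore 35 11, .add 36 30 11, .xload 11 36,
      .xmul 12 10 3, .xadd 11 11 12, .xstore 36 11, .add 30 30 2, .add 31 31 2]))

/-- Add the strategies of the current round to the output. -/
def emit : RAMProg :=
  .seq (.block [.add 40 0 10, .add 41 20 10, .const 46 1])
    (.loop (.le 46 0) (.seq (.block [.add 45 40 10, .const 42 1])
      (.seq (.loop (.le 42 5) (.block [.load 43 45, .add 43 43 41, .xload 10 43, .xadd 10 10 5,
          .xstore 43 10, .add 45 45 2, .add 42 42 2]))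
        (.block [.add 40 40 5, .add 41 41 1, .add 46 46 2]))))

section

variable {table : ℕ → ℝ} {coins : ℕ → Bool} {q : Params} {s : RAMState}

/-- From register `21` on lie the accumulators of the current level, its weights, and the
accumulators of the level above, each of length `N`. Scaling by 1/M on the way up turns sums into
block averages. -/
theorem closeBlock_runs (hE : Env q s) :
    closeBlock.Runs table coins s (16 * q.N + 3) fun s' => Keeps s s' ∧
      s'.mem = s.mem ∧ s'.pos = s.pos ∧
      (∀ x < q.N, s'.xmem (s.reg 21 + x) = 0 ∧
        s'.xmem (s.reg 21 + q.N + x) =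
          s.xmem (s.reg 21 + q.N + x) * (1 + 1 / q.D * s.xmem (s.reg 21 + x)) ∧
        s'.xmem (s.reg 21 + 2 * q.N + x) =
          s.xmem (s.reg 21 + 2 * q.N + x) + s.xmem (s.reg 21 + x) * (1 / q.M)) ∧
      ∀ a, (a < s.reg 21 ∨ s.reg 21 + 3 * q.N ≤ a) → s'.xmem a = s.xmem a := by
  refine (RAMProg.runs_block_seq (RAMProg.runs_for (fun k s' => Keeps s s' ∧
      s'.mem = s.mem ∧ s'.pos = s.pos ∧ s'.reg 30 = s.reg 21 + k ∧ s'.reg 31 = k + 1 ∧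
      (∀ x < k, s'.xmem (s.reg 21 + x) = 0 ∧
        s'.xmem (s.reg 21 + q.N + x) =
          s.xmem (s.reg 21 + q.N + x) * (1 + 1 / q.D * s.xmem (s.reg 21 + x)) ∧
        s'.xmem (s.reg 21 + 2 * q.N + x) =
          s.xmem (s.reg 21 + 2 * q.N + x) + s.xmem (s.reg 21 + x) * (1 / q.M)) ∧
      ∀ a, (∀ x < k, a ≠ s.reg 21 + x ∧ a ≠ s.reg 21 + q.N + x ∧ a ≠ s.reg 21 + 2 * q.N + x) →
        s'.xmem a = s.xmem a) (N := q.N) (tb := 15)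
    (fun k _ s' h => h.2.2.2.2.1) (fun k _ s' h => (hE.keeps h.1).reg3) ?_ ?_)).mono ?_ ?_
  · rintro k hk s' ⟨h1, h2, h3, h4, h5, h6, h7⟩
    have hE' := hE.keeps h1
    have hx : (runList table coins s' [.xload 10 30, .xstore 30 0, .add 35 30 3, .xload 11 35,
        .xmul 12 10 2, .xadd 12 12 1, .xmul 11 11 12, .xstore 35 11, .add 36 30 11, .xload 11 36,
        .xmul 12 10 3, .xadd 11 11 12, .xstore 36 11, .add 30 30 2, .add 31 31 2]).xmem
        = Function.update (Function.update (Function.update s'.xmem (s.reg 21 + k) 0)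
          (s.reg 21 + q.N + k)
            (s.xmem (s.reg 21 + q.N + k) * (1 + 1 / q.D * s.xmem (s.reg 21 + k))))
          (s.reg 21 + 2 * q.N + k)
            (s.xmem (s.reg 21 + 2 * q.N + k) + s.xmem (s.reg 21 + k) * (1 / q.M)) := by
      have e0 : s'.xmem (s.reg 21 + k) = s.xmem (s.reg 21 + k) := h7 _ fun x hx => by omega
      have e1 : s'.xmem (s.reg 21 + k + q.N) = s.xmem (s.reg 21 + q.N + k) := by
        rw [show s.reg 21 + k + q.N = s.reg 21 + q.N + k by omega]
        exact h7 _ fun x hx => by omega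
      have e2 : s'.xmem (s.reg 21 + k + 2 * q.N) = s.xmem (s.reg 21 + 2 * q.N + k) := by
        rw [show s.reg 21 + k + 2 * q.N = s.reg 21 + 2 * q.N + k by omega]
        exact h7 _ fun x hx => by omega
      -- Positive length of the segments keeps the three addresses distinct.
      have hN : q.N ≠ 0 := by omega
      simp [runList, RAMInstr.run, h4, hE'.reg3, hE'.reg11,
        hE'.xreg0, hE'.xreg1, hE'.xreg2, hE'.xreg3, e0, e1, e2, hN]
      rw [show s.reg 21 + k + 2 * q.N = s.reg 21 + 2 * q.N + k by omega,
        show s.reg 21 + k + q.N = s.reg 21 + q.N + k by omega,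
        add_comm (1 : ℝ), mul_comm ((q.D : ℝ)⁻¹)]
    refine RAMProg.runs_block ?_ le_rfl
    refine ⟨⟨fun r hr => ?_, fun r hr => ?_⟩, ?_, ?_, ?_, ?_, fun x hx' => ?_, fun a ha => ?_⟩
    · simp (disch := omega) [runList, RAMInstr.run, Function.update_of_ne, h1.1 r hr]
    · simp (disch := omega) [runList, RAMInstr.run, Function.update_of_ne, h1.2 r hr]
    · simp [runList, RAMInstr.run, h2]
    · simp [runList, RAMInstr.run, h3]
    · simp [runList, RAMInstr.run, h4, hE'.reg2]; ring
    · simp [runList, RAMInstr.run, h5, hE'.reg2]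
    · rw [hx]
      rcases Nat.lt_succ_iff_lt_or_eq.1 hx' with hlt | rfl
      · obtain ⟨g1, g2, g3⟩ := h6 x hlt
        refine ⟨?_, ?_, ?_⟩
        · simp (disch := omega) [Function.update_of_ne, g1]
        · simp (disch := omega) only [Function.update_of_ne, g2]
        · simp (disch := omega) only [Function.update_of_ne, g3]
      · refine ⟨?_, ?_, ?_⟩
        · simp (disch := omega) [Function.update_of_ne]
        · simp (disch := omega) only [Function.update_of_ne, Function.update_self]
        · simp only [Function.update_self]
    · rw [hx]
      have := ha k (by omega)
      simp (disch := omega) only [Function.update_of_ne]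
      exact h7 a fun x hx => ha x (by omega)
  · refine ⟨⟨fun r hr => ?_, fun r hr => rfl⟩, rfl, rfl, ?_, ?_, by omega, fun a _ => rfl⟩
    · simp (disch := omega) [runList, RAMInstr.run, Function.update_of_ne]
    · simp [runList, RAMInstr.run, hE.reg10]
    · simp [runList, RAMInstr.run]
  · simp; omega
  · rintro s' ⟨h1, h2, h3, h4, h5, h6, h7⟩
    exact ⟨h1, h2, h3, h6, fun a ha => h7 a fun x hx => by omega⟩

/-- Every cell adds its share 1/(DG) to the probability of its action. It is an increment, so the
output must be blank beforehand. -/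
theorem emit_runs (hE : Env q s) :
    emit.Runs table coins s (q.m * (8 * (q.D * q.G) + 7) + 4) fun s' => Keeps s s' ∧
      s'.mem = s.mem ∧ s'.pos = s.pos ∧
      ∀ a, s'.xmem a = s.xmem a + ∑ i ∈ Finset.range q.m,
        (((Finset.range (q.D * q.G)).filter fun k =>
          s.mem (q.m + i * (q.D * q.G) + k) + (s.reg 20 + i * q.n) = a).card : ℝ)
            * (1 / (q.D * q.G : ℕ)) := by
  set κ : ℝ := 1 / (q.D * q.G : ℕ) with hκ
  refine (RAMProg.runs_block_seq (RAMProg.runs_for (fun b s' => Keeps s s' ∧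
      s'.mem = s.mem ∧ s'.pos = s.pos ∧ s'.reg 40 = q.m + b * (q.D * q.G) ∧
      s'.reg 41 = s.reg 20 + b * q.n ∧ s'.reg 46 = b + 1 ∧
      ∀ a, s'.xmem a = s.xmem a + ∑ i ∈ Finset.range b,
        (((Finset.range (q.D * q.G)).filter fun k =>
          s.mem (q.m + i * (q.D * q.G) + k) + (s.reg 20 + i * q.n) = a).card : ℝ) * κ)
      (N := q.m) (tb := 8 * (q.D * q.G) + 6)
      (fun k _ s' h => h.2.2.2.2.2.1) (fun k _ s' h => (hE.keeps h.1).reg0) ?_ ?_)).mono ?_ ?_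
  · rintro b hb s₁ ⟨h1, h2, h3, h4, h5, h6, h7⟩
    refine (RAMProg.runs_block_seq (RAMProg.Runs.seq (RAMProg.runs_for (fun k s' => Keeps s s' ∧
      s'.mem = s.mem ∧ s'.pos = s.pos ∧ s'.reg 40 = q.m + b * (q.D * q.G) ∧
      s'.reg 41 = s.reg 20 + b * q.n ∧ s'.reg 46 = b + 1 ∧ s'.reg 42 = k + 1 ∧
      s'.reg 45 = q.m + b * (q.D * q.G) + k ∧
      ∀ a, s'.xmem a = s₁.xmem a + (((Finset.range k).filter fun k =>
          s.mem (q.m + b * (q.D * q.G) + k) + (s.reg 20 + b * q.n) = a).card : ℝ) * κ)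
      (N := q.D * q.G) (tb := 7) (fun k _ s' h => h.2.2.2.2.2.2.1)
      (fun k _ s' h => (hE.keeps h.1).reg5) ?_ ?_) (t' := 3) ?_)).mono ?_ (fun _ h => h)
    · rintro k hk s' ⟨g1, g2, g3, g4, g5, g6, g7, g8, g9⟩
      have hE' := hE.keeps g1
      refine RAMProg.runs_block ?_ le_rfl
      refine ⟨⟨fun r hr => ?_, fun r hr => ?_⟩, ?_, ?_, ?_, ?_, ?_, ?_, ?_, fun a => ?_⟩
      · simp (disch := omega) [runList, RAMInstr.run, Function.update_of_ne, g1.1 r hr]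
      · simp (disch := omega) [runList, RAMInstr.run, Function.update_of_ne, g1.2 r hr]
      · simp [runList, RAMInstr.run, g2]
      · simp [runList, RAMInstr.run, g3]
      · simp [runList, RAMInstr.run, g4]
      · simp [runList, RAMInstr.run, g5]
      · simp [runList, RAMInstr.run, g6]
      · simp [runList, RAMInstr.run, g7, hE'.reg2]
      · simp [runList, RAMInstr.run, g8, hE'.reg2]; ring
      · rw [Finset.range_add_one, Finset.filter_insert]
        simp only [runList, RAMInstr.run, List.foldl, Function.update_apply, g8, g2, g5, g9,
          hE'.xreg5]
        by_cases ha : a = s.mem (q.m + b * (q.D * q.G) + k) + (s.reg 20 + b * q.n)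
        · subst ha
          rw [if_pos rfl, Finset.card_insert_of_notMem (by simp)]
          simp [hκ]
          ring
        · rw [if_neg (Ne.symm ha)]
          simp [ha]
    · refine ⟨⟨fun r hr => ?_, h1.2⟩, h2, h3, ?_, ?_, ?_, ?_, ?_, fun a => ?_⟩
      · simp (disch := omega) [runList, RAMInstr.run, Function.update_of_ne, h1.1 r hr]
      · simp [runList, RAMInstr.run, h4]
      · simp [runList, RAMInstr.run, h5]
      · simp [runList, RAMInstr.run, h6]
      · simp [runList, RAMInstr.run]
      · simp [runList, RAMInstr.run, h4, (hE.keeps h1).reg10]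
      · simp [runList, RAMInstr.run]
    · rintro s' ⟨g1, g2, g3, g4, g5, g6, g7, g8, g9⟩
      have hE' := hE.keeps g1
      refine RAMProg.runs_block ?_ le_rfl
      refine ⟨⟨fun r hr => ?_, g1.2⟩, g2, g3, ?_, ?_, ?_, fun a => ?_⟩
      · simp (disch := omega) [runList, RAMInstr.run, Function.update_of_ne, g1.1 r hr]
      · simp [runList, RAMInstr.run, g4, hE'.reg5]; ring
      · simp [runList, RAMInstr.run, g5, hE'.reg1]; ring
      · simp [runList, RAMInstr.run, g6, hE'.reg2]
      · rw [Finset.sum_range_succ, ← add_assoc, ← h7, ← g9]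
        simp [runList, RAMInstr.run]
    · simp; omega
  · refine ⟨⟨fun r hr => ?_, fun r hr => rfl⟩, rfl, rfl, ?_, ?_, ?_, fun a => ?_⟩
    · simp (disch := omega) [runList, RAMInstr.run, Function.update_of_ne]
    · simp [runList, RAMInstr.run, hE.reg10, hE.reg0]
    · simp [runList, RAMInstr.run, hE.reg10]
    · simp [runList, RAMInstr.run]
    · simp [runList, RAMInstr.run]
  · show 3 + (q.m * (8 * (q.D * q.G) + 7) + 1) ≤ _
    omega
  · rintro s' ⟨h1, h2, h3, h4, h5, h6, h7⟩
    exact ⟨h1, h2, h3, h7⟩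

end

/-! ### Programs for sampling profiles and reading utilities -/

/-- The number whose binary digits are the `B` coins from position `p` on. -/
def coinValue (coins : ℕ → Bool) (p : ℕ) : ℕ → ℕ
  | 0 => 0
  | B + 1 => 2 * coinValue coins p B + if coins (p + B) then 1 else 0

/-- Sample the action of one player, and record its contribution to the table address. -/
def sampleAction : RAMProg :=
  .seq (.block [.const 43 0, .const 42 1])
    (.seq (.loop (.le 42 6) (.block [.coin 44, .add 43 43 43, .add 43 43 44, .add 42 42 2]))
      (.seq (.block [.add 43 43 40, .load 43 43])
        (.seq (mulProg 42 44 45 43)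
          (.seq (.block [.store 47 44, .add 46 46 44, .add 47 47 2])
            (.seq (mulProg 42 44 45 1)
              (.block [.add 45 44 10, .add 40 40 5, .add 48 48 2]))))))

/-- Sample an action profile. -/
def sampleProfile : RAMProg :=
  .seq (.block [.const 45 1, .const 46 0, .add 40 0 10, .const 47 0, .const 48 1])
    (.loop (.le 48 0) sampleAction)

/-- Add the utilities of all deviations from the sampled profile to the accumulators. -/
def readUtilities : RAMProg :=
  .seq (.block [.add 40 46 10, .const 43 1, .const 47 0, .add 49 21 10, .const 48 1])
    (.loop (.le 48 0)
      (.seq (.block [.load 44 47, .sub 44 40 44, .add 42 44 10, .const 41 1])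
        (.seq (.loop (.le 41 1) (.block [.input 10 44, .xmul 10 10 4, .xload 11 49,
            .xadd 11 11 10, .xstore 49 11, .add 49 49 2, .add 44 44 43, .add 41 41 2]))
          (.block [.sub 43 44 42, .add 40 40 45, .add 47 47 2, .add 48 48 2]))))

section

variable {table : ℕ → ℝ} {coins : ℕ → Bool} {q : Params} {s : RAMState}

theorem coinLoop_runs (hE : Env q s) :
    (RAMProg.seq (.block [.const 43 0, .const 42 1])
      (.loop (.le 42 6) (.block [.coin 44, .add 43 43 43, .add 43 43 44, .add 42 42 2]))).Runs
      table coins s (5 * q.B + 3) fun s' => Keeps s s' ∧ s'.mem = s.mem ∧ s'.xmem = s.xmem ∧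
        s'.pos = s.pos + q.B ∧ s'.reg 43 = coinValue coins s.pos q.B ∧
        ∀ r, r < 42 ∨ 45 ≤ r → s'.reg r = s.reg r := by
  refine (RAMProg.runs_block_seq (RAMProg.runs_for (fun k s' => Keeps s s' ∧ s'.mem = s.mem ∧
      s'.xmem = s.xmem ∧ s'.pos = s.pos + k ∧ s'.reg 43 = coinValue coins s.pos k ∧
      (∀ r, r < 42 ∨ 45 ≤ r → s'.reg r = s.reg r) ∧ s'.reg 42 = k + 1) (N := q.B) (tb := 4)
      (fun k _ s' h => h.2.2.2.2.2.2) (fun k _ s' h => (hE.keeps h.1).reg6) ?_ ?_)).mono ?_ ?_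
  · rintro k hk s' ⟨h1, h2, h3, h4, h5, h6, h7⟩
    have hE' := hE.keeps h1
    refine RAMProg.runs_block ?_ le_rfl
    refine ⟨⟨fun r hr => ?_, h1.2⟩, ?_, ?_, ?_, ?_, fun r hr => ?_, ?_⟩
    · simp (disch := omega) [runList, RAMInstr.run, Function.update_of_ne, h1.1 r hr]
    · simp [runList, RAMInstr.run, h2]
    · simp [runList, RAMInstr.run, h3]
    · simp [runList, RAMInstr.run, h4]; ring
    · simp [runList, RAMInstr.run, h5, h4, coinValue]; ring
    · simp (disch := omega) [runList, RAMInstr.run, Function.update_of_ne, h6 r hr]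
    · simp [runList, RAMInstr.run, h7, hE'.reg2]
  · refine ⟨⟨fun r hr => ?_, fun r hr => rfl⟩, rfl, rfl, rfl, ?_, fun r hr => ?_, ?_⟩
    · simp (disch := omega) [runList, RAMInstr.run, Function.update_of_ne]
    · simp [runList, RAMInstr.run, coinValue]
    · simp (disch := omega) [runList, RAMInstr.run, Function.update_of_ne]
    · simp [runList, RAMInstr.run]
  · simp; omega
  · rintro s' ⟨h1, h2, h3, h4, h5, h6, h7⟩
    exact ⟨h1, h2, h3, h4, h5, h6⟩

theorem mulProg_keeps {d b : ℕ} (hE : Env q s) (hd : d = 44) (hb : b = 43 ∨ b = 1) :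
    (mulProg 42 d 45 b).Runs table coins s (3 * s.reg b + 3) fun s' => Keeps s s' ∧
      s'.mem = s.mem ∧ s'.xmem = s.xmem ∧ s'.pos = s.pos ∧ s'.reg 44 = s.reg 45 * s.reg b ∧
        ∀ r, r < 42 ∨ r = 43 ∨ 45 ≤ r → s'.reg r = s.reg r := by
  refine (mulProg_runs hE.reg2 ?_ ?_ ?_ ?_ ?_ ?_ ?_).mono le_rfl ?_
  any_goals omega
  rintro s' rfl
  subst hd
  refine ⟨⟨fun r hr => ?_, fun r hr => rfl⟩, rfl, rfl, rfl, ?_, fun r hr => ?_⟩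
  · simp (disch := omega) [Function.update_of_ne]
  · simp
  · simp (disch := omega) [Function.update_of_ne]

/-- The two products are of the power of `n` in register `45` by the sampled action and by `n`. Both
multipliers are at most `n`, hence the term `6 * q.n`. -/
theorem sampleAction_runs (hE : Env q s)
    (hlt : s.mem (s.reg 40 + coinValue coins s.pos q.B) ≤ q.n) :
    sampleAction.Runs table coins s (5 * q.B + 6 * q.n + 17) fun s' => Keeps s s' ∧
      s'.xmem = s.xmem ∧ s'.pos = s.pos + q.B ∧
      s'.mem = Function.update s.mem (s.reg 47)
        (s.reg 45 * s.mem (s.reg 40 + coinValue coins s.pos q.B)) ∧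
      s'.reg 40 = s.reg 40 + q.D * q.G ∧ s'.reg 45 = s.reg 45 * q.n ∧
      s'.reg 46 = s.reg 46 + s.reg 45 * s.mem (s.reg 40 + coinValue coins s.pos q.B) ∧
      s'.reg 47 = s.reg 47 + 1 ∧ s'.reg 48 = s.reg 48 + 1 := by
  set v := s.mem (s.reg 40 + coinValue coins s.pos q.B) with hv
  -- Regroups the sequence so that tossing the coins becomes a unit.
  have hassoc : ∀ {p₁ p₂ p₃ : RAMProg} {s : RAMState} {t : ℕ} {Q : RAMState → Prop},
      (RAMProg.seq (.seq p₁ p₂) p₃).Runs table coins s t Q →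
      (RAMProg.seq p₁ (.seq p₂ p₃)).Runs table coins s t Q := by
    rintro p₁ p₂ p₃ s t Q ⟨s', t', h1, h2, h3⟩
    cases h1 with
    | seq a b =>
      cases a with
      | seq c d => exact ⟨s', _, .seq c (.seq d b), by omega, h3⟩
  refine hassoc (((coinLoop_runs hE).seq (t' := 6 * q.n + 14) ?_).mono (by omega) fun _ h => h)
  rintro s₁ ⟨h1, h2, h3, h4, h5, h6⟩
  have hE1 := hE.keeps h1
  set s₂ := runList table coins s₁ [.add 43 43 40, .load 43 43] with hs₂
  have k2 : Keeps s₁ s₂ := ⟨fun r hr => by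
    simp (disch := omega) [hs₂, runList, RAMInstr.run, Function.update_of_ne], fun _ _ => rfl⟩
  have r2 : s₂.reg 43 = v := by
    simp [hs₂, runList, RAMInstr.run, h5, h2, h6, hv, add_comm]
  have f2 : ∀ r, 45 ≤ r ∨ r = 40 → s₂.reg r = s.reg r := fun r hr => by
    rw [← h6 r (by omega)]
    simp (disch := omega) [hs₂, runList, RAMInstr.run, Function.update_of_ne]
  have hE2 := hE1.keeps k2
  refine (RAMProg.runs_block_seq (((mulProg_keeps hE2 rfl (Or.inl rfl)).seq
    (t' := 3 * q.n + 9) ?_).mono (t' := 6 * q.n + 12) (by rw [r2]; omega) fun _ h => h)).mono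
    (by simp; omega) fun _ h => h
  rintro s₃ ⟨k3, m3, x3, p3, g3, f3⟩
  rw [r2, f2 45 (by omega)] at g3
  set s₄ := runList table coins s₃ [.store 47 44, .add 46 46 44, .add 47 47 2] with hs₄
  have k4 : Keeps s₃ s₄ := ⟨fun r hr => by
    simp (disch := omega) [hs₄, runList, RAMInstr.run, Function.update_of_ne], fun _ _ => rfl⟩
  have hE4 := (hE2.keeps k3).keeps k4
  refine (RAMProg.runs_block_seq (((mulProg_keeps hE4 rfl (Or.inr rfl)).seq
    (t' := 3) ?_).mono (t' := 3 * q.n + 6) (by rw [hE4.reg1]) fun _ h => h)).mono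
    (by simp; omega) fun _ h => h
  rintro s₅ ⟨k5, m5, x5, p5, g5, f5⟩
  have hE5 := hE4.keeps k5
  refine RAMProg.runs_block ?_ le_rfl
  have e40 : s₅.reg 40 = s.reg 40 := by
    rw [f5 40 (by omega), hs₄]
    simp [runList, RAMInstr.run, f3, f2]
  have e45 : s₄.reg 45 = s.reg 45 := by
    rw [hs₄]
    simp [runList, RAMInstr.run, f3, f2]
  have e47 : s₃.reg 47 = s.reg 47 := by rw [f3 47 (by omega), f2 47 (by omega)]
  refine ⟨(((h1.trans k2).trans k3).trans k4).trans (k5.trans ⟨fun r hr => ?_, fun _ _ => rfl⟩),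
    ?_, ?_, ?_, ?_, ?_, ?_, ?_, ?_⟩
  · simp (disch := omega) [runList, RAMInstr.run, Function.update_of_ne]
  · change s₅.xmem = _
    rw [x5]
    change s₃.xmem = _
    rw [x3]
    exact h3
  · change s₅.pos = _
    rw [p5]
    change s₃.pos = _
    rw [p3]
    exact h4
  · change s₅.mem = _
    rw [m5, hs₄]
    simp only [runList, RAMInstr.run, List.foldl, g3, m3, e47]
    change Function.update s₁.mem _ _ = _
    rw [h2]
  · simp [runList, RAMInstr.run, e40, hE5.reg5]
  · simp [runList, RAMInstr.run, g5, e45, hE4.reg1, hE5.reg10]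
  · simp [runList, RAMInstr.run, f5, hs₄, g3, f3, f2]
  · simp [runList, RAMInstr.run, f5, hs₄, f3, f2, hE2.reg2]
  · simp [runList, RAMInstr.run, f5, hs₄, f3, f2, hE2.reg2]

/-- Cell `i` keeps the contribution of player `i` to the profile's address, which is later taken off
to let that player deviate. The final power n^m is the stride between the utility arrays of
consecutive players. -/
theorem sampleProfile_runs (hE : Env q s)
    (hlt : ∀ i < q.m, s.mem (q.m + i * (q.D * q.G) + coinValue coins (s.pos + i * q.B) q.B) ≤ q.n) :
    sampleProfile.Runs table coins s (q.m * (5 * q.B + 6 * q.n + 18) + 6) fun s' => Keeps s s' ∧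
      s'.xmem = s.xmem ∧ s'.pos = s.pos + q.m * q.B ∧
      (∀ i < q.m, s'.mem i = q.n ^ i *
        s.mem (q.m + i * (q.D * q.G) + coinValue coins (s.pos + i * q.B) q.B)) ∧
      (∀ a, q.m ≤ a → s'.mem a = s.mem a) ∧ s'.reg 45 = q.n ^ q.m ∧
      s'.reg 46 = ∑ i ∈ Finset.range q.m, q.n ^ i *
        s.mem (q.m + i * (q.D * q.G) + coinValue coins (s.pos + i * q.B) q.B) := by
  refine (RAMProg.runs_block_seq (RAMProg.runs_for (fun b s' => Keeps s s' ∧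
      s'.xmem = s.xmem ∧ s'.pos = s.pos + b * q.B ∧
      (∀ i < b, s'.mem i = q.n ^ i *
        s.mem (q.m + i * (q.D * q.G) + coinValue coins (s.pos + i * q.B) q.B)) ∧
      (∀ a, q.m ≤ a → s'.mem a = s.mem a) ∧ s'.reg 45 = q.n ^ b ∧
      s'.reg 46 = ∑ i ∈ Finset.range b, q.n ^ i *
        s.mem (q.m + i * (q.D * q.G) + coinValue coins (s.pos + i * q.B) q.B) ∧
      s'.reg 48 = b + 1 ∧ s'.reg 47 = b ∧ s'.reg 40 = q.m + b * (q.D * q.G))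
      (N := q.m) (tb := 5 * q.B + 6 * q.n + 17)
      (fun k _ s' h => h.2.2.2.2.2.2.2.1) (fun k _ s' h => (hE.keeps h.1).reg0) ?_ ?_)).mono ?_ ?_
  · rintro b hb s' ⟨h1, h2, h3, h4, h5, h6, h7, h8, h9, h10⟩
    have hv : s'.mem (s'.reg 40 + coinValue coins s'.pos q.B)
        = s.mem (q.m + b * (q.D * q.G) + coinValue coins (s.pos + b * q.B) q.B) := by
      rw [h10, h3, h5 _ (by rw [add_assoc]; exact Nat.le_add_right _ _)]
    refine (sampleAction_runs (hE.keeps h1) (by rw [hv]; exact hlt b hb)).mono le_rfl ?_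
    rintro s'' ⟨g1, g2, g3, g4, g5, g6, g7, g8, g9⟩
    rw [hv, h6, h9] at g4
    rw [hv, h6, h7] at g7
    refine ⟨h1.trans g1, g2.trans h2, by rw [g3, h3]; ring, fun i hi => ?_, fun a ha => ?_,
      by rw [g6, h6, pow_succ], ?_, by rw [g9, h8], by rw [g8, h9], by rw [g5, h10]; ring⟩
    · rw [g4]
      rcases Nat.lt_succ_iff_lt_or_eq.1 hi with hi | rfl
      · rw [Function.update_of_ne (by omega), h4 i hi]
      · rw [Function.update_self]
    · rw [g4, Function.update_of_ne (by omega), h5 a ha]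
    · rw [g7, Finset.sum_range_succ]
  · refine ⟨⟨fun r hr => ?_, fun r hr => rfl⟩, rfl, ?_, by omega, fun a _ => rfl, ?_, ?_, ?_, ?_, ?_⟩
    · simp (disch := omega) [runList, RAMInstr.run, Function.update_of_ne]
    · simp [runList, RAMInstr.run]
    · simp [runList, RAMInstr.run]
    · simp [runList, RAMInstr.run]
    · simp [runList, RAMInstr.run]
    · simp [runList, RAMInstr.run]
    · simp [runList, RAMInstr.run, hE.reg0, hE.reg10]
  · show 5 + (q.m * (5 * q.B + 6 * q.n + 18) + 1) ≤ _
    omega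
  · rintro s' ⟨h1, h2, h3, h4, h5, h6, h7, h8⟩
    exact ⟨h1, h2, h3, h4, h5, h6, h7⟩

end

section

variable {table : ℕ → ℝ} {coins : ℕ → Bool} {q : Params} {s : RAMState}

/-- The deviations of player `i` lie at distance n^i from each other. After `n` of them the address
has moved by n^(i+1), the stride for the next player, so one subtraction replaces a multiplication.
-/
theorem readUtilities_runs (hE : Env q s) {b : ℕ → ℕ} (hb : ∀ i < q.m, s.mem i = b i)
    (hP : s.reg 45 = q.n ^ q.m) :
    readUtilities.Runs table coins s (q.m * (9 * q.n + 10) + 6) fun s' => Keeps s s' ∧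
      s'.mem = s.mem ∧ s'.pos = s.pos ∧
      (∀ i < q.m, ∀ j < q.n, s'.xmem (s.reg 21 + (i * q.n + j)) =
        s.xmem (s.reg 21 + (i * q.n + j)) +
          table (s.reg 46 + i * q.n ^ q.m - b i + j * q.n ^ i) * (1 / q.K)) ∧
      ∀ a, (a < s.reg 21 ∨ s.reg 21 + q.N ≤ a) → s'.xmem a = s.xmem a := by
  refine (RAMProg.runs_block_seq (RAMProg.runs_for (fun d s' => Keeps s s' ∧
      s'.mem = s.mem ∧ s'.pos = s.pos ∧ s'.reg 40 = s.reg 46 + d * q.n ^ q.m ∧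
      s'.reg 43 = q.n ^ d ∧ s'.reg 47 = d ∧ s'.reg 49 = s.reg 21 + d * q.n ∧
      s'.reg 45 = q.n ^ q.m ∧ s'.reg 48 = d + 1 ∧
      (∀ i < d, ∀ j < q.n, s'.xmem (s.reg 21 + (i * q.n + j)) =
        s.xmem (s.reg 21 + (i * q.n + j)) +
          table (s.reg 46 + i * q.n ^ q.m - b i + j * q.n ^ i) * (1 / q.K)) ∧
      ∀ a, (a < s.reg 21 ∨ s.reg 21 + d * q.n ≤ a) → s'.xmem a = s.xmem a)
      (N := q.m) (tb := 9 * q.n + 9)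
      (fun k _ s' h => h.2.2.2.2.2.2.2.2.1) (fun k _ s' h => (hE.keeps h.1).reg0) ?_ ?_)).mono
      ?_ ?_
  · rintro d hd s₁ ⟨h1, h2, h3, h4, h5, h6, h7, h8, h9, h10, h11⟩
    set u := s.reg 46 + d * q.n ^ q.m - b d with hu
    refine (RAMProg.runs_block_seq (RAMProg.Runs.seq (RAMProg.runs_for (fun k s' => Keeps s s' ∧
      s'.mem = s.mem ∧ s'.pos = s.pos ∧ s'.reg 40 = s.reg 46 + d * q.n ^ q.m ∧
      s'.reg 43 = q.n ^ d ∧ s'.reg 47 = d ∧ s'.reg 49 = s.reg 21 + d * q.n + k ∧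
      s'.reg 45 = q.n ^ q.m ∧ s'.reg 48 = d + 1 ∧ s'.reg 41 = k + 1 ∧
      s'.reg 44 = u + k * q.n ^ d ∧ s'.reg 42 = u ∧
      (∀ j < k, s'.xmem (s.reg 21 + d * q.n + j) = s₁.xmem (s.reg 21 + d * q.n + j) +
          table (u + j * q.n ^ d) * (1 / q.K)) ∧
      ∀ a, (∀ j < k, a ≠ s.reg 21 + d * q.n + j) → s'.xmem a = s₁.xmem a)
      (N := q.n) (tb := 8) (fun k _ s' h => h.2.2.2.2.2.2.2.2.2.1)
      (fun k _ s' h => (hE.keeps h.1).reg1) ?_ ?_) (t' := 4) ?_)).mono ?_ (fun _ h => h)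
    · rintro k hk s' ⟨g1, g2, g3, g4, g5, g6, g7, g8, g9, g10, g11, g12, g13, g14⟩
      have hE' := hE.keeps g1
      refine RAMProg.runs_block ?_ le_rfl
      refine ⟨⟨fun r hr => ?_, fun r hr => ?_⟩, ?_, ?_, ?_, ?_, ?_, ?_, ?_, ?_, ?_, ?_, ?_,
        fun j hj => ?_, fun a ha => ?_⟩
      · simp (disch := omega) [runList, RAMInstr.run, Function.update_of_ne, g1.1 r hr]
      · simp (disch := omega) [runList, RAMInstr.run, Function.update_of_ne, g1.2 r hr]
      · simp [runList, RAMInstr.run, g2]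
      · simp [runList, RAMInstr.run, g3]
      · simp [runList, RAMInstr.run, g4]
      · simp [runList, RAMInstr.run, g5]
      · simp [runList, RAMInstr.run, g6]
      · simp [runList, RAMInstr.run, g7, hE'.reg2]; ring
      · simp [runList, RAMInstr.run, g8]
      · simp [runList, RAMInstr.run, g9]
      · simp [runList, RAMInstr.run, g10, hE'.reg2]
      · simp [runList, RAMInstr.run, g11, g5]; ring
      · simp [runList, RAMInstr.run, g12]
      · simp only [runList, RAMInstr.run, List.foldl]
        rcases Nat.lt_succ_iff_lt_or_eq.1 hj with hj | rfl
        · simp [g7, hj.ne, g13 j hj]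
        · simp [g7, g11, hE'.xreg4, g14 (s.reg 21 + d * q.n + j) fun i hi => by omega]
      · have := ha k (by omega)
        simp [runList, RAMInstr.run, g7, Function.update_of_ne this,
          g14 a fun j hj => ha j (by omega)]
    · have hE1 := hE.keeps h1
      have hm : s₁.mem d = b d := by rw [h2, hb d hd]
      refine ⟨⟨fun r hr => ?_, h1.2⟩, h2, h3, ?_, ?_, ?_, ?_, ?_, ?_, ?_, ?_, ?_, by omega,
        fun a _ => rfl⟩
      · simp (disch := omega) [runList, RAMInstr.run, Function.update_of_ne, h1.1 r hr]
      · simp [runList, RAMInstr.run, h4]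
      · simp [runList, RAMInstr.run, h5]
      · simp [runList, RAMInstr.run, h6]
      · simp [runList, RAMInstr.run, h7]
      · simp [runList, RAMInstr.run, h8]
      · simp [runList, RAMInstr.run, h9]
      · simp [runList, RAMInstr.run]
      · simp [runList, RAMInstr.run, h4, h6, hm, hu]
      · simp [runList, RAMInstr.run, h4, h6, hm, hu, hE1.reg10]
    · rintro s' ⟨g1, g2, g3, g4, g5, g6, g7, g8, g9, g10, g11, g12, g13, g14⟩
      have hE' := hE.keeps g1
      refine RAMProg.runs_block ?_ le_rfl
      refine ⟨⟨fun r hr => ?_, g1.2⟩, g2, g3, ?_, ?_, ?_, ?_, ?_, ?_, fun i hi j hj => ?_,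
        fun a ha => ?_⟩
      · simp (disch := omega) [runList, RAMInstr.run, Function.update_of_ne, g1.1 r hr]
      · simp [runList, RAMInstr.run, g4, g8]; ring
      · simp [runList, RAMInstr.run, g11, g12, pow_succ]; ring
      · simp [runList, RAMInstr.run, g6, hE'.reg2]
      · simp [runList, RAMInstr.run, g7]; ring
      · simp [runList, RAMInstr.run, g8]
      · simp [runList, RAMInstr.run, g9, hE'.reg2]
      · change s'.xmem _ = _
        rcases Nat.lt_succ_iff_lt_or_eq.1 hi with hi | rfl
        · have : (i + 1) * q.n ≤ d * q.n := Nat.mul_le_mul_right _ hi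
          rw [Nat.succ_mul] at this
          rw [g14 _ fun j hj => by omega, h10 i hi j hj]
        · rw [← add_assoc, g13 j hj, h11 _ (by omega)]
      · change s'.xmem _ = _
        rw [Nat.succ_mul] at ha
        rw [g14 _ fun j hj => by omega, h11 _ (by omega)]
    · simp; omega
  · refine ⟨⟨fun r hr => ?_, fun r hr => rfl⟩, rfl, rfl, ?_, ?_, ?_, ?_, ?_, ?_, by omega,
      fun a _ => rfl⟩
    · simp (disch := omega) [runList, RAMInstr.run, Function.update_of_ne]
    · simp [runList, RAMInstr.run, hE.reg10]
    · simp [runList, RAMInstr.run]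
    · simp [runList, RAMInstr.run]
    · simp [runList, RAMInstr.run, hE.reg10]
    · simp [runList, RAMInstr.run, hP]
    · simp [runList, RAMInstr.run]
  · show 5 + (q.m * (9 * q.n + 10) + 1) ≤ _
    omega
  · rintro s' ⟨h1, h2, h3, h4, h5, h6, h7, h8, h9, h10, h11⟩
    exact ⟨h1, h2, h3, h10, h11⟩

end

/-! ### One round -/

/-- The table address of the utility of player `i` at the action `j`, when the other players use
the actions `act`. -/
def deviationAddr (m n : ℕ) (act : ℕ → ℕ) (i j : ℕ) : ℕ :=
  ∑ i' ∈ Finset.range m, n ^ i' * act i' + i * n ^ m - n ^ i * act i + j * n ^ i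

/-- Estimated rewards in a round with strategies `σ`, from the samples with indices `z`. -/
noncomputable def estimate (table : ℕ → ℝ) (m n K : ℕ) (σ z : ℕ → ℕ → ℕ) (x : ℕ) : ℝ :=
  ∑ k ∈ Finset.range K,
    table (deviationAddr m n (fun i => σ i (z k i)) (x / n) (x % n)) * (1 / K)

/-- One round: output the strategies, and estimate the rewards. -/
def playRound : RAMProg :=
  .seq emit (.seq (.block [.add 20 20 3, .const 23 1])
    (.loop (.le 23 8) (.seq sampleProfile (.seq readUtilities (.block [.add 23 23 2])))))

/-- A bound for the time of a round. -/
def roundTime (q : Params) : ℕ :=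
  q.m * (8 * (q.D * q.G) + 7) + 4 + (2 + (q.K * (q.m * (5 * q.B + 15 * q.n + 28) + 14) + 1))

/-- The `hlev` hypothesis keeps the round's output apart from the accumulators, and `hz` makes the
accumulated samples equal to the estimate. Each round consumes `K * (m * B)` new coins. -/
theorem playRound_runs {table : ℕ → ℝ} {coins : ℕ → Bool} {q : Params} {s : RAMState}
    (hE : Env q s) {σ : ℕ → ℕ → ℕ}
    (hσ : ∀ i < q.m, ∀ k < q.D * q.G, s.mem (q.m + i * (q.D * q.G) + k) = σ i k)
    (hlt : ∀ i < q.m, ∀ k < q.D * q.G, σ i k < q.n)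
    (hcoin : ∀ p, coinValue coins p q.B < q.D * q.G)
    (hlev : s.reg 20 + q.N ≤ s.reg 21)
    (hz : ∀ x < q.N, s.xmem (s.reg 21 + x) = 0) :
    playRound.Runs table coins s (roundTime q) fun s' =>
      (∀ r, r < 20 ∨ r = 21 ∨ r = 22 ∨ 50 ≤ r → s'.reg r = s.reg r) ∧
      (∀ r, r < 10 → s'.xreg r = s.xreg r) ∧ s'.reg 20 = s.reg 20 + q.N ∧
      s'.pos = s.pos + q.K * (q.m * q.B) ∧ (∀ a, q.m ≤ a → s'.mem a = s.mem a) ∧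
      (∀ x < q.N, s'.xmem (s.reg 21 + x) = estimate table q.m q.n q.K σ
        (fun k i => coinValue coins (s.pos + k * (q.m * q.B) + i * q.B) q.B) x) ∧
      (∀ i < q.m, ∀ j < q.n, s'.xmem (s.reg 20 + (i * q.n + j)) =
        s.xmem (s.reg 20 + (i * q.n + j)) +
          (((Finset.range (q.D * q.G)).filter fun k => σ i k = j).card : ℝ)
            * (1 / (q.D * q.G : ℕ))) ∧
      ∀ a, (a < s.reg 20 ∨ s.reg 20 + q.N ≤ a) → (a < s.reg 21 ∨ s.reg 21 + q.N ≤ a) →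
        s'.xmem a = s.xmem a := by
  have hNrow : ∀ i < q.m, ∀ j < q.n, i * q.n + j < q.N := by
    intro i hi j hj
    rw [Params.N]
    nlinarith
  refine (emit_runs hE).seq ?_
  rintro s₁ ⟨e1, e2, e3, e4⟩
  have hE1 := hE.keeps e1
  have hfar : ∀ a, (a < s.reg 20 ∨ s.reg 20 + q.N ≤ a) → s₁.xmem a = s.xmem a := by
    intro a ha
    rw [e4, Finset.sum_eq_zero, add_zero]
    intro i hi
    have hi := Finset.mem_range.1 hi
    rw [Finset.filter_false_of_mem]
    · simp
    · intro k hk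
      have hk := Finset.mem_range.1 hk
      rw [hσ i hi k hk]
      have := hNrow i hi _ (hlt i hi k hk)
      omega
  have hnear : ∀ i < q.m, ∀ j < q.n, s₁.xmem (s.reg 20 + (i * q.n + j)) =
        s.xmem (s.reg 20 + (i * q.n + j)) +
          (((Finset.range (q.D * q.G)).filter fun k => σ i k = j).card : ℝ)
            * (1 / (q.D * q.G : ℕ)) := by
    intro i hi j hj
    rw [e4, Finset.sum_eq_single_of_mem i (Finset.mem_range.2 hi)]
    · congr 4
      apply Finset.filter_congr
      intro k hk
      rw [hσ i hi k (Finset.mem_range.1 hk)]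
      omega
    · intro i' hi' hne
      have hi' := Finset.mem_range.1 hi'
      rw [Finset.filter_false_of_mem]
      · simp
      · intro k hk heq
        have hk := Finset.mem_range.1 hk
        rw [hσ i' hi' k hk] at heq
        -- Division by `n` recovers the player from the address, so other players do not touch this
        -- entry.
        have h1 : q.n * i' + σ i' k = q.n * i + j := by
          rw [mul_comm q.n, mul_comm q.n]; omega
        have h2 := hlt i' hi' k hk
        apply hne
        have h3 := congrArg (· / q.n) h1
        simpa [Nat.mul_add_div (show 0 < q.n by omega), Nat.div_eq_of_lt h2,
          Nat.div_eq_of_lt hj] using h3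
  refine (RAMProg.runs_block_seq (RAMProg.runs_for (fun b s' =>
      (∀ r, r < 20 ∨ r = 21 ∨ r = 22 ∨ 50 ≤ r → s'.reg r = s.reg r) ∧
      (∀ r, r < 10 → s'.xreg r = s.xreg r) ∧ s'.reg 20 = s.reg 20 + q.N ∧ s'.reg 23 = b + 1 ∧
      s'.pos = s.pos + b * (q.m * q.B) ∧ (∀ a, q.m ≤ a → s'.mem a = s.mem a) ∧
      (∀ x < q.N, s'.xmem (s.reg 21 + x) = ∑ k ∈ Finset.range b,
        table (deviationAddr q.m q.n (fun i => σ i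
          (coinValue coins (s.pos + k * (q.m * q.B) + i * q.B) q.B)) (x / q.n) (x % q.n))
            * (1 / q.K)) ∧
      ∀ a, (a < s.reg 21 ∨ s.reg 21 + q.N ≤ a) → s'.xmem a = s₁.xmem a)
      (N := q.K) (tb := q.m * (5 * q.B + 15 * q.n + 28) + 13)
      (fun k _ s' h => h.2.2.2.1) (fun k _ s' h => (hE.of_eq (fun r hr => h.1 r (by omega))
        h.2.1).reg8) ?_ ?_)).mono ?_ ?_
  · rintro b hb s₂ ⟨h1, h2, h3, h4, h5, h6, h7, h8⟩
    have hE2 : Env q s₂ := hE.of_eq (fun r hr => h1 r (by omega)) h2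
    have hact : ∀ i < q.m, s₂.mem (q.m + i * (q.D * q.G)
        + coinValue coins (s₂.pos + i * q.B) q.B)
        = σ i (coinValue coins (s.pos + b * (q.m * q.B) + i * q.B) q.B) := by
      intro i hi
      rw [h6 _ (by rw [add_assoc]; exact Nat.le_add_right _ _), h5, hσ i hi _ (hcoin _)]
    set act : ℕ → ℕ := fun i => σ i (coinValue coins (s.pos + b * (q.m * q.B) + i * q.B) q.B)
      with hactdef
    refine ((sampleProfile_runs hE2 fun i hi => ?_).seq
      (t' := q.m * (9 * q.n + 10) + 6 + 1) ?_).mono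
      (by
        have := Nat.mul_add q.m (5 * q.B + 6 * q.n + 18) (9 * q.n + 10)
        rw [show 5 * q.B + 6 * q.n + 18 + (9 * q.n + 10) = 5 * q.B + 15 * q.n + 28 by omega] at this
        omega) fun _ h => h
    · rw [hact i hi]
      exact (hlt i hi _ (hcoin _)).le
    rintro s₃ ⟨k1, k2, k3, k4, k5, k6, k7⟩
    have hE3 := hE2.keeps k1
    have hprof : s₃.reg 46 = ∑ i ∈ Finset.range q.m, q.n ^ i * act i := by
      rw [k7]
      exact Finset.sum_congr rfl fun i hi => by rw [hact i (Finset.mem_range.1 hi)]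
    refine (readUtilities_runs hE3 (b := fun i => q.n ^ i * act i) (fun i hi => ?_) k6).seq ?_
    · rw [k4 i hi, hact i hi]
    rintro s₄ ⟨l1, l2, l3, l4, l5⟩
    have hE4 := hE3.keeps l1
    have h21 : s₃.reg 21 = s.reg 21 := by rw [k1.1 21 (by omega), h1 21 (by omega)]
    have hreg : ∀ r, r < 30 ∨ 50 ≤ r → s₄.reg r = s₂.reg r := fun r hr =>
      (l1.1 r hr).trans (k1.1 r hr)
    refine RAMProg.runs_block ?_ le_rfl
    refine ⟨fun r hr => ?_, fun r hr => ?_, ?_, ?_, ?_, fun a ha => ?_, fun x hx => ?_,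
      fun a ha => ?_⟩
    · have := (hreg r (by omega)).trans (h1 r hr)
      simp (disch := omega) [runList, RAMInstr.run, Function.update_of_ne, this]
    · exact ((l1.2 r hr).trans (k1.2 r hr)).trans (h2 r hr)
    · simp [runList, RAMInstr.run, hreg, h3]
    · simp [runList, RAMInstr.run, hreg, h4, hE2.reg2]
    · change s₄.pos = _
      rw [l3, k3, h5]; ring
    · change s₄.mem a = _
      rw [l2, k5 a ha, h6 a ha]
    · change s₄.xmem _ = _
      have hn : 0 < q.n := Nat.pos_of_ne_zero fun h => by simp [Params.N, h] at hx
      have hxd : x / q.n < q.m := by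
        rw [Nat.div_lt_iff_lt_mul hn]; exact hx
      have hxe : x / q.n * q.n + x % q.n = x := Nat.div_add_mod' x q.n
      have := l4 (x / q.n) hxd (x % q.n) (Nat.mod_lt _ hn)
      rw [hxe, h21, k2, h7 x hx, hprof] at this
      rw [this, Finset.sum_range_succ]
      rfl
    · change s₄.xmem a = _
      rw [l5 a (by rw [h21]; exact ha), k2, h8 a ha]
  · refine ⟨fun r hr => ?_, e1.2, ?_, ?_, ?_, fun a ha => ?_, fun x hx => ?_, fun a ha => rfl⟩
    · simp (disch := omega) [runList, RAMInstr.run, Function.update_of_ne, e1.1 r (by omega)]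
    · simp [runList, RAMInstr.run, e1.1, hE.reg3]
    · simp [runList, RAMInstr.run]
    · simp [runList, RAMInstr.run, e3]
    · simp [runList, RAMInstr.run, e2]
    · simp [runList, RAMInstr.run, hfar (s.reg 21 + x) (by omega), hz x hx]
  · show 2 + (q.K * (q.m * (5 * q.B + 15 * q.n + 28) + 14) + 1) ≤ _
    exact le_rfl
  · rintro s' ⟨h1, h2, h3, h4, h5, h6, h7, h8⟩
    refine ⟨h1, h2, h3, h5, h6, fun x hx => ?_, fun i hi j hj => ?_, fun a ha ha' => ?_⟩
    · rw [h7 x hx, estimate]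
    · have := hNrow i hi j hj
      rw [h8 _ (by omega), hnear i hi j hj]
    · rw [h8 a ha', hfar a ha]

/-! ### Recursion over the tree -/

/-- The strategy of player `i` in round `t`, when `r` are the estimated rewards. -/
noncomputable def playerStrategy (q : Params) (r : ℕ → ℕ → ℝ) (t i idx : ℕ) : ℕ :=
  treeStrategy q.M (1 / q.D) q.n q.G (fun t j => r t (i * q.n + j)) t idx

/-- The index that the coins select for player `i` in the `k`-th sample of round `t`. -/
def sampleIndex (q : Params) (coins : ℕ → Bool) (t k i : ℕ) : ℕ :=
  coinValue coins (t * (q.K * (q.m * q.B)) + k * (q.m * q.B) + i * q.B) q.B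

/-- The program for a subtree of height `h`. -/
def treeProg : ℕ → RAMProg
  | 0 => playRound
  | h + 1 => .seq (.block [.sub 21 21 11, .sub 22 22 4]) (.seq initWeights
      (.seq (.block [.const (50 + h) 1])
        (.seq (.loop (.le (50 + h) 7) (.seq fillTable (.seq (treeProg h)
            (.seq closeBlock (.block [.add (50 + h) (50 + h) 2])))))
          (.block [.add 21 21 11, .add 22 22 4]))))

/-- A bound for the time of `treeProg`. -/
def treeTime (q : Params) : ℕ → ℕ
  | 0 => roundTime q
  | h + 1 => q.M * (q.m * (13 * q.n + 4 * q.G + 13) + 4 + (treeTime q h + (16 * q.N + 3 + 1)) + 1)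
      + 4 * q.N + 9

/-- What holds before round `t`, outside the subtrees of height `h`. -/
structure TreeInv (q : Params) (r : ℕ → ℕ → ℝ) (t h : ℕ) (s : RAMState) : Prop where
  env : Env q s
  reg20 : s.reg 20 = t * q.N
  reg21 : s.reg 21 = q.base + h * (2 * q.N)
  reg22 : s.reg 22 = h * q.G
  pos : s.pos = t * (q.K * (q.m * q.B))
  out : ∀ t' < t, ∀ i < q.m, ∀ j < q.n, s.xmem (t' * q.N + (i * q.n + j)) =
    (((Finset.range (q.D * q.G)).filter fun k => playerStrategy q r t' i k = j).card : ℝ)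
      * (1 / (q.D * q.G : ℕ))
  blank : ∀ a, t * q.N ≤ a → a < q.base → s.xmem a = 0
  acc : ∀ h' < h, ∀ x < q.N, s.xmem (q.base + h' * (2 * q.N) + x) = 0

/-- The tables of the levels from `h` on are those for the `c`-th block of level `h`. -/
def Tables (q : Params) (r : ℕ → ℕ → ℝ) (h c : ℕ) (s : RAMState) : Prop :=
  ∀ h', h ≤ h' → h' < q.D → ∀ i < q.m, ∀ k < q.G,
    s.mem (q.m + i * (q.D * q.G) + h' * q.G + k) =
      levelTable q.M (1 / q.D) q.n q.G (fun t j => r t (i * q.n + j)) h' (c / q.M ^ (h' - h)) k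

/-- The level can be read off from the address: divide by `G` and reduce modulo `D`. -/
theorem cell_ne {D G i h k i' h' k' : ℕ} (hk : k < G) (hk' : k' < G) (hh : h < D) (hh' : h' < D)
    (hne : h ≠ h') : i * (D * G) + h * G + k ≠ i' * (D * G) + h' * G + k' := by
  intro he
  have h1 : ∀ i h k, k < G → h < D → (i * (D * G) + h * G + k) / G % D = h := by
    intro i h k hk hh
    rw [show i * (D * G) + h * G + k = k + (i * D + h) * G by ring,
      Nat.add_mul_div_right _ _ (by omega), Nat.div_eq_of_lt hk, zero_add, add_comm,
      Nat.add_mul_mod_self_right, Nat.mod_eq_of_lt hh]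
  apply hne
  rw [← h1 i h k hk hh, he, h1 i' h' k' hk' hh']

section

variable {table : ℕ → ℝ} {coins : ℕ → Bool} {q : Params} {r : ℕ → ℕ → ℝ}

/-- At a leaf the tables of all levels are current, and together they are the strategy of round `t`.
The equation `hfix` identifies the computed estimates with the rewards on which those tables rest.
-/
theorem treeProg_zero_runs (hn : 0 < q.n) (hM : 0 < q.M) (hD : 0 < q.D)
    (hr : ∀ t, ∀ x < q.N, 0 ≤ r t x ∧ r t x ≤ 1)
    (hfix : ∀ t, ∀ x < q.N, r t x = estimate table q.m q.n q.K (playerStrategy q r t)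
      (sampleIndex q coins t) x)
    (hcoin : ∀ p, coinValue coins p q.B < q.D * q.G) {t : ℕ} (ht : t + 1 ≤ q.M ^ q.D)
    {s : RAMState} (hI : TreeInv q r t 0 s) (hA : ∀ x < q.N, s.xmem (q.base + x) = 0)
    (hT : Tables q r 0 t s) :
    playRound.Runs table coins s (roundTime q) fun s' => TreeInv q r (t + 1) 0 s' ∧
      (∀ x < q.N, s'.xmem (q.base + x) = r t x) ∧ Tables q r 0 t s' ∧
      (∀ k, 50 ≤ k → s'.reg k = s.reg k) ∧ ∀ a, q.base + q.N ≤ a → s'.xmem a = s.xmem a := by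
  have hbase : (t + 1) * q.N ≤ q.base := Nat.mul_le_mul_right _ ht
  rw [Nat.succ_mul] at hbase
  have hrow : ∀ i < q.m, ∀ j < q.n, i * q.n + j < q.N := by
    intro i hi j hj
    rw [Params.N]
    nlinarith
  have h20 := hI.reg20
  have h21 := hI.reg21
  rw [zero_mul, add_zero] at h21
  refine (playRound_runs hI.env (σ := playerStrategy q r t) ?_ ?_ hcoin ?_ ?_).mono le_rfl ?_
  · intro i hi k hk
    have hG : 0 < q.G := Nat.pos_of_ne_zero fun h => by simp [h] at hk
    have h1 : k / q.G < q.D := by rwa [Nat.div_lt_iff_lt_mul hG]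
    have := hT (k / q.G) (Nat.zero_le _) h1 i hi (k % q.G) (Nat.mod_lt _ hG)
    rw [add_assoc _ (k / q.G * q.G), Nat.div_add_mod', Nat.sub_zero] at this
    rw [this]
    rfl
  · intro i hi k hk
    exact treeStrategy_lt hD hM hn (fun t j hj => hr t _ (hrow i hi j hj)) t hk
  · rw [h20, h21]
    exact hbase
  · rw [h21]
    exact hA
  rintro s' ⟨g1, g2, g3, g4, g5, g6, g7, g8⟩
  rw [h21] at g6 g8
  rw [h20] at g7 g8
  refine ⟨⟨hI.env.of_eq (fun k hk => g1 k (by omega)) g2, by rw [g3, h20]; ring,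
    by rw [g1 21 (by omega), h21]; ring, by rw [g1 22 (by omega), hI.reg22],
    by rw [g4, hI.pos]; ring, fun t' ht' i hi j hj => ?_, fun a ha ha' => ?_, by omega⟩,
    fun x hx => ?_, fun h' _ hh i hi k hk => ?_, fun k hk => g1 k (by omega), fun a ha => ?_⟩
  · have hlt := hrow i hi j hj
    rcases Nat.lt_succ_iff_lt_or_eq.1 ht' with ht' | rfl
    · have h1 : (t' + 1) * q.N ≤ t * q.N := Nat.mul_le_mul_right _ ht'
      rw [Nat.succ_mul] at h1
      rw [g8 _ (by omega) (by omega), hI.out t' ht' i hi j hj]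
    · rw [g7 i hi j hj, hI.blank _ (by omega) (by omega), zero_add]
  · rw [Nat.succ_mul] at ha
    rw [g8 _ (by omega) (by omega), hI.blank _ (by omega) ha']
  · rw [g6 x hx, hfix t x hx, hI.pos]
    rfl
  · rw [g5 _ (by rw [add_assoc, add_assoc]; exact Nat.le_add_right _ _)]
    exact hT h' (Nat.zero_le _) hh i hi k hk
  · exact g8 a (by omega) (by omega)

/-- Invariant of the loop of `treeProg (h + 1)`, after `b` blocks. -/
structure LevelInv (q : Params) (r : ℕ → ℕ → ℝ) (c h : ℕ) (s₀ : RAMState) (b : ℕ) (s : RAMState) :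
    Prop where
  inv : TreeInv q r ((c * q.M + b) * q.M ^ h) h s
  acc : ∀ x < q.N, s.xmem (q.base + h * (2 * q.N) + x) = 0
  weight : ∀ x < q.N, s.xmem (q.base + h * (2 * q.N) + q.N + x) =
    ∏ i ∈ Finset.range b, (1 + 1 / q.D * blockAvg q.M (fun t => r t x) h (c * q.M + i))
  accUp : ∀ x < q.N, s.xmem (q.base + h * (2 * q.N) + 2 * q.N + x) =
    ∑ i ∈ Finset.range b, blockAvg q.M (fun t => r t x) h (c * q.M + i) * (1 / q.M)
  tables : Tables q r (h + 1) c s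
  count : s.reg (50 + h) = b + 1
  regs : ∀ k, 50 + (h + 1) ≤ k → s.reg k = s₀.reg k
  far : ∀ a, q.base + h * (2 * q.N) + 3 * q.N ≤ a → s.xmem a = s₀.xmem a

/-- The invariant of height `h` reads only the real memory below the accumulators of level `h`. -/
theorem TreeInv.of_keeps {t h : ℕ} {s s' : RAMState} (hI : TreeInv q r t h s) (hk : Keeps s s')
    (hx : ∀ a, a < q.base + h * (2 * q.N) → s'.xmem a = s.xmem a)
    (hp : s'.pos = s.pos) (ht : t ≤ q.M ^ q.D) : TreeInv q r t h s' where
  env := hI.env.keeps hk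
  reg20 := (hk.1 20 (by omega)).trans hI.reg20
  reg21 := (hk.1 21 (by omega)).trans hI.reg21
  reg22 := (hk.1 22 (by omega)).trans hI.reg22
  pos := hp.trans hI.pos
  out := by
    intro t' ht' i hi j hj
    have h1 : (t' + 1) * q.N ≤ q.base := Nat.mul_le_mul_right _ (by omega)
    rw [Nat.succ_mul] at h1
    have h2 : i * q.n + j < q.N := by
      rw [Params.N]
      nlinarith
    rw [hx _ (by omega), hI.out t' ht' i hi j hj]
  blank a ha ha' := by rw [hx _ (by omega), hI.blank a ha ha']
  acc := by
    intro h' hh x hxN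
    have : (h' + 1) * (2 * q.N) ≤ h * (2 * q.N) := Nat.mul_le_mul_right _ hh
    rw [Nat.succ_mul] at this
    rw [hx _ (by omega), hI.acc h' hh x hxN]

/-- A subtree deposits its block average in its own accumulators, which must be zero at the start,
and leaves the tables and counters of higher levels intact. The sequence `r` is fixed in advance and
constrained only by `hfix`, so the induction need not track which rewards are already known. -/
theorem treeProg_runs (hn : 0 < q.n) (hM : 0 < q.M) (hD : 0 < q.D)
    (hr : ∀ t, ∀ x < q.N, 0 ≤ r t x ∧ r t x ≤ 1)
    (hfix : ∀ t, ∀ x < q.N, r t x = estimate table q.m q.n q.K (playerStrategy q r t)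
      (sampleIndex q coins t) x)
    (hcoin : ∀ p, coinValue coins p q.B < q.D * q.G) (h c : ℕ) (hh : h ≤ q.D)
    (hc : (c + 1) * q.M ^ h ≤ q.M ^ q.D)
    {s : RAMState} (hI : TreeInv q r (c * q.M ^ h) h s)
    (hA : ∀ x < q.N, s.xmem (q.base + h * (2 * q.N) + x) = 0) (hT : Tables q r h c s) :
    (treeProg h).Runs table coins s (treeTime q h) fun s' =>
      TreeInv q r ((c + 1) * q.M ^ h) h s' ∧
      (∀ x < q.N, s'.xmem (q.base + h * (2 * q.N) + x) = blockAvg q.M (fun t => r t x) h c) ∧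
      Tables q r h c s' ∧ (∀ k, 50 + h ≤ k → s'.reg k = s.reg k) ∧
      ∀ a, q.base + h * (2 * q.N) + q.N ≤ a → s'.xmem a = s.xmem a := by
  induction h generalizing c s with
  | zero =>
    simp only [pow_zero, mul_one, zero_mul, add_zero] at hc hI hA ⊢
    exact treeProg_zero_runs hn hM hD hr hfix hcoin hc hI hA hT
  | succ h ih =>
    have hrow : ∀ i < q.m, ∀ j < q.n, i * q.n + j < q.N := by
      intro i hi j hj
      rw [Params.N]
      nlinarith
    have hup : q.base + (h + 1) * (2 * q.N) = q.base + h * (2 * q.N) + 2 * q.N := by ring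
    have hbc : ∀ b ≤ q.M, (c * q.M + b) * q.M ^ h ≤ q.M ^ q.D := by
      intro b hb
      refine le_trans ?_ hc
      rw [pow_succ', ← mul_assoc]
      apply Nat.mul_le_mul_right
      rw [Nat.succ_mul]
      omega
    have hE := hI.env
    -- enter the level
    refine (RAMProg.runs_block_seq ((RAMProg.Runs.seq (initWeights_runs (s := runList table coins s
      [.sub 21 21 11, .sub 22 22 4]) (hE.of_eq ?_ ?_)) (t' := q.M * (q.m * (13 * q.n + 4 * q.G + 13)
        + 4 + (treeTime q h + (16 * q.N + 3 + 1)) + 1) + 4) ?_).mono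
      (t' := treeTime q (h + 1) - 2) (by simp only [treeTime]; omega) fun _ h => h)).mono
      (by simp [treeTime]; omega) fun _ h => h
    · intro k hk
      simp (disch := omega) [runList, RAMInstr.run, Function.update_of_ne]
    · intro k hk
      rfl
    rintro s₁ ⟨k1, m1, p1, x1⟩
    have r21 : s₁.reg 21 = q.base + h * (2 * q.N) := by
      rw [k1.1 21 (by omega)]
      simp [runList, RAMInstr.run, hI.reg21, hE.reg11, hup]
    have r22 : s₁.reg 22 = h * q.G := by
      rw [k1.1 22 (by omega)]
      simp [runList, RAMInstr.run, hI.reg22, hE.reg4, Nat.succ_mul]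
    have r21' : (runList table coins s [.sub 21 21 11, .sub 22 22 4]).reg 21
        = q.base + h * (2 * q.N) := by
      simp [runList, RAMInstr.run, hI.reg21, hE.reg11, hup]
    have rr : ∀ k, k < 21 ∨ 23 ≤ k ∧ k < 30 ∨ 50 ≤ k → s₁.reg k = s.reg k := by
      intro k hk
      rw [k1.1 k (by omega)]
      simp (disch := omega) [runList, RAMInstr.run, Function.update_of_ne]
    have x1' : ∀ a, s₁.xmem a = if q.base + h * (2 * q.N) + q.N ≤ a
        ∧ a < q.base + h * (2 * q.N) + 2 * q.N then 1 else s.xmem a := by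
      intro a
      rw [x1 a, r21']
      rfl
    have m1' : s₁.mem = s.mem := m1
    have p1' : s₁.pos = s.pos := p1
    have hE1 : Env q s₁ := hE.of_eq (fun k hk => rr k (by omega)) k1.2
    -- the loop over the blocks
    refine (RAMProg.runs_block_seq (RAMProg.Runs.seq (RAMProg.runs_for (LevelInv q r c h s)
      (N := q.M) (tb := q.m * (13 * q.n + 4 * q.G + 13) + 4
        + (treeTime q h + (16 * q.N + 3 + 1)))
      (fun k _ s' h => h.count) (fun k _ s' h => h.inv.env.reg7) ?_ ?_) (t' := 2) ?_)).mono ?_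
      fun _ h => h
    · intro b hb s₂ hL
      have hE2 := hL.inv.env
      have hblk : (c * q.M + b) / q.M = c := by
        rw [add_comm, Nat.add_mul_div_right _ _ hM, Nat.div_eq_of_lt hb, zero_add]
      have hblk' : (c * q.M + b) % q.M = b := by
        rw [add_comm, Nat.add_mul_mod_self_right, Nat.mod_eq_of_lt hb]
      have hwt : ∀ x < q.N, s₂.xmem (s₂.reg 21 + q.N + x)
          = treeWeight q.M (1 / q.D) (fun t => r t x) h (c * q.M + b) := by
        intro x hx
        rw [hL.inv.reg21, hL.weight x hx]
        simp only [treeWeight, hblk, hblk']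
      refine (fillTable_runs hE2 hn hD fun x hx => ?_).seq ?_
      · rw [hwt x hx]
        exact treeWeight_pos (by positivity) hM (fun t => hr t x hx) _ _
      rintro s₃ ⟨k3, x3, p3, f3, g3⟩
      rw [hL.inv.reg22] at f3 g3
      have hI3 := hL.inv.of_keeps k3 (fun a _ => by rw [x3]) p3 (hbc b hb.le)
      have hT3 : Tables q r h (c * q.M + b) s₃ := by
        intro h' hh' hhD i hi k hk
        rcases Nat.eq_or_lt_of_le hh' with rfl | hlt
        · rw [f3 i hi k hk, Nat.sub_self, pow_zero, Nat.div_one, levelTable]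
          have hw : ∀ j < q.n, s₂.xmem (s₂.reg 21 + q.N + (i * q.n + j))
              = treeWeight q.M (1 / q.D) (fun t => r t (i * q.n + j)) h (c * q.M + b) :=
            fun j hj => hwt _ (hrow i hi j hj)
          -- Rounding depends on the weights through their first `n` partial sums only.
          have hcc : ∀ j ≤ q.n, ∑ a ∈ Finset.range j, s₂.xmem (s₂.reg 21 + q.N + (i * q.n + a))
              = ∑ a ∈ Finset.range j,
                treeWeight q.M (1 / q.D) (fun t => r t (i * q.n + a)) h (c * q.M + b) :=
            fun j hj => Finset.sum_congr rfl fun a ha =>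
              hw a ((Finset.mem_range.1 ha).trans_le hj)
          rw [roundTable, roundTable]
          congr 1
          apply Finset.filter_congr
          intro j hj
          rw [cellCount, cellCount, hcc (j + 1) (Finset.mem_range.1 hj), hcc q.n le_rfl]
        · rw [g3 _ fun i' _ k' hk' => ?_, hL.tables h' hlt hhD i hi k hk]
          -- A child block lies in the same blocks of higher levels as its parent.
          · rw [show h' - h = (h' - (h + 1)) + 1 by omega, pow_succ', ← Nat.div_div_eq_div_mul,
              hblk]
          · have := cell_ne (i := i) (i' := i') hk hk' hhD (by omega) (show h' ≠ h by omega)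
            omega
      refine (ih (c * q.M + b) (by omega) (hbc (b + 1) hb) hI3 (fun x hx => ?_) hT3).seq ?_
      · rw [x3]
        exact hL.acc x hx
      rintro s₄ ⟨i4, a4, t4, r4, x4⟩
      refine (closeBlock_runs i4.env).seq ?_
      rintro s₅ ⟨k5, m5, p5, x5, y5⟩
      rw [i4.reg21] at x5 y5
      refine RAMProg.runs_block ?_ le_rfl
      have hI5 := i4.of_keeps k5 (fun a ha => y5 a (Or.inl ha)) p5 (hbc (b + 1) hb)
      set s₆ := runList table coins s₅ [.add (50 + h) (50 + h) 2] with hs₆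
      have r6 : ∀ k, k < 50 ∨ 50 + h < k → s₆.reg k = s₅.reg k := by
        intro k hk
        simp (disch := omega) [hs₆, runList, RAMInstr.run, Function.update_of_ne]
      refine ⟨⟨hI5.env.of_eq (fun k hk => r6 k (by omega)) fun _ _ => rfl,
          (r6 20 (by omega)).trans hI5.reg20, (r6 21 (by omega)).trans hI5.reg21,
          (r6 22 (by omega)).trans hI5.reg22, hI5.pos, hI5.out, hI5.blank, hI5.acc⟩,
        fun x hx => (x5 x hx).1, fun x hx => ?_, fun x hx => ?_, fun h' hh' hhD i hi k hk => ?_,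
        ?_, fun k hk => ?_, fun a ha => ?_⟩
      · change s₅.xmem _ = _
        rw [(x5 x hx).2.1, a4 x hx, x4 _ (by omega), x3, hL.weight x hx, Finset.prod_range_succ]
      · change s₅.xmem _ = _
        rw [(x5 x hx).2.2, a4 x hx, x4 _ (by omega), x3, hL.accUp x hx, Finset.sum_range_succ]
      · change s₅.mem _ = _
        rw [m5, t4 h' (by omega) hhD i hi k hk, show h' - h = (h' - (h + 1)) + 1 by omega,
          pow_succ', ← Nat.div_div_eq_div_mul, hblk]
      · simp [hs₆, runList, RAMInstr.run, hI5.env.reg2, k5.1, r4, k3.1, hL.count]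
      · rw [r6 k (by omega), k5.1 k (by omega), r4 k (by omega), k3.1 k (by omega),
          hL.regs k hk]
      · change s₅.xmem _ = _
        rw [y5 _ (by omega), x4 _ (by omega), x3, hL.far a ha]
    · set s₂ := runList table coins s₁ [.const (50 + h) 1] with hs₂
      have r2 : ∀ k, k ≠ 50 + h → s₂.reg k = s₁.reg k := by
        intro k hk
        simp (disch := omega) [hs₂, runList, RAMInstr.run, Function.update_of_ne]
      have ht0 : (c * q.M + 0) * q.M ^ h = c * q.M ^ (h + 1) := by ring
      have hNb : c * q.M ^ (h + 1) * q.N ≤ q.base := by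
        rw [Params.base, ← ht0]
        exact Nat.mul_le_mul_right _ (hbc 0 (Nat.zero_le _))
      constructor
      · rw [ht0]
        refine ⟨hE1.of_eq (fun k hk => r2 k (by omega)) fun _ _ => rfl, ?_, ?_, ?_,
          p1'.trans hI.pos, fun t' ht' i hi j hj => ?_, fun a ha ha' => ?_, fun h' hh' x hx => ?_⟩
        · rw [r2 20 (by omega), rr 20 (by omega), hI.reg20]
        · rw [r2 21 (by omega), r21]
        · rw [r2 22 (by omega), r22]
        · change s₁.xmem _ = _
          have h1 : (t' + 1) * q.N ≤ c * q.M ^ (h + 1) * q.N := Nat.mul_le_mul_right _ ht'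
          rw [Nat.succ_mul] at h1
          have := hrow i hi j hj
          rw [x1', if_neg (by omega), hI.out t' ht' i hi j hj]
        · change s₁.xmem _ = _
          rw [x1', if_neg (by omega), hI.blank a ha ha']
        · change s₁.xmem _ = _
          have h1 : (h' + 1) * (2 * q.N) ≤ h * (2 * q.N) := Nat.mul_le_mul_right _ hh'
          rw [Nat.succ_mul] at h1
          rw [x1', if_neg (by omega), hI.acc h' (by omega) x hx]
      · intro x hx
        change s₁.xmem _ = _
        rw [x1', if_neg (by omega), hI.acc h (by omega) x hx]
      · intro x hx
        change s₁.xmem _ = _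
        rw [x1', if_pos (by omega)]
        simp
      · intro x hx
        change s₁.xmem _ = _
        rw [x1', if_neg (by omega), ← hup, hA x hx]
        simp
      · intro h' hh' hhD i hi k hk
        change s₁.mem _ = _
        rw [m1', hT h' hh' hhD i hi k hk]
      · simp [hs₂, runList, RAMInstr.run]
      · intro k hk
        rw [r2 k (by omega), rr k (by omega)]
      · intro a ha
        change s₁.xmem _ = _
        rw [x1', if_neg (by omega)]
    · -- leave the level
      intro s₂ hL
      refine RAMProg.runs_block ?_ le_rfl
      have hE2 := hL.inv.env
      have ht0 : (c * q.M + q.M) * q.M ^ h = (c + 1) * q.M ^ (h + 1) := by ring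
      have hI2 := hL.inv
      rw [ht0] at hI2
      set s₃ := runList table coins s₂ [.add 21 21 11, .add 22 22 4] with hs₃
      have r3 : ∀ k, k < 21 ∨ 22 < k → s₃.reg k = s₂.reg k := by
        intro k hk
        simp (disch := omega) [hs₃, runList, RAMInstr.run, Function.update_of_ne]
      refine ⟨⟨hE2.of_eq (fun k hk => r3 k (by omega)) fun _ _ => rfl,
          (r3 20 (by omega)).trans hI2.reg20, ?_, ?_, hI2.pos, hI2.out, hI2.blank,
          fun h' hh' x hx => ?_⟩, fun x hx => ?_, hL.tables, fun k hk => ?_, fun a ha => ?_⟩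
      · simp [hs₃, runList, RAMInstr.run, hI2.reg21, hE2.reg11]
        ring
      · simp [hs₃, runList, RAMInstr.run, hI2.reg22, hE2.reg4]
        ring
      · rcases Nat.lt_succ_iff_lt_or_eq.1 hh' with hh' | rfl
        · exact hI2.acc h' hh' x hx
        · exact hL.acc x hx
      · change s₂.xmem _ = _
        rw [hup, hL.accUp x hx]
        rfl
      · rw [r3 k (by omega), hL.regs k hk]
      · exact hL.far a (by omega)
    · simp only [List.length]
      omega

end

/-! ### Choice of the sizes and their computation -/

/-- The sizes for `m` players, `n` actions and `2 ^ e` levels. -/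
def sizes (e m n : ℕ) : Params where
  m := m
  n := n
  D := 2 ^ e
  -- At least `D * n` cells, so rounding loses a fraction of at most 1/D; and `D * G` is a power of
  -- two, so `B` coins choose a cell exactly uniformly.
  G := 2 ^ e * 2 ^ Nat.clog 2 n
  -- With step size 1/D this makes the regret term D log n / M at most 1/D. The summand for `m`
  -- keeps the arity positive when `n = 1`.
  M := (2 ^ e) ^ 2 * (Nat.clog 2 m + Nat.clog 2 n)
  -- With accuracy 1/D the Chernoff exponent K/(4D²) is 2D²L², which outweighs the logarithm of the
  -- number of estimates.
  K := 8 * (2 ^ e) ^ 4 * (Nat.clog 2 m + Nat.clog 2 n) ^ 2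
  B := 2 * e + Nat.clog 2 n

/-- Double register `d` until the powers of two reach register `l`; count in register `33`. -/
def clogProg (d l : ℕ) : RAMProg :=
  .loop (.le 32 l) (.block [.add 31 31 31, .add d d d, .add 32 31 2, .add 33 33 2])

/-- Power of register `7` to register `34`, into register `9`. -/
def powProg : RAMProg :=
  .loop (.le 37 34) (.seq (mulProg 30 36 9 7) (.block [.add 9 36 10, .add 37 37 2]))

/-- Compute the constants. -/
def preamble (e : ℕ) : RAMProg :=
  .seq (.block [.const 2 1, .const 4 (2 ^ e), .const 31 1, .const 32 2, .const 33 0])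
  (.seq (mulProg 30 3 0 1)
  (.seq (clogProg 4 1)
  (.seq (.block [.const 34 (2 * e), .add 6 34 33, .const 31 1, .const 32 2])
  (.seq (clogProg 35 0)
  (.seq (.block [.const 34 ((2 ^ e) ^ 2)])
  (.seq (mulProg 30 7 34 33)
  (.seq (mulProg 30 35 33 33)
  (.seq (.block [.const 34 (8 * (2 ^ e) ^ 4)])
  (.seq (mulProg 30 8 34 35)
  (.seq (.block [.const 34 (2 ^ e)])
  (.seq (mulProg 30 5 4 34)
  (.seq (.block [.const 9 1, .const 37 1])
  (.seq powProg
  (.seq (mulProg 30 21 9 3)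
  (.seq (.block [.add 11 3 3])
  (.seq (mulProg 30 36 11 34)
  (.block [.add 21 21 36, .add 22 5 10, .cast 1 2, .cast 2 34, .xdiv 2 1 2, .cast 3 7,
    .xdiv 3 1 3, .cast 4 8, .xdiv 4 1 4, .cast 5 5, .xdiv 5 1 5, .cast 6 4])))))))))))))))))

/-- A bound for the time of `preamble`. -/
def preambleTime (q : Params) (l k : ℕ) : ℕ :=
  5 + (3 * q.n + 3 + (5 * k + 1 + (4 + (5 * l + 1 + (1 + (3 * (l + k) + 3 + (3 * (l + k) + 3 + (1 +
    (3 * ((l + k) * (l + k)) + 3 + (1 + (3 * q.D + 3 + (2 + (q.D * (3 * q.M + 6) + 1 +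
      (3 * q.N + 3 + (1 + (3 * q.D + 3 + 12))))))))))))))))

section

variable {table : ℕ → ℝ} {coins : ℕ → Bool}

theorem mulProg_runs_eq {c d a b va vb : ℕ} {s : RAMState} (h : s.reg 2 = 1) (ha : s.reg a = va)
    (hb : s.reg b = vb) (hne : c ≠ a ∧ c ≠ b ∧ d ≠ a ∧ d ≠ b ∧ c ≠ d ∧ c ≠ 2 ∧ d ≠ 2) :
    (mulProg c d a b).Runs table coins s (3 * vb + 3) fun s' => s' = { s with
      reg := Function.update (Function.update s.reg d (va * vb)) c (vb + 1) } := by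
  subst ha hb
  exact mulProg_runs h hne.1 hne.2.1 hne.2.2.1 hne.2.2.2.1 hne.2.2.2.2.1 hne.2.2.2.2.2.1
    hne.2.2.2.2.2.2

theorem clogProg_runs {d l v g w : ℕ} {s : RAMState} (h2 : s.reg 2 = 1) (h31 : s.reg 31 = 1)
    (h32 : s.reg 32 = 2) (h33 : s.reg 33 = v) (hd : s.reg d = g) (hl : s.reg l = w)
    (hne : l < 30 ∧ d ≠ l ∧ d ≠ 2 ∧ d ≠ 31 ∧ d ≠ 32 ∧ d ≠ 33) :
    (clogProg d l).Runs table coins s (5 * Nat.clog 2 w + 1) fun s' => s' = { s with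
      reg := Function.update (Function.update (Function.update (Function.update s.reg
        31 (2 ^ Nat.clog 2 w)) d (g * 2 ^ Nat.clog 2 w)) 32 (2 ^ Nat.clog 2 w + 1))
        33 (v + Nat.clog 2 w) } := by
  obtain ⟨n1, n2, n3, n4, n5, n6⟩ := hne
  refine (RAMProg.runs_loop (fun k s' => s' = { s with
      reg := Function.update (Function.update (Function.update (Function.update s.reg
        31 (2 ^ k)) d (g * 2 ^ k)) 32 (2 ^ k + 1)) 33 (v + k) }) (N := Nat.clog 2 w) (tb := 4)
        (Nat.zero_le _) ?_ ?_ ?_).mono (by omega) (fun _ h => h)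
  · rintro k hk s' rfl
    have e : Function.update (Function.update (Function.update (Function.update s.reg
        31 (2 ^ k)) d (g * 2 ^ k)) 32 (2 ^ k + 1)) 33 (v + k) l = w := by
      simp (disch := omega) [Function.update_of_ne, hl]
    simp only [RAMTest.Holds, e]
    -- Register `32` holds 2^k + 1, so the non-strict test of the machine expresses 2^k < w.
    rw [Nat.lt_clog_iff_pow_lt (by norm_num)]
    simp
  · rintro k hk s' rfl
    refine RAMProg.runs_block ?_ le_rfl
    simp only [runList, RAMInstr.run, List.foldl]
    congr 1
    ext r
    have n3' := n3.symm
    have n4' := n4.symm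
    have n5' := n5.symm
    have n6' := n6.symm
    by_cases hr1 : r = 33
    · subst hr1; simp [*]; ring
    by_cases hr2 : r = 32
    · subst hr2; simp [*]; ring
    by_cases hr3 : r = d
    · subst hr3; simp [*]; ring
    by_cases hr4 : r = 31
    · subst hr4; simp [*]; ring
    simp [hr1, hr2, hr3, hr4]
  · have : Function.update (Function.update (Function.update (Function.update s.reg
        31 (2 ^ 0)) d (g * 2 ^ 0)) 32 (2 ^ 0 + 1)) 33 (v + 0) = s.reg := by
      ext r
      simp only [Function.update_apply]
      split_ifs <;> simp_all
    rw [this]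

theorem powProg_runs {M D : ℕ} {s : RAMState} (h2 : s.reg 2 = 1) (h7 : s.reg 7 = M)
    (h34 : s.reg 34 = D) (h9 : s.reg 9 = 1) (h10 : s.reg 10 = 0) (h37 : s.reg 37 = 1) :
    powProg.Runs table coins s (D * (3 * M + 6) + 1) fun s' => ∃ ρ : ℕ → ℕ,
      s' = { s with reg := ρ } ∧ ρ 9 = M ^ D ∧
        ∀ r, r ≠ 9 → r ≠ 30 → r ≠ 36 → r ≠ 37 → ρ r = s.reg r := by
  refine (RAMProg.runs_for (fun k s' => ∃ ρ : ℕ → ℕ, s' = { s with reg := ρ } ∧ ρ 9 = M ^ k ∧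
    ρ 37 = k + 1 ∧ ∀ r, r ≠ 9 → r ≠ 30 → r ≠ 36 → r ≠ 37 → ρ r = s.reg r) (N := D)
    (tb := 3 * M + 5) ?_ ?_ ?_ ?_).mono le_rfl ?_
  · rintro k hk s' ⟨ρ, rfl, g1, g2, g3⟩
    exact g2
  · rintro k hk s' ⟨ρ, rfl, g1, g2, g3⟩
    exact (g3 34 (by omega) (by omega) (by omega) (by omega)).trans h34
  · rintro k hk s' ⟨ρ, rfl, g1, g2, g3⟩
    refine (mulProg_runs_eq (va := M ^ k) (vb := M) ?_ ?_ ?_ (by omega)).seq (t' := 2) ?_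
    · simp [g3, h2]
    · exact g1
    · simp [g3, h7]
    rintro s' rfl
    refine RAMProg.runs_block ⟨_, rfl, ?_, ?_, fun r h1 h2 h3 h4 => ?_⟩ le_rfl
    · simp [RAMInstr.run, g3, h10, pow_succ]
    · simp [RAMInstr.run, g2, g3, h2]
    · simp [RAMInstr.run, h1, h2, h3, h4, g3]
  · exact ⟨s.reg, rfl, by simp [h9], h37, fun _ _ _ _ _ => rfl⟩
  · rintro s' ⟨ρ, h1, h2, h3, h4⟩
    exact ⟨ρ, h1, h2, h4⟩

/-- Before round 0 nothing has been written, so the invariant holds for every `r`. Register `21`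
starts above the working areas of all `D` levels, at the accumulators of the root. -/
theorem preamble_runs (e m n : ℕ) (r : ℕ → ℕ → ℝ) :
    (preamble e).Runs table coins (RAMState.init m n)
      (preambleTime (sizes e m n) (Nat.clog 2 m) (Nat.clog 2 n)) fun s =>
        TreeInv (sizes e m n) r 0 (sizes e m n).D s ∧ s.xmem = fun _ => 0 := by
  unfold preamble preambleTime
  set l := Nat.clog 2 m with hl
  set k := Nat.clog 2 n with hk
  refine RAMProg.runs_block_seq ?_
  refine (mulProg_runs_eq (va := m) (vb := n) (by simp [runList, RAMInstr.run])
    (by simp [runList, RAMInstr.run, RAMState.init])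
    (by simp [runList, RAMInstr.run, RAMState.init]) (by omega)).seq ?_
  rintro _ rfl
  refine (clogProg_runs (v := 0) (g := 2 ^ e) (w := n) (by simp [runList, RAMInstr.run])
    (by simp [runList, RAMInstr.run]) (by simp [runList, RAMInstr.run])
    (by simp [runList, RAMInstr.run]) (by simp [runList, RAMInstr.run])
    (by simp [runList, RAMInstr.run, RAMState.init]) (by omega)).seq ?_
  rintro _ rfl
  refine RAMProg.runs_block_seq ?_
  refine (clogProg_runs (v := k) (g := 0) (w := m) (by simp [runList, RAMInstr.run])
    (by simp [runList, RAMInstr.run]) (by simp [runList, RAMInstr.run])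
    (by simp [runList, RAMInstr.run, hk]) (by simp [runList, RAMInstr.run, RAMState.init])
    (by simp [runList, RAMInstr.run, RAMState.init]) (by omega)).seq ?_
  rintro _ rfl
  refine RAMProg.runs_block_seq ?_
  refine (mulProg_runs_eq (va := (2 ^ e) ^ 2) (vb := l + k) (by simp [runList, RAMInstr.run])
    (by simp [runList, RAMInstr.run])
    (by simp [runList, RAMInstr.run, hl, hk, add_comm]) (by omega)).seq ?_
  rintro _ rfl
  refine (mulProg_runs_eq (va := l + k) (vb := l + k) (by simp [runList, RAMInstr.run])
    (by simp [runList, RAMInstr.run, hl, hk, add_comm])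
    (by simp [runList, RAMInstr.run, hl, hk, add_comm]) (by omega)).seq ?_
  rintro _ rfl
  refine RAMProg.runs_block_seq ?_
  refine (mulProg_runs_eq (va := 8 * (2 ^ e) ^ 4) (vb := (l + k) * (l + k))
    (by simp [runList, RAMInstr.run]) (by simp [runList, RAMInstr.run])
    (by simp [runList, RAMInstr.run]) (by omega)).seq ?_
  rintro _ rfl
  refine RAMProg.runs_block_seq ?_
  refine (mulProg_runs_eq (va := 2 ^ e * 2 ^ k) (vb := 2 ^ e)
    (by simp [runList, RAMInstr.run]) (by simp [runList, RAMInstr.run, hk])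
    (by simp [runList, RAMInstr.run]) (by omega)).seq ?_
  rintro _ rfl
  refine RAMProg.runs_block_seq ?_
  refine (powProg_runs (M := (2 ^ e) ^ 2 * (l + k)) (D := 2 ^ e) (by simp [runList, RAMInstr.run])
    (by simp [runList, RAMInstr.run]) (by simp [runList, RAMInstr.run])
    (by simp [runList, RAMInstr.run]) (by simp [runList, RAMInstr.run, RAMState.init])
    (by simp [runList, RAMInstr.run])).seq ?_
  rintro _ ⟨ρ, rfl, hρ9, hρ⟩
  have h0 : ρ 0 = m := by
    rw [hρ 0 (by omega) (by omega) (by omega) (by omega)]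
    simp [runList, RAMInstr.run, RAMState.init]
  have h1 : ρ 1 = n := by
    rw [hρ 1 (by omega) (by omega) (by omega) (by omega)]
    simp [runList, RAMInstr.run, RAMState.init]
  have h2 : ρ 2 = 1 := by
    rw [hρ 2 (by omega) (by omega) (by omega) (by omega)]
    simp [runList, RAMInstr.run]
  have h3 : ρ 3 = m * n := by
    rw [hρ 3 (by omega) (by omega) (by omega) (by omega)]
    simp [runList, RAMInstr.run]
  have h4 : ρ 4 = 2 ^ e * 2 ^ k := by
    rw [hρ 4 (by omega) (by omega) (by omega) (by omega)]
    simp [runList, RAMInstr.run, hk]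
  have h5 : ρ 5 = 2 ^ e * (2 ^ e * 2 ^ k) := by
    rw [hρ 5 (by omega) (by omega) (by omega) (by omega)]
    simp [runList, RAMInstr.run]
    ring
  have h6 : ρ 6 = 2 * e + k := by
    rw [hρ 6 (by omega) (by omega) (by omega) (by omega)]
    simp [runList, RAMInstr.run, hk]
  have h7 : ρ 7 = (2 ^ e) ^ 2 * (l + k) := by
    rw [hρ 7 (by omega) (by omega) (by omega) (by omega)]
    simp [runList, RAMInstr.run]
  have h8 : ρ 8 = 8 * (2 ^ e) ^ 4 * (l + k) ^ 2 := by
    rw [hρ 8 (by omega) (by omega) (by omega) (by omega)]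
    simp [runList, RAMInstr.run]
    ring
  have h10 : ρ 10 = 0 := by
    rw [hρ 10 (by omega) (by omega) (by omega) (by omega)]
    simp [runList, RAMInstr.run, RAMState.init]
  have h20 : ρ 20 = 0 := by
    rw [hρ 20 (by omega) (by omega) (by omega) (by omega)]
    simp [runList, RAMInstr.run, RAMState.init]
  have h34 : ρ 34 = 2 ^ e := by
    rw [hρ 34 (by omega) (by omega) (by omega) (by omega)]
    simp [runList, RAMInstr.run]
  clear hρ
  simp only [runList, RAMInstr.run, List.foldl]
  refine (mulProg_runs_eq (va := ((2 ^ e) ^ 2 * (l + k)) ^ 2 ^ e) (vb := m * n) h2 hρ9 h3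
    (by omega)).seq ?_
  rintro _ rfl
  refine RAMProg.runs_block_seq ?_
  refine (mulProg_runs_eq (va := 2 * (m * n)) (vb := 2 ^ e) (by simp [runList, RAMInstr.run, h2])
    (by simp [runList, RAMInstr.run, h3]; ring) (by simp [runList, RAMInstr.run, h34])
    (by omega)).seq ?_
  rintro _ rfl
  refine RAMProg.runs_block ?_ le_rfl
  refine ⟨⟨⟨?_, ?_, ?_, ?_, ?_, ?_, ?_, ?_, ?_, ?_, ?_, ?_, ?_, ?_, ?_, ?_, ?_, ?_, ?_⟩,
    ?_, ?_, ?_, ?_, ?_, ?_, ?_⟩, ?_⟩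
  all_goals simp [runList, RAMInstr.run, sizes, Params.N, Params.base, RAMState.init, ← hl, ← hk,
    h0, h1, h2, h3, h4, h5, h6, h7, h8, h10, h20, h34, hρ9]
  all_goals ring

end

/-! ### The run of the whole program -/

/-! ### Strategies depend on earlier rounds only -/

section Causality

theorem blockAvg_congr {M : ℕ} {r r' : ℕ → ℝ} (h c : ℕ)
    (hr : ∀ t < (c + 1) * M ^ h, r t = r' t) : blockAvg M r h c = blockAvg M r' h c := by
  induction h generalizing c with
  | zero => exact hr c (by simp)
  | succ h ih =>
    rw [blockAvg, blockAvg]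
    refine Finset.sum_congr rfl fun i hi => ?_
    rw [ih]
    intro t ht
    apply hr t (ht.trans_le _)
    rw [pow_succ', ← mul_assoc]
    apply Nat.mul_le_mul_right
    have := Finset.mem_range.1 hi
    rw [Nat.succ_mul]
    omega

theorem treeWeight_congr {M : ℕ} {η : ℝ} {r r' : ℕ → ℝ} (h c : ℕ)
    (hr : ∀ t < c * M ^ h, r t = r' t) : treeWeight M η r h c = treeWeight M η r' h c := by
  refine Finset.prod_congr rfl fun i hi => ?_
  rw [blockAvg_congr]
  intro t ht
  apply hr t (ht.trans_le _)
  apply Nat.mul_le_mul_right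
  have := Finset.mem_range.1 hi
  have := Nat.div_add_mod' c M
  omega

/-- The weights for a block use only blocks that were completed before it. This makes the recursion
for the rewards well founded and the samples of a round independent of its strategies. -/
theorem playerStrategy_congr {q : Params} {r r' : ℕ → ℕ → ℝ} {t : ℕ}
    (hr : ∀ t' < t, r t' = r' t') : playerStrategy q r t = playerStrategy q r' t := by
  funext i idx
  simp only [playerStrategy, treeStrategy, levelTable]
  congr 1
  funext j
  apply treeWeight_congr
  intro t' ht'
  rw [hr t' (ht'.trans_le (Nat.div_mul_le_self _ _))]

theorem deviationAddr_congr {m n : ℕ} {act act' : ℕ → ℕ} (h : ∀ i < m, act i = act' i) {i : ℕ}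
    (hi : i < m) (j : ℕ) : deviationAddr m n act i j = deviationAddr m n act' i j := by
  rw [deviationAddr, deviationAddr, h i hi,
    Finset.sum_congr rfl fun i hi => by rw [h i (Finset.mem_range.1 hi)]]

theorem div_lt_of_lt_N {q : Params} {x : ℕ} (hx : x < q.N) : x / q.n < q.m := by
  have hn : 0 < q.n := Nat.pos_of_ne_zero fun h => by simp [Params.N, h] at hx
  rwa [Nat.div_lt_iff_lt_mul hn]

end Causality

/-! ### The estimated rewards as a function of the samples -/

/-- The estimated rewards, when `z t k i` is the index that is sampled for player `i` in the `k`-th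
sample of round `t`. -/
noncomputable def reward (q : Params) (table : ℕ → ℝ) (z : ℕ → ℕ → ℕ → ℕ) : ℕ → ℕ → ℝ :=
  Nat.lt_wfRel.wf.fix fun t rec x => if x < q.N then
    estimate table q.m q.n q.K
      (playerStrategy q (fun t' => if h : t' < t then rec t' h else 0) t) (z t) x else 0

section Reward

variable {q : Params} {table : ℕ → ℝ} {z z' : ℕ → ℕ → ℕ → ℕ}

/-- Setting later rewards to 0 in the recursion is harmless by `playerStrategy_congr`. -/
theorem reward_eq (t x : ℕ) : reward q table z t x = if x < q.N then
    estimate table q.m q.n q.K (playerStrategy q (reward q table z) t) (z t) x else 0 := by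
  have h := congrFun (WellFounded.fix_eq Nat.lt_wfRel.wf (C := fun _ => ℕ → ℝ)
    (fun t rec x => if x < q.N then estimate table q.m q.n q.K
      (playerStrategy q (fun t' => if h : t' < t then rec t' h else 0) t) (z t) x else 0) t) x
  refine (h.trans ?_)
  have e : playerStrategy q (fun t' => if h : t' < t then reward q table z t' else 0) t
      = playerStrategy q (reward q table z) t :=
    playerStrategy_congr fun t' ht' => by simp [ht']
  rw [← e]
  rfl

theorem reward_mem (hK : 0 < q.K) (ht : ∀ k, 0 ≤ table k ∧ table k ≤ 1) (t x : ℕ) :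
    0 ≤ reward q table z t x ∧ reward q table z t x ≤ 1 := by
  rw [reward_eq]
  split_ifs
  · have hK' : (0 : ℝ) < q.K := by exact_mod_cast hK
    rw [estimate, ← Finset.sum_mul, mul_one_div, div_le_one hK']
    refine ⟨div_nonneg (Finset.sum_nonneg fun _ _ => (ht _).1) hK'.le, ?_⟩
    calc _ ≤ ∑ _k ∈ Finset.range q.K, (1 : ℝ) := Finset.sum_le_sum fun _ _ => (ht _).2
      _ = _ := by simp
  · simp

/-- By strong induction on the round: rewards before round `t` depend on the samples before round
`t` only. -/
theorem reward_congr {t : ℕ} (hz : ∀ t' < t, ∀ k < q.K, ∀ i < q.m, z t' k i = z' t' k i) :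
    ∀ t' < t, reward q table z t' = reward q table z' t' := by
  intro t'
  induction t' using Nat.strong_induction_on with
  | _ t' ih =>
    intro ht'
    funext x
    rw [reward_eq, reward_eq, playerStrategy_congr fun s hs => ih s hs (hs.trans ht')]
    split_ifs with hx
    · refine Finset.sum_congr rfl fun k hk => ?_
      rw [deviationAddr_congr (fun i hi => ?_) (div_lt_of_lt_N hx)]
      rw [hz t' ht' k (Finset.mem_range.1 hk) i hi]
    · rfl

end Reward

/-- The whole program, with `2 ^ e` levels. -/
def equilibriumProg (e : ℕ) : RAMProg :=
  .seq (preamble e) (.seq (treeProg (2 ^ e)) (.block [.add 0 9 10]))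

/-- A bound for the time of `equilibriumProg`. -/
def equilibriumTime (e m n : ℕ) : ℕ :=
  preambleTime (sizes e m n) (Nat.clog 2 m) (Nat.clog 2 n)
    + (treeTime (sizes e m n) (2 ^ e) + 1)

theorem coinValue_lt (coins : ℕ → Bool) (p B : ℕ) : coinValue coins p B < 2 ^ B := by
  induction B with
  | zero => simp [coinValue]
  | succ B ih =>
    rw [coinValue, pow_succ]
    split_ifs <;> omega

theorem coinValue_eq_iff (c c' : ℕ → Bool) (p B : ℕ) :
    coinValue c p B = coinValue c' p B ↔ ∀ b < B, c (p + b) = c' (p + b) := by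
  induction B with
  | zero => simp [coinValue]
  | succ B ih =>
    rw [Nat.forall_lt_succ_right, ← ih, coinValue, coinValue]
    cases c (p + B) <;> cases c' (p + B) <;> simp <;> omega

theorem two_pow_bits (e m n : ℕ) :
    2 ^ (sizes e m n).B = (sizes e m n).D * (sizes e m n).G := by
  simp only [sizes]
  ring

theorem sizes_log_pos {m : ℕ} (n : ℕ) (hm : 2 ≤ m) : 0 < Nat.clog 2 m + Nat.clog 2 n :=
  Nat.add_pos_left (Nat.clog_pos (by norm_num) hm) _

/-- The sequence `reward` at the sampled indices solves the fixed point equation demanded by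
`treeProg_runs`, which is then used at the root. -/
theorem equilibriumProg_runs {table : ℕ → ℝ} (ht : ∀ k, 0 ≤ table k ∧ table k ≤ 1)
    (coins : ℕ → Bool) (e m n : ℕ) (hm : 2 ≤ m) (hn : 1 ≤ n) :
    (equilibriumProg e).Runs table coins (RAMState.init m n) (equilibriumTime e m n) fun s =>
      s.reg 0 = (sizes e m n).M ^ (sizes e m n).D ∧
      ∀ t < (sizes e m n).M ^ (sizes e m n).D, ∀ i < m, ∀ j < n,
        s.xmem (t * (m * n) + (i * n + j)) =
          (((Finset.range (2 ^ (sizes e m n).B)).filter fun k =>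
            playerStrategy (sizes e m n) (reward (sizes e m n) table
              (sampleIndex (sizes e m n) coins)) t i k = j).card : ℝ)
            * (1 / (2 ^ (sizes e m n).B : ℕ)) := by
  set q := sizes e m n with hq
  have hL := sizes_log_pos n hm
  have hM : 0 < q.M := by
    simp only [hq, sizes]
    positivity
  have hK : 0 < q.K := by
    simp only [hq, sizes]
    positivity
  have hD : 0 < q.D := by
    simp only [hq, sizes]
    positivity
  refine (preamble_runs e m n (reward q table (sampleIndex q coins))).seq ?_
  rintro s₁ ⟨h1, h2⟩
  refine (treeProg_runs (r := reward q table (sampleIndex q coins)) (q := q) hn hM hD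
    (fun t x _ => reward_mem hK ht t x) (fun t x hx => ?_) (fun p => ?_) (2 ^ e) 0 le_rfl
    (by rw [zero_add, one_mul]; exact le_rfl) ?_ ?_ ?_).seq ?_
  · rw [reward_eq, if_pos hx]
  · rw [← two_pow_bits]
    exact coinValue_lt _ _ _
  · rw [zero_mul]
    exact h1
  · intro x _
    rw [h2]
  -- At the root there is no level left above, so the condition on tables is vacuous.
  · intro h' hh hh'
    exact absurd hh' (not_lt.2 hh)
  rintro s₂ ⟨g1, -⟩
  refine RAMProg.runs_block ⟨?_, ?_⟩ le_rfl
  · simp [runList, RAMInstr.run, g1.env.reg9, g1.env.reg10]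
  · intro t ht' i hi j hj
    have := g1.out t (by rw [zero_add, one_mul]; exact ht') i hi j hj
    rw [two_pow_bits]
    exact this

/-! ### The coins as a uniform choice of samples -/

/-- All the indices that are sampled. -/
abbrev Samples (q : Params) : Type :=
  Fin (q.M ^ q.D) → Fin q.K → Fin q.m → Fin (2 ^ q.B)

/-- The indices that the coins select. -/
def samples (q : Params) (coins : ℕ → Bool) : Samples q := fun t k i =>
  ⟨sampleIndex q coins t k i, coinValue_lt _ _ _⟩

/-- Samples as a function on natural numbers. -/
def Samples.index {q : Params} (x : Samples q) (t k i : ℕ) : ℕ :=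
  if h : t < q.M ^ q.D ∧ k < q.K ∧ i < q.m then x ⟨t, h.1⟩ ⟨k, h.2.1⟩ ⟨i, h.2.2⟩ else 0

/-- A coin position has mixed-radix digits: round, sample, player, bit. The samples thus encode the
coins that are used, each exactly once. -/
theorem samples_eq_iff (q : Params) (c c' : ℕ → Bool) :
    samples q c = samples q c' ↔ ∀ p < q.M ^ q.D * (q.K * (q.m * q.B)), c p = c' p := by
  constructor
  · intro h p hp
    have h1 : 0 < q.K * (q.m * q.B) := Nat.pos_of_ne_zero fun h => by simp [h] at hp
    have h2 : 0 < q.m * q.B := Nat.pos_of_ne_zero fun h => by simp [h] at h1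
    have h3 : 0 < q.B := Nat.pos_of_ne_zero fun h => by simp [h] at h2
    have e1 := Nat.div_add_mod' p (q.K * (q.m * q.B))
    set p1 := p % (q.K * (q.m * q.B)) with hp1
    have e2 := Nat.div_add_mod' p1 (q.m * q.B)
    set p2 := p1 % (q.m * q.B) with hp2
    have e3 := Nat.div_add_mod' p2 q.B
    have l1 : p / (q.K * (q.m * q.B)) < q.M ^ q.D := by rwa [Nat.div_lt_iff_lt_mul h1]
    have l2 : p1 / (q.m * q.B) < q.K := by
      rw [Nat.div_lt_iff_lt_mul h2]
      exact Nat.mod_lt _ h1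
    have l3 : p2 / q.B < q.m := by
      rw [Nat.div_lt_iff_lt_mul h3]
      exact Nat.mod_lt _ h2
    have := congrArg Fin.val (congrFun (congrFun (congrFun h ⟨_, l1⟩) ⟨_, l2⟩) ⟨_, l3⟩)
    have := (coinValue_eq_iff c c' _ _).1 this (p2 % q.B) (Nat.mod_lt _ h3)
    rw [← e1, ← e2, ← e3]
    simpa only [add_assoc] using this
  · intro h
    funext t k i
    apply Fin.ext
    refine (coinValue_eq_iff c c' _ _).2 fun b hb => h _ ?_
    have h1 : (t + 1) * (q.K * (q.m * q.B)) ≤ q.M ^ q.D * (q.K * (q.m * q.B)) :=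
      Nat.mul_le_mul_right _ t.2
    have h2 : (k + 1) * (q.m * q.B) ≤ q.K * (q.m * q.B) := Nat.mul_le_mul_right _ k.2
    have h3 : (i + 1) * q.B ≤ q.m * q.B := Nat.mul_le_mul_right _ i.2
    rw [Nat.succ_mul] at h1 h2 h3
    omega

theorem card_samples (q : Params) :
    Fintype.card (Samples q) = 2 ^ (q.M ^ q.D * (q.K * (q.m * q.B))) := by
  simp only [Samples, Fintype.card_fun, Fintype.card_fin, ← pow_mul]
  congr 1
  ring

theorem samples_index (q : Params) (coins : ℕ → Bool) {t k i : ℕ} (ht : t < q.M ^ q.D)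
    (hk : k < q.K) (hi : i < q.m) :
    (samples q coins).index t k i = sampleIndex q coins t k i := by
  rw [Samples.index, dif_pos ⟨ht, hk, hi⟩]
  rfl

/-! ### Correctness when the estimates are accurate -/

/-! ### Mixtures of product distributions and swap regret -/

section Mixture

variable {m n b : ℕ}

theorem card_filter_forall_eq (S : Fin m → Fin b → Fin n) (a : Fin m → Fin n) :
    (Finset.univ.filter fun w : Fin m → Fin b => (fun i => S i (w i)) = a).card
      = ∏ i, (Finset.univ.filter fun k => S i k = a i).card := by
  rw [← Fintype.card_piFinset]
  congr 1
  ext w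
  simp [funext_iff]

/-- The product of the table distributions is the image of the uniform distribution on tuples of
cells. -/
theorem sum_prod_strategy (S : Fin m → Fin b → Fin n) (F : (Fin m → Fin n) → ℝ) :
    ∑ a : Fin m → Fin n,
        (∏ i, ((Finset.univ.filter fun k => S i k = a i).card : ℝ) * (1 / b)) * F a
      = (∑ w : Fin m → Fin b, F fun i => S i (w i)) * (1 / (b : ℝ) ^ m) := by
  have h : ∀ a : Fin m → Fin n,
      (∏ i, ((Finset.univ.filter fun k => S i k = a i).card : ℝ) * (1 / b)) * F a
      = (∑ w : Fin m → Fin b, if (fun i => S i (w i)) = a then F a else 0) * (1 / (b : ℝ) ^ m) := by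
    intro a
    rw [Finset.prod_mul_distrib, Finset.prod_const, Finset.card_univ, Fintype.card_fin,
      ← Finset.sum_filter, Finset.sum_const, card_filter_forall_eq, nsmul_eq_mul]
    push_cast
    rw [one_div_pow]
    ring
  rw [Finset.sum_congr rfl fun a _ => h a, ← Finset.sum_mul, Finset.sum_comm]
  congr 1
  refine Finset.sum_congr rfl fun w _ => ?_
  simp

/-- The expected utility of player `i` at the action `j`, when the others follow `S`. -/
noncomputable def expectedUtility (G : Game m n) (S : Fin m → Fin b → Fin n) (i : Fin m)
    (j : Fin n) : ℝ :=
  (∑ w : Fin m → Fin b, G.u i (Function.update (fun i' => S i' (w i')) i j)) * (1 / (b : ℝ) ^ m)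

/-- The expected utility of a deviation ignores the player's own cell, so that cell may be resampled
independently of the others. -/
theorem sum_prod_strategy_swap (hb : 0 < b) (G : Game m n) (S : Fin m → Fin b → Fin n)
    (i : Fin m) (φ : Fin n → Fin n) :
    ∑ a : Fin m → Fin n,
        (∏ i, ((Finset.univ.filter fun k => S i k = a i).card : ℝ) * (1 / b))
          * G.u i (Function.update a i (φ (a i)))
      = (∑ k, expectedUtility G S i (φ (S i k))) * (1 / b) := by
  have hb' : (b : ℝ) ≠ 0 := by exact_mod_cast hb.ne'
  rw [sum_prod_strategy S fun a => G.u i (Function.update a i (φ (a i)))]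
  have h := sum_resample i
    (fun (w : Fin m → Fin b) k => G.u i (Function.update (fun i' => S i' (w i')) i (φ (S i k))))
    (by
      intro w k k'
      congr 1
      funext i'
      by_cases hi : i' = i
      · subst hi; simp
      · simp [hi])
  rw [Fintype.card_fin] at h
  simp only [expectedUtility]
  rw [← Finset.sum_mul, Finset.sum_comm, h]
  field_simp

/-- Both sides of the equilibrium condition are averages over rounds, and their difference is the
average swap regret for true expected utilities. -/
theorem isSolution_of_swap_regret (hb : 0 < b) (G : Game m n) {T : ℕ} (hT : 0 < T)
    (S : ℕ → Fin m → Fin b → Fin n) {s : RAMState} (h0 : s.reg 0 = T)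
    (hs : ∀ t < T, ∀ (i : Fin m) (j : Fin n), s.strategy t i j
      = ((Finset.univ.filter fun k => S t i k = j).card : ℝ) * (1 / b)) {ε : ℝ}
    (hreg : ∀ (i : Fin m) (φ : Fin n → Fin n), ∑ t ∈ Finset.range T, ∑ k,
      (expectedUtility G (S t) i (φ (S t i k)) - expectedUtility G (S t) i (S t i k))
        ≤ ε * (T * b)) :
    s.IsSolution G ε := by
  have hb' : (0 : ℝ) < b := by exact_mod_cast hb
  have hT' : (0 : ℝ) < T := by exact_mod_cast hT
  have hmix : ∀ F : (Fin m → Fin n) → ℝ, ∑ a, s.mixture m n a * F a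
      = 1 / T * ∑ t ∈ Finset.range T, ∑ a : Fin m → Fin n,
        (∏ i, ((Finset.univ.filter fun k => S t i k = a i).card : ℝ) * (1 / b)) * F a := by
    intro F
    rw [Finset.sum_comm, Finset.mul_sum]
    refine Finset.sum_congr rfl fun a _ => ?_
    rw [RAMState.mixture, h0, mul_assoc, Finset.sum_mul]
    congr 1
    refine Finset.sum_congr rfl fun t ht => ?_
    rw [Finset.prod_congr rfl fun i _ => hs t (Finset.mem_range.1 ht) i (a i)]
  have hval : ∀ (i : Fin m) (φ : Fin n → Fin n),
      ∑ a, s.mixture m n a * G.u i (Function.update a i (φ (a i)))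
        = 1 / T * ∑ t ∈ Finset.range T, (∑ k, expectedUtility G (S t) i (φ (S t i k))) * (1 / b) := by
    intro i φ
    rw [hmix fun a => G.u i (Function.update a i (φ (a i)))]
    congr 1
    exact Finset.sum_congr rfl fun t _ => sum_prod_strategy_swap hb G (S t) i φ
  refine ⟨by omega, fun t ht i => ⟨fun j => ?_, ?_⟩, ⟨fun a => ?_, ?_⟩, fun i φ => ?_⟩
  · show 0 ≤ s.strategy t i j
    rw [hs t (by omega) i j]
    positivity
  · rw [Finset.sum_congr rfl fun j _ => hs t (by omega) i j, ← Finset.sum_mul]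
    have : ∑ j : Fin n, ((Finset.univ.filter fun k => S t i k = j).card : ℝ) = b := by
      have h := Finset.card_eq_sum_card_fiberwise (f := S t i) (s := Finset.univ)
        (t := Finset.univ) (fun _ _ => Finset.mem_coe.2 (Finset.mem_univ _))
      rw [Finset.card_univ, Fintype.card_fin] at h
      exact_mod_cast h.symm
    rw [this]
    field_simp
  · rw [RAMState.mixture]
    refine mul_nonneg (by positivity) (Finset.sum_nonneg fun t ht => Finset.prod_nonneg
      fun i _ => ?_)
    rw [hs t (by rw [← h0]; exact Finset.mem_range.1 ht) i]
    positivity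
  · have h := hmix fun _ => 1
    simp only [mul_one] at h
    rw [h]
    have h1 : ∀ t, ∑ a : Fin m → Fin n,
        (∏ i, ((Finset.univ.filter fun k => S t i k = a i).card : ℝ) * (1 / b)) = 1 := by
      intro t
      have := sum_prod_strategy (S t) fun _ => 1
      simp only [mul_one] at this
      rw [this]
      simp [hb'.ne']
    simp only [h1]
    simp [hT'.ne']
  · have hid := hval i id
    simp only [id, Function.update_eq_self] at hid
    rw [hval i φ, hid, sub_le_iff_le_add, ← sub_le_iff_le_add', ← mul_sub,
      ← Finset.sum_sub_distrib]
    have h1 : ∑ t ∈ Finset.range T, ((∑ k, expectedUtility G (S t) i (φ (S t i k))) * (1 / (b : ℝ))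
        - (∑ k, expectedUtility G (S t) i (S t i k)) * (1 / b))
        = (∑ t ∈ Finset.range T, ∑ k, (expectedUtility G (S t) i (φ (S t i k))
          - expectedUtility G (S t) i (S t i k))) * (1 / b) := by
      rw [Finset.sum_mul]
      refine Finset.sum_congr rfl fun t _ => ?_
      rw [Finset.sum_sub_distrib]
      ring
    rw [h1]
    calc _ ≤ 1 / (T : ℝ) * (ε * (T * b) * (1 / b)) := by
          gcongr
          exact hreg i φ
      _ = ε := by field_simp

theorem Game.table_mem (G : Game m n) (k : ℕ) : 0 ≤ G.table k ∧ G.table k ≤ 1 := by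
  rw [Game.table]
  split_ifs
  · exact G.u_mem _ _
  · simp

/-- The truncated subtraction is exact, because player `i`'s own term occurs in the sum. -/
theorem Game.table_deviationAddr (G : Game m n) (i : Fin m) (a : Fin m → Fin n) (j : Fin n)
    (act : ℕ → ℕ) (ha : ∀ i : Fin m, act i = a i) :
    G.table (deviationAddr m n act i j) = G.u i (Function.update a i j) := by
  rw [← Game.table_apply]
  congr 1
  rw [deviationAddr, Finset.sum_range, ← Finset.add_sum_erase _ _ (Finset.mem_univ i),
    ← Finset.add_sum_erase Finset.univ
      (fun i' => ((Function.update a i j i' : Fin n) : ℕ) * n ^ (i' : ℕ)) (Finset.mem_univ i),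
    Function.update_self]
  have : ∑ x ∈ Finset.univ.erase i, ((Function.update a i j x : Fin n) : ℕ) * n ^ (x : ℕ)
      = ∑ x ∈ Finset.univ.erase i, n ^ (x : ℕ) * act x := by
    refine Finset.sum_congr rfl fun x hx => ?_
    rw [Function.update_of_ne (Finset.ne_of_mem_erase hx), ha, mul_comm]
  rw [this]
  omega

end Mixture

/-! ### Accuracy of the estimates -/

/-- An index for every player, as a function on natural numbers. -/
def extendIndex {m b : ℕ} (w : Fin m → Fin b) (i : ℕ) : ℕ := if h : i < m then w ⟨i, h⟩ else 0

/-- The reward of player `i` for the action `j`, averaged over all indices. -/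
noncomputable def meanReward (q : Params) (table : ℕ → ℝ) (σ : ℕ → ℕ → ℕ) (i j : ℕ) : ℝ :=
  (∑ w : Fin q.m → Fin (2 ^ q.B),
    table (deviationAddr q.m q.n (fun i' => σ i' (extendIndex w i')) i j))
      * (1 / Fintype.card (Fin q.m → Fin (2 ^ q.B)))

/-- In every round the estimates are close to the mean rewards. -/
def Accurate (q : Params) (table : ℕ → ℝ) (x : Samples q) : Prop :=
  ∀ (t : Fin (q.M ^ q.D)) (i : Fin q.m) (j : Fin q.n),
    |reward q table x.index t (i * q.n + j)
      - meanReward q table (playerStrategy q (reward q table x.index) t) i j| ≤ 1 / q.D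

-- A union bound over rounds, players and actions. For each triple the other rounds are fixed, so
-- the strategies of round `t` are fixed too, and the Chernoff bound applies to its fresh samples.
open Classical in
theorem card_not_accurate_le {q : Params} {table : ℕ → ℝ}
    (ht : ∀ k, 0 ≤ table k ∧ table k ≤ 1) (hK : 0 < q.K) (hD : 0 < q.D) :
    ((Finset.univ.filter fun x : Samples q => ¬ Accurate q table x).card : ℝ)
      ≤ ((q.M ^ q.D : ℕ) * (q.m * q.n) : ℝ) * (2 * Real.exp (-(q.K * (1 / q.D) ^ 2 / 4)))
        * Fintype.card (Samples q) := by
  have hD' : (0 : ℝ) < q.D := by exact_mod_cast hD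
  set δ : ℝ := 2 * Real.exp (-(q.K * (1 / q.D) ^ 2 / 4)) with hδ
  let f : Samples q → Fin (q.M ^ q.D) → Fin q.m → Fin q.n → (Fin q.m → Fin (2 ^ q.B)) → ℝ :=
    fun x t i j w => table (deviationAddr q.m q.n (fun i' =>
      playerStrategy q (reward q table x.index) t i' (extendIndex w i')) i j)
  let P : Fin (q.M ^ q.D) → Fin q.m → Fin q.n → Samples q →
      (Fin q.K → Fin q.m → Fin (2 ^ q.B)) → Prop := fun t i j x y =>
    1 / (q.D : ℝ) < |∑ k, f x t i j (y k) * (1 / q.K)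
      - (∑ w, f x t i j w) * (1 / Fintype.card (Fin q.m → Fin (2 ^ q.B)))|
  have hrew : ∀ (x : Samples q) (t : Fin (q.M ^ q.D)) (i : Fin q.m) (j : Fin q.n),
      reward q table x.index t (i * q.n + j) = ∑ k, f x t i j (x t k) * (1 / q.K) := by
    intro x t i j
    have hlt : (i : ℕ) * q.n + j < q.N := by
      have h1 : ((i : ℕ) + 1) * q.n ≤ q.m * q.n := Nat.mul_le_mul_right _ i.2
      rw [Nat.succ_mul] at h1
      rw [Params.N]
      omega
    have hdiv : ((i : ℕ) * q.n + j) / q.n = i := by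
      rw [add_comm, Nat.add_mul_div_right _ _ j.pos, Nat.div_eq_of_lt j.2, zero_add]
    have hmod : ((i : ℕ) * q.n + j) % q.n = j := by
      rw [add_comm, Nat.add_mul_mod_self_right, Nat.mod_eq_of_lt j.2]
    rw [reward_eq, if_pos hlt, estimate, Finset.sum_range, hdiv, hmod]
    refine Finset.sum_congr rfl fun k _ => ?_
    have : ∀ i', x.index t k i' = extendIndex (x t k) i' := by
      intro i'
      by_cases hi : i' < q.m
      · simp [Samples.index, extendIndex, hi]
      · simp [Samples.index, extendIndex, hi]
    simp only [this, f]
  have hsub : (Finset.univ.filter fun x : Samples q => ¬ Accurate q table x)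
      ⊆ Finset.univ.biUnion fun z : Fin (q.M ^ q.D) × Fin q.m × Fin q.n =>
        Finset.univ.filter fun x : Samples q => P z.1 z.2.1 z.2.2 x (x z.1) := by
    intro x hx
    have hx := (Finset.mem_filter.1 hx).2
    simp only [Accurate, not_forall, not_le] at hx
    obtain ⟨t, i, j, h⟩ := hx
    refine Finset.mem_biUnion.2 ⟨(t, i, j), Finset.mem_univ _, Finset.mem_filter.2
      ⟨Finset.mem_univ _, ?_⟩⟩
    rw [hrew] at h
    exact h
  have hP : ∀ t i j, ((Finset.univ.filter fun x : Samples q => P t i j x (x t)).card : ℝ)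
      ≤ δ * Fintype.card (Samples q) := by
    intro t i j
    refine card_adaptive_le t (P t i j) (fun x y z => ?_) fun x => ?_
    -- Changing the samples of round `t` leaves the earlier rewards alone, and with them the
    -- strategies of round `t`.
    · have hf : f (Function.update x t y) t i j = f x t i j := by
        have hs : playerStrategy q (reward q table (Samples.index (Function.update x t y))) t
            = playerStrategy q (reward q table (Samples.index (q := q) x)) t := by
          refine playerStrategy_congr (reward_congr fun t' ht' k _ i' _ => ?_)
          simp only [Samples.index]
          split_ifs with h
          · rw [Function.update_of_ne]
            intro h'
            have := congrArg Fin.val h'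
            simp only at this
            omega
          · rfl
        simp only [f, hs]
      simp only [P, hf]
    · have := card_average_deviation_le (f x t i j) (fun w => ht _) q.K hK
        (η := 1 / q.D) (by positivity) (by rw [div_le_one hD']; exact_mod_cast hD)
      refine this.trans (le_of_eq ?_)
      rw [hδ, Fintype.card_fun (α := Fin q.K), Fintype.card_fin]
      push_cast
      rfl
  calc _ ≤ ((Finset.univ.biUnion fun z : Fin (q.M ^ q.D) × Fin q.m × Fin q.n =>
        Finset.univ.filter fun x : Samples q => P z.1 z.2.1 z.2.2 x (x z.1)).card : ℝ) := by
        exact_mod_cast Finset.card_le_card hsub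
    _ ≤ ∑ z : Fin (q.M ^ q.D) × Fin q.m × Fin q.n,
        ((Finset.univ.filter fun x : Samples q => P z.1 z.2.1 z.2.2 x (x z.1)).card : ℝ) := by
        exact_mod_cast Finset.card_biUnion_le
    _ ≤ ∑ _z : Fin (q.M ^ q.D) × Fin q.m × Fin q.n, δ * Fintype.card (Samples q) :=
        Finset.sum_le_sum fun z _ => hP _ _ _
    _ = _ := by
        rw [Finset.sum_const, Finset.card_univ, Fintype.card_prod, Fintype.card_prod,
          Fintype.card_fin, Fintype.card_fin, Fintype.card_fin, nsmul_eq_mul]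
        push_cast
        ring

theorem log_le_clog (n : ℕ) : Real.log n ≤ Nat.clog 2 n := by
  rcases Nat.eq_zero_or_pos n with rfl | hn
  · simp
  have h1 : (n : ℝ) ≤ 2 ^ Nat.clog 2 n := by exact_mod_cast Nat.le_pow_clog (by norm_num) n
  calc Real.log n ≤ Real.log (2 ^ Nat.clog 2 n) :=
        Real.log_le_log (by exact_mod_cast hn) h1
    _ = Nat.clog 2 n * Real.log 2 := Real.log_pow _ _
    _ ≤ Nat.clog 2 n * 1 := by
        gcongr
        linarith [Real.log_two_lt_d9]
    _ = _ := mul_one _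

/-- Swap regret 4/D for the estimates plus an error of 1/D on each side of a swap gives 6/D for the
true utilities. -/
theorem isSolution_of_accurate {m n : ℕ} (hm : 2 ≤ m) (hn : 1 ≤ n) (G : Game m n)
    (coins : ℕ → Bool) (e : ℕ) {ε : ℝ} (hε : 6 / (2 ^ e : ℕ) ≤ ε)
    (hacc : Accurate (sizes e m n) G.table (samples (sizes e m n) coins)) {s : RAMState}
    (h0 : s.reg 0 = (sizes e m n).M ^ (sizes e m n).D)
    (hs : ∀ t < (sizes e m n).M ^ (sizes e m n).D, ∀ i < m, ∀ j < n,
        s.xmem (t * (m * n) + (i * n + j)) =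
          (((Finset.range (2 ^ (sizes e m n).B)).filter fun k =>
            playerStrategy (sizes e m n) (reward (sizes e m n) G.table
              (sampleIndex (sizes e m n) coins)) t i k = j).card : ℝ)
            * (1 / (2 ^ (sizes e m n).B : ℕ))) :
    s.IsSolution G ε := by
  set q := sizes e m n with hq
  have hL := sizes_log_pos n hm
  have hM : 0 < q.M := by
    simp only [hq, sizes]
    positivity
  have hK : 0 < q.K := by
    simp only [hq, sizes]
    positivity
  have hD : 0 < q.D := by
    simp only [hq, sizes]
    positivity
  have hD' : (0 : ℝ) < q.D := by exact_mod_cast hD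
  have hbits : 2 ^ q.B = q.D * q.G := two_pow_bits e m n
  set r := reward q G.table (sampleIndex q coins) with hrdef
  have hr : ∀ t x, 0 ≤ r t x ∧ r t x ≤ 1 := reward_mem hK G.table_mem
  have hagree : ∀ t < q.M ^ q.D, reward q G.table (samples q coins).index t = r t :=
    reward_congr fun t ht k hk i hi => samples_index q coins ht hk hi
  have hrow : ∀ i < m, ∀ j < n, i * n + j < q.N := by
    intro i hi j hj
    change i * n + j < m * n
    nlinarith
  have hlt : ∀ t i k, i < m → k < 2 ^ q.B → playerStrategy q r t i k < n := by
    intro t i k hi hk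
    rw [hbits] at hk
    exact treeStrategy_lt (M := q.M) (n := n) hD hM hn (r := fun t j => r t (i * n + j))
      (fun t j _ => hr t _) t hk
  have hn' : 0 < n := hn
  let S : ℕ → Fin m → Fin (2 ^ q.B) → Fin n := fun t i k =>
    ⟨playerStrategy q r t i k, hlt t i k i.2 k.2⟩
  have hmean : ∀ t < q.M ^ q.D, ∀ (i : Fin m) (j : Fin n),
      |r t (i * n + j) - expectedUtility G (S t) i j| ≤ 1 / q.D := by
    intro t ht i j
    have h := hacc ⟨t, ht⟩ i j
    have hst : playerStrategy q (reward q G.table (samples q coins).index) t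
        = playerStrategy q r t := playerStrategy_congr fun t' ht' => hagree t' (ht'.trans ht)
    simp only [hagree t ht, hst] at h
    refine le_of_eq_of_le ?_ h
    have : meanReward q G.table (playerStrategy q r t) i j = expectedUtility G (S t) i j := by
      rw [meanReward, expectedUtility]
      congr 1
      · refine Finset.sum_congr rfl fun w _ => ?_
        refine G.table_deviationAddr i _ j _ fun i' => ?_
        change playerStrategy q r t i' (extendIndex w i') = playerStrategy q r t i' (w i')
        congr 1
        simp only [extendIndex, dif_pos (show (i' : ℕ) < q.m from i'.2)]
        rfl
      · rw [Fintype.card_fun, Fintype.card_fin, Fintype.card_fin]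
        push_cast
        rfl
    rw [this]
    rfl
  refine isSolution_of_swap_regret (b := 2 ^ q.B) (by positivity) G (T := q.M ^ q.D)
    (by positivity) S h0 ?_ ?_
  · intro t ht i j
    rw [RAMState.strategy, add_assoc, hs t ht i i.2 j j.2]
    congr 2
    rw [Finset.card_filter, Finset.card_filter, Finset.sum_range]
    refine Finset.sum_congr rfl fun k _ => ?_
    simp only [S, Fin.ext_iff]
  · intro i φ
    have hmain := treeStrategy_swap_regret (M := q.M) (D := q.D) (n := n) (G := q.G)
      (L := Nat.clog 2 m + Nat.clog 2 n) hD hL hn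
      (by
        push_cast
        linarith [log_le_clog n, show (0 : ℝ) ≤ Nat.clog 2 m by positivity])
      (Nat.mul_le_mul_left _ (Nat.le_pow_clog (by norm_num) n))
      (r := fun t j => r t (i * n + j)) (fun t j _ => hr t _)
      -- The swap is extended arbitrarily to natural numbers; only values at actions matter.
      (fun j => if h : j < n then φ ⟨j, h⟩ else 0)
      (fun j hj => by simp [hj]) rfl
    rw [← hbits] at hmain
    have hle : ∑ t ∈ Finset.range (q.M ^ q.D), ∑ k,
        (expectedUtility G (S t) i (φ (S t i k)) - expectedUtility G (S t) i (S t i k))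
        ≤ ∑ t ∈ Finset.range (q.M ^ q.D), ∑ k : Fin (2 ^ q.B),
          ((r t (i * n + φ (S t i k)) - r t (i * n + S t i k)) + 2 / q.D) := by
      refine Finset.sum_le_sum fun t ht => Finset.sum_le_sum fun k _ => ?_
      have h1 := abs_le.1 (hmean t (Finset.mem_range.1 ht) i (φ (S t i k)))
      have h2 := abs_le.1 (hmean t (Finset.mem_range.1 ht) i (S t i k))
      have e2 : (2 : ℝ) / q.D = 1 / q.D + 1 / q.D := by ring
      rw [e2]
      linarith [h1.1, h1.2, h2.1, h2.2]
    refine hle.trans ?_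
    have hconv : ∑ t ∈ Finset.range (q.M ^ q.D), ∑ k : Fin (2 ^ q.B),
          (r t (i * n + φ (S t i k)) - r t (i * n + S t i k))
        ≤ 4 * q.G * (q.M : ℝ) ^ q.D := by
      refine le_of_eq_of_le ?_ hmain
      refine Finset.sum_congr rfl fun t _ => ?_
      rw [Finset.sum_range]
      refine Finset.sum_congr rfl fun k _ => ?_
      have hk : treeStrategy q.M (1 / q.D) n q.G (fun t j => r t (i * n + j)) t k < n :=
        hlt t i k i.2 k.2
      simp only [dif_pos hk]
      rfl
    simp only [Finset.sum_add_distrib, Finset.sum_const, Finset.card_univ, Fintype.card_fin,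
      Finset.card_range, nsmul_eq_mul]
    have hcast : ((2 ^ q.B : ℕ) : ℝ) = q.D * q.G := by
      rw [hbits]
      push_cast
      rfl
    have hcast' : ((q.M ^ q.D : ℕ) : ℝ) = (q.M : ℝ) ^ q.D := by push_cast; rfl
    rw [hcast, hcast']
    have hGM : (0 : ℝ) ≤ (q.M : ℝ) ^ q.D * (q.D * q.G) := by positivity
    calc _ ≤ 4 * q.G * (q.M : ℝ) ^ q.D + (q.M : ℝ) ^ q.D * (q.D * q.G * (2 / q.D)) := by
          gcongr
      _ = 6 / q.D * ((q.M : ℝ) ^ q.D * (q.D * q.G)) := by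
          field_simp
          ring
      _ ≤ ε * ((q.M : ℝ) ^ q.D * (q.D * q.G)) := mul_le_mul_of_nonneg_right hε hGM

/-! ### Running time and success probability -/

theorem two_pow_clog_le {n : ℕ} (hn : 1 ≤ n) : 2 ^ Nat.clog 2 n ≤ 2 * n := by
  rcases hn.eq_or_lt with rfl | hn
  · simp
  · have h := Nat.pow_pred_clog_lt_self (b := 2) (by norm_num) hn
    have h0 : 0 < Nat.clog 2 n := Nat.clog_pos (by norm_num) hn
    obtain ⟨k, hk⟩ := Nat.exists_eq_succ_of_ne_zero h0.ne'
    rw [hk] at h ⊢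
    simp only [Nat.pred_succ] at h
    rw [Nat.pow_succ]
    omega

/-! ### Bounds for the running time -/

/-- Bounds for the sizes by a single quantity `Y`. -/
structure Params.Bounded (q : Params) (Y : ℕ) : Prop where
  eight_le : 8 ≤ Y
  m_pos : 1 ≤ q.m
  n_pos : 1 ≤ q.n
  D_le : q.D ≤ Y
  G_le : q.G ≤ 2 * Y * q.n
  M_le : q.M ≤ Y ^ 2
  K_le : q.K ≤ Y ^ 5
  B_le : q.B ≤ 3 * Y

/-- Here Y = DL with D ≥ 8, which absorbs the factor 8 of `K` into another power of D. -/
theorem sizes_bounded {e m n : ℕ} (he : 3 ≤ e) (hm : 2 ≤ m) (hn : 1 ≤ n) :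
    (sizes e m n).Bounded (2 ^ e * (Nat.clog 2 m + Nat.clog 2 n)) := by
  have hL := sizes_log_pos n hm
  set l := Nat.clog 2 m
  set k := Nat.clog 2 n with hk
  have h8 : 8 ≤ 2 ^ e := by
    calc 8 = 2 ^ 3 := by norm_num
      _ ≤ 2 ^ e := Nat.pow_le_pow_right (by norm_num) he
  have hlt : e < 2 ^ e := Nat.lt_two_pow_self
  set D := 2 ^ e with hD
  have hDY : D ≤ D * (l + k) := Nat.le_mul_of_pos_right _ hL
  have hLY : l + k ≤ D * (l + k) := Nat.le_mul_of_pos_left _ (by omega)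
  have hL2 : l + k ≤ (l + k) ^ 2 := by nlinarith
  have hc := two_pow_clog_le hn
  refine ⟨h8.trans hDY, by simp only [sizes]; omega, by simp only [sizes]; omega, hDY, ?_, ?_, ?_,
    ?_⟩
  · simp only [sizes]
    calc 2 ^ e * 2 ^ Nat.clog 2 n ≤ D * (l + k) * (2 * n) := Nat.mul_le_mul hDY hc
      _ = _ := by ring
  · simp only [sizes]
    calc (2 ^ e) ^ 2 * (l + k) ≤ D ^ 2 * (l + k) ^ 2 := Nat.mul_le_mul_left _ hL2
      _ = _ := by ring
  · simp only [sizes]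
    calc 8 * (2 ^ e) ^ 4 * (l + k) ^ 2 = 8 * (D * D) * (D * (l + k)) ^ 2 := by
          rw [← hD]; ring
      _ ≤ (D * (D * D)) * (D * (l + k)) ^ 2 := by
          gcongr
      _ ≤ (D * (l + k)) ^ 3 * (D * (l + k)) ^ 2 := by
          refine Nat.mul_le_mul_right _ ?_
          calc D * (D * D) = D ^ 3 := by ring
            _ ≤ _ := Nat.pow_le_pow_left hDY 3
      _ = _ := by ring
  · simp only [sizes]
    omega

/-- Sampling dominates: at most Y^5 profiles at a cost of order NY each, while the output costs
order NY². -/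
theorem Params.Bounded.roundTime_le {q : Params} {Y : ℕ} (h : q.Bounded Y) :
    roundTime q ≤ q.N * Y ^ 8 := by
  obtain ⟨h8, hm, hn, hD, hG, hM, hK, hB⟩ := h
  have hN : 1 ≤ q.N := Nat.mul_pos hm hn
  have hmN : q.m ≤ q.N := Nat.le_mul_of_pos_right _ hn
  have h1 : q.m * (8 * (q.D * q.G) + 7) ≤ q.N * (16 * Y ^ 2 + 7) := by
    calc _ ≤ q.m * (8 * (Y * (2 * Y * q.n)) + 7 * q.n) := by gcongr; omega
      _ = _ := by rw [Params.N]; ring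
  have h2 : q.m * (5 * q.B + 15 * q.n + 28) + 14 ≤ q.N * (15 * Y + 57) := by
    calc _ ≤ q.m * (5 * (3 * Y) * q.n + 15 * q.n + 28 * q.n) + 14 * q.N := by
          have : 5 * q.B ≤ 5 * (3 * Y) * q.n := (Nat.mul_le_mul_left _ hB).trans
            (Nat.le_mul_of_pos_right _ hn)
          gcongr <;> omega
      _ = _ := by rw [Params.N]; ring
  calc roundTime q ≤ q.N * (16 * Y ^ 2 + 7) + 7 * q.N + Y ^ 5 * (q.N * (15 * Y + 57)) := by
        have := Nat.mul_le_mul hK h2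
        rw [roundTime]
        omega
    _ = q.N * (16 * Y ^ 2 + 14 + Y ^ 5 * (15 * Y + 57)) := by ring
    _ ≤ q.N * Y ^ 8 := by
        refine Nat.mul_le_mul_left _ ?_
        have a1 : Y ^ 5 * (15 * Y + 57) ≤ Y ^ 5 * (23 * Y) := Nat.mul_le_mul_left _ (by omega)
        have a2 : 64 * Y ^ 6 ≤ Y ^ 8 := by
          calc 64 * Y ^ 6 = (8 * 8) * Y ^ 6 := by ring
            _ ≤ (Y * Y) * Y ^ 6 := by gcongr
            _ = _ := by ring
        have a3 : Y ^ 2 ≤ Y ^ 6 := Nat.pow_le_pow_right (by omega) (by norm_num)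
        have a4 : 1 ≤ Y ^ 6 := Nat.one_le_pow _ _ (by omega)
        have a5 : Y ^ 5 * (23 * Y) = 23 * Y ^ 6 := by ring
        omega

/-- Each level multiplies the time by M ≤ Y², and one more factor Y ≥ 8 pays for the overhead. -/
theorem Params.Bounded.treeTime_le {q : Params} {Y : ℕ} (h : q.Bounded Y) (k : ℕ) :
    treeTime q k ≤ q.N * Y ^ (8 + 3 * k) := by
  induction k with
  | zero => exact h.roundTime_le
  | succ k ih =>
    obtain ⟨h8, hm, hn, hD, hG, hM, hK, hB⟩ := h
    have hN : 1 ≤ q.N := Nat.mul_pos hm hn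
    have h1 : q.m * (13 * q.n + 4 * q.G + 13) ≤ q.N * (26 + 8 * Y) := by
      calc _ ≤ q.m * (13 * q.n + 4 * (2 * Y * q.n) + 13 * q.n) := by gcongr; omega
        _ = _ := by rw [Params.N]; ring
    have h2 : q.m * (13 * q.n + 4 * q.G + 13) + 4 + (treeTime q k + (16 * q.N + 3 + 1)) + 1
        ≤ q.N * (51 + 8 * Y + Y ^ (8 + 3 * k)) := by
      simp only [mul_add] at h1 ⊢
      omega
    calc treeTime q (k + 1)
        ≤ Y ^ 2 * (q.N * (51 + 8 * Y + Y ^ (8 + 3 * k))) + 13 * q.N := by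
          have := Nat.mul_le_mul hM h2
          rw [treeTime]
          omega
      _ = q.N * (Y ^ 2 * (51 + 8 * Y) + 13 + Y ^ (8 + 3 * k + 2)) := by ring
      _ ≤ q.N * Y ^ (8 + 3 * (k + 1)) := by
          refine Nat.mul_le_mul_left _ ?_
          have a1 : Y ^ 2 * (51 + 8 * Y) ≤ Y ^ 2 * (15 * Y) := Nat.mul_le_mul_left _ (by omega)
          have a2 : Y ^ 2 * (15 * Y) = 15 * Y ^ 3 := by ring
          have a3 : Y ^ (8 + 3 * (k + 1)) = Y * Y ^ (8 + 3 * k + 2) := by ring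
          have a4 : 8 * Y ^ (8 + 3 * k + 2) ≤ Y * Y ^ (8 + 3 * k + 2) := Nat.mul_le_mul_right _ h8
          have a5 : 64 * Y ^ 3 ≤ Y ^ (8 + 3 * k + 2) := by
            calc 64 * Y ^ 3 = (8 * 8) * Y ^ 3 := by ring
              _ ≤ (Y * Y) * Y ^ 3 := by gcongr
              _ = Y ^ 5 := by ring
              _ ≤ _ := Nat.pow_le_pow_right (by omega) (by omega)
          have a6 : 1 ≤ Y ^ 3 := Nat.one_le_pow _ _ (by omega)
          omega

theorem Params.Bounded.preambleTime_le {q : Params} {Y l k : ℕ} (h : q.Bounded Y)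
    (hl : l + k ≤ Y) : preambleTime q l k ≤ q.N * Y ^ 5 := by
  obtain ⟨h8, hm, hn, hD, hG, hM, hK, hB⟩ := h
  have hN : 1 ≤ q.N := Nat.mul_pos hm hn
  have hnN : q.n ≤ q.N := Nat.le_mul_of_pos_left _ hm
  have h1 : q.D * (3 * q.M + 6) ≤ Y * (3 * Y ^ 2 + 6) := by gcongr
  have h2 : (l + k) * (l + k) ≤ Y * Y := by gcongr
  have h3 : preambleTime q l k ≤ 6 * q.N + (3 * Y ^ 3 + 3 * Y ^ 2 + 23 * Y + 65) := by
    have e1 : Y * (3 * Y ^ 2 + 6) = 3 * Y ^ 3 + 6 * Y := by ring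
    have e2 : Y * Y = Y ^ 2 := by ring
    rw [e1] at h1
    rw [e2] at h2
    simp only [preambleTime]
    linarith
  refine h3.trans ?_
  have h4 : 3 * Y ^ 3 + 3 * Y ^ 2 + 23 * Y + 71 ≤ Y ^ 5 := by
    have a1 : 64 * Y ^ 3 ≤ Y ^ 5 := by
      calc 64 * Y ^ 3 = (8 * 8) * Y ^ 3 := by ring
        _ ≤ (Y * Y) * Y ^ 3 := by gcongr
        _ = Y ^ 5 := by ring
    have a2 : 8 * Y ^ 2 ≤ Y ^ 3 := by
      calc 8 * Y ^ 2 ≤ Y * Y ^ 2 := Nat.mul_le_mul_right _ h8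
        _ = _ := by ring
    have a3 : 8 * Y ≤ Y ^ 2 := by
      calc 8 * Y ≤ Y * Y := Nat.mul_le_mul_right _ h8
        _ = _ := by ring
    omega
  calc _ ≤ 6 * q.N + q.N * (3 * Y ^ 3 + 3 * Y ^ 2 + 23 * Y + 65) := by
        gcongr
        exact Nat.le_mul_of_pos_left _ hN
    _ = q.N * (3 * Y ^ 3 + 3 * Y ^ 2 + 23 * Y + 71) := by ring
    _ ≤ _ := Nat.mul_le_mul_left _ h4

/-- The exponent 8 + 3D of the tree, plus one for the preamble and constants, is at most 5D since D
≥ 8. -/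
theorem equilibriumTime_le {e m n : ℕ} (he : 3 ≤ e) (hm : 2 ≤ m) (hn : 1 ≤ n) :
    equilibriumTime e m n
      ≤ m * n * (2 ^ e * (Nat.clog 2 m + Nat.clog 2 n)) ^ (5 * 2 ^ e) := by
  have h := sizes_bounded he hm hn
  have h8 : 8 ≤ 2 ^ e := by
    calc 8 = 2 ^ 3 := by norm_num
      _ ≤ 2 ^ e := Nat.pow_le_pow_right (by norm_num) he
  set Y := 2 ^ e * (Nat.clog 2 m + Nat.clog 2 n) with hY
  have h1 := h.preambleTime_le (l := Nat.clog 2 m) (k := Nat.clog 2 n)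
    (Nat.le_mul_of_pos_left _ (by omega))
  have h2 := h.treeTime_le (2 ^ e)
  have hN : (sizes e m n).N = m * n := rfl
  rw [hN] at h1 h2
  have hY8 := h.eight_le
  calc equilibriumTime e m n ≤ m * n * Y ^ 5 + (m * n * Y ^ (8 + 3 * 2 ^ e) + m * n) := by
        have : 1 ≤ m * n := Nat.mul_pos (by omega) hn
        rw [equilibriumTime]
        omega
    _ = m * n * (Y ^ 5 + Y ^ (8 + 3 * 2 ^ e) + 1) := by ring
    _ ≤ m * n * Y ^ (5 * 2 ^ e) := by
        refine Nat.mul_le_mul_left _ ?_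
        have a1 : Y ^ 5 ≤ Y ^ (8 + 3 * 2 ^ e) := Nat.pow_le_pow_right (by omega) (by omega)
        have a2 : 1 ≤ Y ^ (8 + 3 * 2 ^ e) := Nat.one_le_pow _ _ (by omega)
        have a3 : Y * Y ^ (8 + 3 * 2 ^ e) ≤ Y ^ (5 * 2 ^ e) := by
          rw [← pow_succ']
          exact Nat.pow_le_pow_right (by omega) (by omega)
        have a4 := Nat.mul_le_mul_right (Y ^ (8 + 3 * 2 ^ e)) hY8
        omega

/-- A polylogarithmic factor is smaller than the number of profiles of the other players. -/
theorem exists_polylog_le (c a : ℝ) {δ : ℝ} (hδ : 0 < δ) :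
    ∃ N : ℕ, ∀ m n : ℕ, 2 ≤ m → 2 ≤ n → N ≤ m * n →
      c * ((m : ℝ) * n * Real.log ((m : ℝ) * n) ^ a) ≤ δ * ((m : ℝ) * (n : ℝ) ^ m) := by
  have h := (isLittleO_log_rpow_rpow_atTop a
    (show (0 : ℝ) < 1 / 2 by norm_num)).const_mul_left c
  obtain ⟨N, hN⟩ := eventually_atTop.1
    ((tendsto_natCast_atTop_atTop (R := ℝ)).eventually (h.bound hδ))
  refine ⟨N, fun m n hm hn hmn => ?_⟩
  have hb := hN (m * n) hmn
  obtain ⟨k, rfl⟩ := Nat.exists_eq_add_of_le' hm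
  -- n^(m-1) is at least the square root of mn, which outgrows every power of the logarithm.
  have hsq : (((k + 2 : ℕ) : ℝ) * n) ^ (1 / 2 : ℝ) ≤ (n : ℝ) ^ (k + 1) := by
    rw [← Real.sqrt_eq_rpow]
    refine Real.sqrt_le_iff.2 ⟨by positivity, ?_⟩
    have h1 : k + 2 ≤ n ^ (2 * k + 1) := by
      have h2 : k + 1 < 2 ^ (k + 1) := Nat.lt_two_pow_self
      calc k + 2 ≤ 2 ^ (k + 1) := h2
        _ ≤ 2 ^ (2 * k + 1) := Nat.pow_le_pow_right (by norm_num) (by omega)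
        _ ≤ n ^ (2 * k + 1) := Nat.pow_le_pow_left hn _
    have h3 : (k + 2) * n ≤ (n ^ (k + 1)) ^ 2 := by
      calc (k + 2) * n ≤ n ^ (2 * k + 1) * n := Nat.mul_le_mul_right _ h1
        _ = _ := by ring
    exact_mod_cast h3
  rw [Nat.cast_mul, Real.norm_eq_abs, Real.norm_eq_abs,
    abs_of_nonneg (Real.rpow_nonneg (by positivity) _)] at hb
  have hb' := (le_abs_self _).trans (hb.trans (mul_le_mul_of_nonneg_left hsq hδ.le))
  calc c * (((k + 2 : ℕ) : ℝ) * n * Real.log (((k + 2 : ℕ) : ℝ) * n) ^ a)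
      = ((k + 2 : ℕ) : ℝ) * n * (c * Real.log (((k + 2 : ℕ) : ℝ) * n) ^ a) := by ring
    _ ≤ ((k + 2 : ℕ) : ℝ) * n * (δ * (n : ℝ) ^ (k + 1)) := by gcongr
    _ = _ := by ring

/-- The power 2^L is at most 4mn and log 2 ≤ log(mn), so L log 2 ≤ 3 log(mn); and 3 / log 2 < 5. -/
theorem clog_add_clog_le {m n : ℕ} (hm : 2 ≤ m) (hn : 1 ≤ n) :
    ((Nat.clog 2 m + Nat.clog 2 n : ℕ) : ℝ) ≤ 5 * Real.log ((m : ℝ) * n) := by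
  have hm' : (0 : ℝ) < m := by positivity
  have hn' : (0 : ℝ) < n := by positivity
  have h1 : ((2 : ℝ) ^ (Nat.clog 2 m + Nat.clog 2 n)) ≤ 4 * ((m : ℝ) * n) := by
    have := Nat.mul_le_mul (two_pow_clog_le (show 1 ≤ m by omega)) (two_pow_clog_le hn)
    rw [pow_add]
    calc _ ≤ (2 * m : ℝ) * (2 * n) := by exact_mod_cast this
      _ = _ := by ring
  have h2 := Real.log_le_log (by positivity) h1
  rw [Real.log_pow, Real.log_mul (by norm_num) (by positivity),
    show (4 : ℝ) = 2 ^ 2 by norm_num, Real.log_pow] at h2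
  have h3 : Real.log 2 ≤ Real.log ((m : ℝ) * n) := by
    refine Real.log_le_log (by norm_num) ?_
    have : 2 ≤ m * n := by nlinarith
    exact_mod_cast this
  have h4 := Real.log_two_gt_d9
  push_cast at h2 ⊢
  nlinarith

/-! ### The success probability -/

open Classical in
theorem successProb_equilibriumProg_ge {m n : ℕ} (hm : 2 ≤ m) (hn : 1 ≤ n) (G : Game m n) {e : ℕ}
    {ε : ℝ} (hε : 6 / (2 ^ e : ℕ) ≤ ε) :
    1 - (((sizes e m n).M ^ (sizes e m n).D : ℕ) * (m * n) : ℝ)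
        * (2 * Real.exp (-((sizes e m n).K * (1 / (sizes e m n).D) ^ 2 / 4)))
      ≤ (equilibriumProg e).successProb G ε := by
  set q := sizes e m n with hq
  have hL := sizes_log_pos n hm
  have hK : 0 < q.K := by
    simp only [hq, sizes]
    positivity
  have hD : 0 < q.D := by
    simp only [hq, sizes]
    positivity
  have hcard : (0 : ℝ) < Fintype.card (Samples q) := by
    rw [card_samples]
    positivity
  have hbad := card_not_accurate_le (q := q) G.table_mem hK hD
  have hsplit : ((Finset.univ.filter fun x : Samples q => Accurate q G.table x).card : ℝ)
      + (Finset.univ.filter fun x : Samples q => ¬ Accurate q G.table x).card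
      = Fintype.card (Samples q) := by
    exact_mod_cast Finset.card_filter_add_card_filter_not (s := Finset.univ) _
  have hprob := fairCoins_real_preimage _ (samples q) (samples_eq_iff q) (card_samples q)
    (Finset.univ.filter fun x : Samples q => Accurate q G.table x)
  calc _ ≤ fairCoins.real {c | samples q c
        ∈ Finset.univ.filter fun x : Samples q => Accurate q G.table x} := by
        rw [hprob, le_div_iff₀ hcard, sub_mul, one_mul]
        have e1 : (q.m : ℝ) = m := rfl
        have e2 : (q.n : ℝ) = n := rfl
        rw [e1, e2] at hbad
        linarith
    _ ≤ _ := by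
        -- Monotonicity holds for arbitrary sets, so the success event need not be shown measurable.
        refine measureReal_mono fun coins hc => ?_
        obtain ⟨s, t, h1, -, h2, h3⟩ := equilibriumProg_runs G.table_mem coins e m n hm hn
        exact ⟨s, t, h1, isSolution_of_accurate hm hn G coins e hε
          (Finset.mem_filter.1 hc).2 h2 h3⟩

/-- With ℓ = log(mn) ≤ L, the failure bound has exponent at most D(D + L) + ℓ + 1 - 2D²L², and this
is at most -ℓ². -/
theorem failure_le {m n e : ℕ} (hm : 2 ≤ m) (hn : 1 ≤ n) (he : 3 ≤ e) :
    (((sizes e m n).M ^ (sizes e m n).D : ℕ) * (m * n) : ℝ)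
        * (2 * Real.exp (-((sizes e m n).K * (1 / (sizes e m n).D) ^ 2 / 4)))
      ≤ 1 / ((m : ℝ) * n) ^ Real.log ((m * n : ℕ) : ℝ) := by
  have hm' : (0 : ℝ) < m := by positivity
  have hn' : (0 : ℝ) < n := by positivity
  have hmn : (0 : ℝ) < (m : ℝ) * n := by positivity
  have hLpos : (1 : ℝ) ≤ ((Nat.clog 2 m + Nat.clog 2 n : ℕ) : ℝ) := by
    exact_mod_cast sizes_log_pos n hm
  have hℓ : Real.log ((m : ℝ) * n) ≤ ((Nat.clog 2 m + Nat.clog 2 n : ℕ) : ℝ) := by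
    rw [Real.log_mul hm'.ne' hn'.ne']
    push_cast
    exact add_le_add (log_le_clog m) (log_le_clog n)
  have hℓ0 : 0 ≤ Real.log ((m : ℝ) * n) := by
    refine Real.log_nonneg ?_
    have : 1 ≤ m * n := Nat.mul_pos (by omega) hn
    exact_mod_cast this
  have h8 : (8 : ℝ) ≤ 2 ^ e := by
    calc (8 : ℝ) = 2 ^ 3 := by norm_num
      _ ≤ 2 ^ e := pow_le_pow_right₀ (by norm_num) he
  -- This bounds log(D²) by D; it uses e ≥ 3.
  have heD : (2 * e : ℝ) ≤ 2 ^ e := by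
    have : 2 * e ≤ 2 ^ e := by
      obtain ⟨k, rfl⟩ := Nat.exists_eq_add_of_le' he
      have := Nat.lt_two_pow_self (n := k)
      rw [pow_add]
      omega
    exact_mod_cast this
  set L : ℝ := ((Nat.clog 2 m + Nat.clog 2 n : ℕ) : ℝ) with hL
  set D : ℝ := 2 ^ e with hD
  set ℓ := Real.log ((m : ℝ) * n) with hℓdef
  have hDpos : 0 < D := by linarith
  have hM : (((sizes e m n).M ^ (sizes e m n).D : ℕ) : ℝ)
      = Real.exp (2 ^ e * Real.log (D ^ 2 * L)) := by
    have h1 : ((sizes e m n).M : ℝ) = D ^ 2 * L := by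
      simp only [sizes]
      push_cast
      rw [hL]
      push_cast
      rfl
    have h2 : (sizes e m n).D = 2 ^ e := rfl
    rw [Nat.cast_pow, h1, h2, mul_comm, ← Real.log_rpow (by positivity),
      Real.exp_log (by positivity), ← Real.rpow_natCast]
    push_cast
    rfl
  have hK : ((sizes e m n).K : ℝ) * (1 / (sizes e m n).D) ^ 2 / 4 = 2 * D ^ 2 * L ^ 2 := by
    have h1 : ((sizes e m n).K : ℝ) = 8 * D ^ 4 * L ^ 2 := by
      simp only [sizes]
      push_cast
      rw [hL]
      push_cast
      rfl
    have h2 : ((sizes e m n).D : ℝ) = D := by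
      simp only [sizes]
      push_cast
      rfl
    rw [h1, h2]
    field_simp
    ring
  have hlogM : Real.log (D ^ 2 * L) ≤ D + L := by
    rw [Real.log_mul (by positivity) (by positivity), Real.log_pow, hD, Real.log_pow]
    have h2 := Real.log_two_lt_d9
    have h3 := Real.log_le_sub_one_of_pos (show 0 < L by linarith)
    have h4 : (e : ℝ) * Real.log 2 ≤ e * (1 / 2 + 1 / 2) := by gcongr; linarith
    push_cast
    linarith
  have h2 : (2 : ℝ) ≤ Real.exp 1 := by linarith [Real.add_one_le_exp (1 : ℝ)]
  have hr : 1 / ((m : ℝ) * n) ^ Real.log ((m * n : ℕ) : ℝ) = Real.exp (-(ℓ * ℓ)) := by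
    rw [Nat.cast_mul, Real.rpow_def_of_pos hmn, Real.exp_neg, one_div]
  rw [hM, hK, hr]
  calc Real.exp (2 ^ e * Real.log (D ^ 2 * L)) * ((m : ℝ) * n)
        * (2 * Real.exp (-(2 * D ^ 2 * L ^ 2)))
      ≤ Real.exp (D * (D + L)) * Real.exp ℓ * (Real.exp 1 * Real.exp (-(2 * D ^ 2 * L ^ 2))) := by
        rw [hℓdef, Real.exp_log hmn]
        gcongr
    _ = Real.exp (D * (D + L) + ℓ + 1 - 2 * D ^ 2 * L ^ 2) := by
        rw [← Real.exp_add, ← Real.exp_add, ← Real.exp_add]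
        congr 1
        ring
    _ ≤ Real.exp (-(ℓ * ℓ)) := by
        refine Real.exp_le_exp.2 ?_
        -- As L ≥ 1, one D²L² absorbs D², and the other absorbs DL + ℓ + 1 + ℓ² ≤ (D + 3)L².
        have a1 : L ≤ L ^ 2 := by nlinarith
        have a2 : ℓ * ℓ ≤ L ^ 2 := by nlinarith
        have a3 : D ^ 2 * 1 ≤ D ^ 2 * L ^ 2 := by gcongr; nlinarith
        have a4 : D * L ≤ D * L ^ 2 := by gcongr
        have a5 : (D + 3) * L ^ 2 ≤ D ^ 2 * L ^ 2 := by gcongr; nlinarith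
        nlinarith

/-! ### Large `ε`: an arbitrary pure profile -/

/-- Every player plays the action `0`. -/
def pureProfileProg : RAMProg :=
  .seq (.block [.const 2 1, .cast 0 2, .const 3 0, .const 4 1])
    (.seq (.loop (.le 4 0) (.block [.xstore 3 0, .add 3 3 1, .add 4 4 2])) (.block [.const 0 1]))

theorem pureProfileProg_runs {table : ℕ → ℝ} {coins : ℕ → Bool} {m n : ℕ} (hn : 1 ≤ n) :
    pureProfileProg.Runs table coins (RAMState.init m n) (4 * m + 6) fun s =>
      s.reg 0 = 1 ∧ ∀ i < m, ∀ j < n, s.xmem (i * n + j) = if j = 0 then 1 else 0 := by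
  refine (RAMProg.runs_block_seq ((RAMProg.runs_for (N := m) (tb := 3) (fun k s =>
    s.reg 0 = m ∧ s.reg 1 = n ∧ s.reg 2 = 1 ∧ s.reg 3 = k * n ∧ s.reg 4 = k + 1 ∧ s.xreg 0 = 1 ∧
      (∀ x, k * n ≤ x → s.xmem x = 0) ∧
      ∀ i < k, ∀ j < n, s.xmem (i * n + j) = if j = 0 then 1 else 0) ?_ ?_ ?_ ?_).seq
    (t' := 1) ?_)).mono (by simp; omega) fun _ h => h
  · rintro k - s ⟨-, -, -, -, h, -⟩
    exact h
  · rintro k - s ⟨h, -⟩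
    exact h
  · rintro k - s ⟨h0, h1, h2, h3, h4, h5, h6, h7⟩
    refine RAMProg.runs_block ?_ le_rfl
    simp only [runList, RAMInstr.run, List.foldl]
    refine ⟨by simp [h0], by simp [h1], by simp [h2], ?_, ?_, by simp [h5], ?_, ?_⟩
    · simp [h3, h1]
      ring
    · simp [h4, h2]
    · intro x hx
      rw [Nat.succ_mul] at hx
      rw [Function.update_of_ne (by omega), h6 x (by omega)]
    · intro i hi j hj
      rcases Nat.lt_succ_iff_lt_or_eq.1 hi with hi | rfl
      · have : (i + 1) * n ≤ k * n := Nat.mul_le_mul_right _ hi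
        rw [Nat.succ_mul] at this
        rw [Function.update_of_ne (by omega), h7 i hi j hj]
      · rw [h3]
        by_cases hj0 : j = 0
        · subst hj0
          simp [h5]
        · rw [Function.update_of_ne (by omega), h6 _ (by omega), if_neg hj0]
  · simp [runList, RAMInstr.run, RAMState.init]
  · rintro s ⟨-, -, -, -, -, -, -, h⟩
    refine RAMProg.runs_block ⟨?_, ?_⟩ le_rfl
    · simp [runList, RAMInstr.run]
    · exact h

/-- Utilities lie in [0, 1], so no swap gains more than 1. -/
theorem isSolution_of_one_le {m n : ℕ} (hn : 1 ≤ n) (G : Game m n) {ε : ℝ} (hε : 1 ≤ ε)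
    {s : RAMState} (h0 : s.reg 0 = 1)
    (hs : ∀ i < m, ∀ j < n, s.xmem (i * n + j) = if j = 0 then 1 else 0) : s.IsSolution G ε := by
  refine isSolution_of_swap_regret (b := 1) (T := 1) one_pos G one_pos
    (fun _ _ _ => ⟨0, hn⟩) h0 ?_ ?_
  · intro t ht i j
    obtain rfl : t = 0 := by omega
    rw [RAMState.strategy, zero_mul, zero_add, hs i i.2 j j.2]
    by_cases hj : (j : ℕ) = 0
    · have : (⟨0, hn⟩ : Fin n) = j := Fin.ext hj.symm
      simp [hj, this]
    · have : (⟨0, hn⟩ : Fin n) ≠ j := fun h => hj (by rw [← h])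
      simp [hj, this]
  · intro i φ
    have h : ∀ (S : Fin m → Fin 1 → Fin n) (j : Fin n), expectedUtility G S i j ∈ Set.Icc 0 1 := by
      intro S j
      simpa [expectedUtility] using G.u_mem i _
    simp only [Finset.range_one, Finset.sum_singleton, Finset.univ_unique, Nat.cast_one, mul_one]
    linarith [(h (fun _ _ => ⟨0, hn⟩) (φ ⟨0, hn⟩)).2, (h (fun _ _ => ⟨0, hn⟩) ⟨0, hn⟩).1]

theorem successProb_pureProfileProg {m n : ℕ} (hn : 1 ≤ n) (G : Game m n) {ε : ℝ} (hε : 1 ≤ ε) :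
    pureProfileProg.successProb G ε = 1 := by
  have : {coins | ∃ s t, pureProfileProg.RunsOn G coins s t ∧ s.IsSolution G ε} = Set.univ := by
    refine Set.eq_univ_of_forall fun coins => ?_
    obtain ⟨s, t, h1, -, h2, h3⟩ := pureProfileProg_runs (table := G.table) (coins := coins)
      (m := m) hn
    exact ⟨s, t, h1, isSolution_of_one_le hn G hε h2 h3⟩
  rw [RAMProg.successProb, this, probReal_univ]

/-! ### The theorem -/

theorem log_two_le_log_mul {m n : ℕ} (hm : 2 ≤ m) (hn : 1 ≤ n) :
    Real.log 2 ≤ Real.log ((m : ℝ) * n) := by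
  refine Real.log_le_log (by norm_num) ?_
  have : 2 ≤ m * n := by nlinarith
  exact_mod_cast this

theorem one_le_rpow_div_log_two {m n : ℕ} (hm : 2 ≤ m) (hn : 1 ≤ n) {a : ℝ} (ha : 0 ≤ a) :
    1 ≤ (Real.log ((m : ℝ) * n) / Real.log 2) ^ a := by
  refine Real.one_le_rpow ?_ ha
  rw [one_le_div (Real.log_pos (by norm_num))]
  exact log_two_le_log_mul hm hn

theorem equilibriumTime_le_log {e m n : ℕ} (he : 3 ≤ e) (hm : 2 ≤ m) (hn : 1 ≤ n) :
    (equilibriumTime e m n : ℝ)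
      ≤ (m : ℝ) * n * (2 ^ e * (5 * Real.log ((m : ℝ) * n))) ^ (5 * 2 ^ e) := by
  have h : (equilibriumTime e m n : ℝ) ≤ (m : ℝ) * n
      * (2 ^ e * ((Nat.clog 2 m + Nat.clog 2 n : ℕ) : ℝ)) ^ (5 * 2 ^ e) := by
    exact_mod_cast equilibriumTime_le he hm hn
  refine h.trans ?_
  gcongr
  exact clog_add_clog_le hm hn

/-- At `mn = 2` the logarithm is below 1, where enlarging the exponent would lower the power. Hence
the division by log 2, paid for by the constant. -/
theorem equilibriumTime_le_const {e : ℕ} (he : 3 ≤ e) {a : ℝ} (ha : (5 * 2 ^ e : ℕ) ≤ a) :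
    ∃ c : ℝ, ∀ m n : ℕ, 2 ≤ m → 1 ≤ n →
      (equilibriumTime e m n : ℝ) ≤ c * ((m : ℝ) * n * Real.log ((m : ℝ) * n) ^ a) := by
  refine ⟨(2 ^ e * 5) ^ (5 * 2 ^ e) * (1 / Real.log 2) ^ a, fun m n hm hn => ?_⟩
  refine (equilibriumTime_le_log he hm hn).trans ?_
  have hlog2 : 0 < Real.log 2 := Real.log_pos (by norm_num)
  have hℓ2 := log_two_le_log_mul hm hn
  set ℓ := Real.log ((m : ℝ) * n)
  have h1 : ℓ ^ (5 * 2 ^ e) ≤ (1 / Real.log 2) ^ a * ℓ ^ a := by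
    calc ℓ ^ (5 * 2 ^ e) ≤ (ℓ / Real.log 2) ^ (5 * 2 ^ e) := by
          refine pow_le_pow_left₀ (by linarith) ?_ _
          rw [le_div_iff₀ hlog2]
          nlinarith [Real.log_two_lt_d9]
      _ = (ℓ / Real.log 2) ^ ((5 * 2 ^ e : ℕ) : ℝ) := (Real.rpow_natCast _ _).symm
      _ ≤ (ℓ / Real.log 2) ^ a :=
          Real.rpow_le_rpow_of_exponent_le ((one_le_div hlog2).2 hℓ2) ha
      _ = _ := by
          rw [← Real.mul_rpow (by positivity) (by linarith)]
          congr 1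
          ring
  calc (m : ℝ) * n * (2 ^ e * (5 * ℓ)) ^ (5 * 2 ^ e)
      = (2 ^ e * 5) ^ (5 * 2 ^ e) * (m * n * ℓ ^ (5 * 2 ^ e)) := by
        rw [← mul_assoc, mul_pow]
        ring
    _ ≤ (2 ^ e * 5) ^ (5 * 2 ^ e) * (m * n * ((1 / Real.log 2) ^ a * ℓ ^ a)) := by gcongr
    _ = _ := by ring

/-- For 1/ε ≤ log n also D ≤ 12 log n, so the base DL of the time bound is itself polylogarithmic
and the factor depending on ε goes into the exponent. -/
theorem equilibriumTime_le_uniform {e m n : ℕ} (he : 3 ≤ e) (hm : 2 ≤ m) (hn : 1 ≤ n) {x : ℝ}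
    (hx : 1 ≤ x) (hxe : 2 ^ e ≤ 12 * x) (hxn : x ≤ Real.log n) :
    (equilibriumTime e m n : ℝ) ≤ (m : ℝ) * n * Real.log ((m : ℝ) * n) ^ (600 * x) := by
  refine (equilibriumTime_le_log he hm hn).trans ?_
  have hm' : (0 : ℝ) < m := by positivity
  have hn' : (0 : ℝ) < n := by positivity
  have hℓ : Real.log n + Real.log 2 ≤ Real.log ((m : ℝ) * n) := by
    rw [Real.log_mul hm'.ne' hn'.ne', add_comm]
    gcongr
    exact_mod_cast hm
  have h2 := Real.log_two_gt_d9
  set ℓ := Real.log ((m : ℝ) * n)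
  have hℓ1 : 1.69 ≤ ℓ := by linarith
  -- The base is at most 60ℓ², and 60 ≤ ℓ^8 because ℓ ≥ 1 + log 2.
  have hbase : 2 ^ e * (5 * ℓ) ≤ ℓ ^ 10 := by
    have h8 : (60 : ℝ) ≤ ℓ ^ 8 := by
      calc (60 : ℝ) ≤ 1.69 ^ 8 := by norm_num
        _ ≤ ℓ ^ 8 := by gcongr
    calc 2 ^ e * (5 * ℓ) ≤ (12 * ℓ) * (5 * ℓ) := by
          gcongr
          linarith
      _ = 60 * ℓ ^ 2 := by ring
      _ ≤ ℓ ^ 8 * ℓ ^ 2 := by gcongr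
      _ = ℓ ^ 10 := by ring
  gcongr
  calc (2 ^ e * (5 * ℓ)) ^ (5 * 2 ^ e) ≤ (ℓ ^ 10) ^ (5 * 2 ^ e) := by gcongr
    _ = ℓ ^ ((10 * (5 * 2 ^ e) : ℕ) : ℝ) := by rw [← pow_mul, Real.rpow_natCast]
    _ ≤ ℓ ^ (600 * x) := by
        refine Real.rpow_le_rpow_of_exponent_le (by linarith) ?_
        push_cast
        linarith

theorem corollary6 :
    ∃ C : ℝ, 0 < C ∧ ∃ ω : ℕ → ℝ, Tendsto ω atTop atTop ∧
      ∀ ε : ℝ, 0 < ε → ∃ (p : RAMProg) (time : ℕ → ℕ → ℕ),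
        -- on every game and for all coin tosses, `p` halts after at most `time m n` steps
        (∀ m n : ℕ, 2 ≤ m → 1 ≤ n → ∀ (G : Game m n) (coins : ℕ → Bool),
          ∃ s t, p.RunsOn G coins s t ∧ t ≤ time m n) ∧
        -- success probability
        (∀ m n : ℕ, 2 ≤ m → 1 ≤ n → ∀ G : Game m n,
          1 - 1 / ((m : ℝ) * n) ^ ω (m * n) ≤ p.successProb G ε) ∧
        -- running time for fixed `ε`
        (∃ c : ℝ, ∀ m n : ℕ, 2 ≤ m → 1 ≤ n →
          (time m n : ℝ) ≤ c * ((m : ℝ) * n * Real.log ((m : ℝ) * n) ^ (C / ε))) ∧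
        -- running time in the regime `ε ≥ 1 / log n`, with a factor that does not depend on `ε`
        (∀ m n : ℕ, 2 ≤ m → 1 ≤ n → 1 / ε ≤ Real.log n →
          (time m n : ℝ) ≤ C * ((m : ℝ) * n * Real.log ((m : ℝ) * n) ^ (C / ε))) ∧
        -- the running time is sublinear in the size `m * n ^ m` of the description of the game
        (∀ δ : ℝ, 0 < δ → ∃ N : ℕ, ∀ m n : ℕ, 2 ≤ m → 2 ≤ n → N ≤ m * n →
          (time m n : ℝ) ≤ δ * ((m : ℝ) * (n : ℝ) ^ m)) := by
  -- 600 = 12 · 5 · 10: D ≤ 12/ε, the time exponent 5D, and a base of at most ℓ^10.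
  refine ⟨600, by norm_num, fun N => Real.log N,
    Real.tendsto_log_atTop.comp tendsto_natCast_atTop_atTop, fun ε hε => ?_⟩
  suffices h : ∃ (p : RAMProg) (time : ℕ → ℕ → ℕ),
      (∀ m n : ℕ, 2 ≤ m → 1 ≤ n → ∀ (G : Game m n) (coins : ℕ → Bool),
        ∃ s t, p.RunsOn G coins s t ∧ t ≤ time m n) ∧
      (∀ m n : ℕ, 2 ≤ m → 1 ≤ n → ∀ G : Game m n,
        1 - 1 / ((m : ℝ) * n) ^ Real.log (m * n : ℕ) ≤ p.successProb G ε) ∧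
      (∃ c : ℝ, ∀ m n : ℕ, 2 ≤ m → 1 ≤ n →
        (time m n : ℝ) ≤ c * ((m : ℝ) * n * Real.log ((m : ℝ) * n) ^ (600 / ε))) ∧
      (∀ m n : ℕ, 2 ≤ m → 1 ≤ n → 1 / ε ≤ Real.log n →
        (time m n : ℝ) ≤ 600 * ((m : ℝ) * n * Real.log ((m : ℝ) * n) ^ (600 / ε))) by
    obtain ⟨p, time, h1, h2, ⟨c, h3⟩, h4⟩ := h
    refine ⟨p, time, h1, h2, ⟨c, h3⟩, h4, fun δ hδ => ?_⟩
    obtain ⟨N, hN⟩ := exists_polylog_le c (600 / ε) hδ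
    exact ⟨N, fun m n hm hn hmn => (h3 m n hm (by omega)).trans (hN m n hm hn hmn)⟩
  have hlog2 : 0 < Real.log 2 := Real.log_pos (by norm_num)
  rcases le_or_gt 1 ε with h1 | h1
  · have htime : ∀ m n : ℕ, 2 ≤ m → 1 ≤ n → ((4 * m + 6 : ℕ) : ℝ) ≤ 7 * ((m : ℝ) * n) := by
      intro m n hm hn
      have : 4 * m + 6 ≤ 7 * (m * n) := by nlinarith
      exact_mod_cast this
    refine ⟨pureProfileProg, fun m _ => 4 * m + 6, fun m n hm hn G coins => ?_,
      fun m n hm hn G => ?_, ⟨7 * (1 / Real.log 2) ^ (600 / ε), fun m n hm hn => ?_⟩,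
      fun m n hm hn hlog => ?_⟩
    · obtain ⟨s, t, h, ht, -⟩ := pureProfileProg_runs (table := G.table) (coins := coins)
        (m := m) hn
      exact ⟨s, t, h, ht⟩
    · rw [successProb_pureProfileProg hn G h1]
      have : 0 ≤ 1 / ((m : ℝ) * n) ^ Real.log (m * n : ℕ) := by positivity
      linarith
    · have hℓ := log_two_le_log_mul hm hn
      calc ((4 * m + 6 : ℕ) : ℝ) ≤ 7 * ((m : ℝ) * n) * 1 := by
            rw [mul_one]
            exact htime m n hm hn
        _ ≤ 7 * ((m : ℝ) * n) * (Real.log ((m : ℝ) * n) / Real.log 2) ^ (600 / ε) := by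
            gcongr
            exact one_le_rpow_div_log_two hm hn (by positivity)
        _ = 7 * ((m : ℝ) * n)
              * ((1 / Real.log 2) ^ (600 / ε) * Real.log ((m : ℝ) * n) ^ (600 / ε)) := by
            rw [← Real.mul_rpow (by positivity) (by linarith), one_div_mul_eq_div]
        _ = _ := by ring
    -- A positive lower bound for log n excludes n = 1; then mn ≥ 4 and log(mn) ≥ 1, so the power is
    -- at least 1.
    · have hn2 : 2 ≤ n := by
        by_contra h
        obtain rfl : n = 1 := by omega
        rw [Nat.cast_one, Real.log_one] at hlog
        exact absurd hlog (not_le.2 (by positivity))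
      have hℓ : 1 ≤ Real.log ((m : ℝ) * n) := by
        have h4 : (2 : ℝ) ^ 2 ≤ (m : ℝ) * n := by
          have : 2 ^ 2 ≤ m * n := by nlinarith
          exact_mod_cast this
        have := Real.log_le_log (by norm_num) h4
        rw [Real.log_pow] at this
        push_cast at this
        linarith [Real.log_two_gt_d9]
      calc ((4 * m + 6 : ℕ) : ℝ) ≤ 600 * ((m : ℝ) * n * 1) := by
            have : 0 ≤ (m : ℝ) * n := by positivity
            linarith [htime m n hm hn]
        _ ≤ _ := by
            gcongr
            exact Real.one_le_rpow hℓ (by positivity)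
  · have h6 : 6 < 6 / ε := by
      rw [lt_div_iff₀ hε]
      linarith
    -- The depth D = 2^(k+1) lies between 6/ε, as accuracy demands, and 12/ε, as the time bound
    -- demands.
    obtain ⟨k, hk1, hk2⟩ := exists_nat_pow_near (show 1 ≤ 6 / ε by linarith)
      (show (1 : ℝ) < 2 by norm_num)
    have he : 3 ≤ k + 1 := by
      by_contra h
      have : (2 : ℝ) ^ (k + 1) ≤ 2 ^ 2 := pow_le_pow_right₀ (by norm_num) (by omega)
      linarith
    have hup : (2 : ℝ) ^ (k + 1) ≤ 12 * (1 / ε) := by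
      rw [pow_succ]
      calc (2 : ℝ) ^ k * 2 ≤ 6 / ε * 2 := by gcongr
        _ = _ := by ring
    have hlow : 6 / ((2 ^ (k + 1) : ℕ) : ℝ) ≤ ε := by
      push_cast
      rw [div_le_iff₀ (by positivity), mul_comm, ← div_le_iff₀ hε]
      exact hk2.le
    have hx : 600 / ε = 600 * (1 / ε) := by ring
    refine ⟨equilibriumProg (k + 1), equilibriumTime (k + 1), fun m n hm hn G coins => ?_,
      fun m n hm hn G => ?_, equilibriumTime_le_const he ?_, fun m n hm hn hlog => ?_⟩
    · obtain ⟨s, t, h, ht, -⟩ := equilibriumProg_runs G.table_mem coins (k + 1) m n hm hn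
      exact ⟨s, t, h, ht⟩
    · linarith [successProb_equilibriumProg_ge hm hn G hlow, failure_le hm hn he]
    · rw [hx]
      push_cast
      have : 0 < 1 / ε := by positivity
      linarith
    · rw [hx]
      have h := equilibriumTime_le_uniform he hm hn (x := 1 / ε)
        (by rw [le_div_iff₀ hε]; linarith) hup hlog
      have h0 : (0 : ℝ) ≤ equilibriumTime (k + 1) m n := by positivity
      linarith
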